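/- Fix $d\ge 0$ and $\lambda\in\mathbb R$. Let $\mathcal X$ be the set of continuous maps $x:\mathbb R^2\to\mathbb R^d$, $(s,t)\mapsto x_{st}$, with $x_{tt}=0$ and $x_{su}+x_{ut}=x_{st}$ for all $s,u,t$. For $I\subseteq\mathbb R$ let $\mathcal F_I$ be the $\sigma$-field generated by the coordinates $x\mapsto x_{st}$ with the closed interval between $s$ and $t$ contained in $I$, and $\mathcal F=\mathcal F_{\mathbb R}$. Let $\mu$ be the law on $(\mathcal X,\mathcal F)$ of the increments $x_{st}=B_t-B_s$ of a two-sided $d$-dimensional Brownian motion $B$. Intervals $I=[a,b]$ below are bounded, $a<b$, and $|I|=b-a$. Put $I^-=(-\infty,a)$, $I^+=(b,\infty)$, $I^c=I^-\cup I^+$. For $x,y\in\mathcal X$ let $x\otimes_I y$ be the unique element of $\mathcal X$ whose increments over intervals contained in $I$ are those of $x$ and whose increments over intervals contained in $I^c$ are those of $y$. Translations act by $(\tau_a x)_{st}=x_{s+a,t+a}$. Let $W:\mathbb R^d\times\mathbb R\to\mathbb R$ be continuous and $$U_I(x)=\int_{I\times I}W(x_{st},t-s)\,dt\,ds,\qquad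 V_I(x,y)=\int_{J(I)}\big[W((x\otimes_I y)_{st},t-s)-W((0\otimes_I y)_{st},t-s)\big]\,dt\,ds,$$ $$J(I)=(I^+\times I^-)\cup(I^-\times I^+)\cup(I\times I^c)\cup(I^c\times I).$$ Let $\Pi=(\pi_I)_I$, where $\pi_I(\cdot|y)$ is the image under $x\mapsto x\otimes_I y$ of the measure $Z_I(y)^{-1}e^{-\lambda U_I(x)-\lambda V_I(x,y)}\mu(dx)$, with $Z_I(y)=\int e^{-\lambda U_I(x)-\lambda V_I(x,y)}\mu(dx)$. A Gibbs measure for $\Pi$ is a probability measure $\nu$ on $(\mathcal X,\mathcal F)$ such that, for every $I$ and $A\in\mathcal F$, $\nu(A\,|\,\mathcal F_{I^c})=\pi_I(A|\cdot)$ $\nu$-almost surely. For $x\in\mathcal X$, $\xi\in\mathbb R^d$, $a\ge0$ let $$Q(x,\xi,a)=\int_{-\infty}^0dt\int_0^\infty ds\,\big|W(\xi+x_{st},a+s-t)-W(x_{st},a+s-t)\big|,$$ and consider the conditions on $W$: (H1) there is a constant $C$ with $\sup_{x\in\mathcal X}|U_I(x)|\le C|I|^2$ for all $I$, and $\sup_{x\in\mathcal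 X}\int_{-\infty}^{\infty}|W(x_{0t},|t|)|\,dt<\infty$; (H2) there is a constant $C$ with $\sup_{a\ge0}\sup_{x\in\mathcal X}Q(x,\xi,a)\le C(1+|\xi|)$ for all $\xi\in\mathbb R^d$. **Theorem.** Assume that $W$ and its time reversal $(\xi,t)\mapsto W(\xi,-t)$ satisfy (H1) and (H2) (if $W$ is even in $t$, this just says that $W$ satisfies (H1) and (H2)). Then $\Pi$ is well defined: the integrals defining $V_I(x,y)$ converge absolutely for all $I,x,y$, each $\pi_I$ is a proper probability kernel from $(\mathcal X,\mathcal F_{I^c})$ to $(\mathcal X,\mathcal F)$, and $\pi_K\pi_I=\pi_K$ whenever $I\subseteq K$. Moreover there exists at least one Gibbs measure $\nu$ for $\Pi$ that is translation invariant, i.e. $\nu\circ\tau_a^{-1}=\nu$ for all $a\in\mathbb R$. -/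

import Mathlib

open MeasureTheory ProbabilityTheory Set
open scoped ENNReal NNReal

namespace BrownianGibbs

/-- The space `𝒳` of increment paths: continuous maps `(s, t) ↦ x s t` from `ℝ × ℝ` to `ℝ^d`
with `x t t = 0` and the cocycle property `x s u + x u t = x s t`
(so `x s t = B t - B s` for a continuous path `B`). -/
structure IncrementPath (d : ℕ) where
  toFun : ℝ → ℝ → EuclideanSpace ℝ (Fin d)
  continuous_toFun : Continuous fun p : ℝ × ℝ => toFun p.1 p.2
  diag : ∀ t, toFun t t = 0
  cocycle : ∀ s u t, toFun s u + toFun u t = toFun s t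

namespace IncrementPath

variable {d : ℕ}

instance : CoeFun (IncrementPath d) fun _ => ℝ → ℝ → EuclideanSpace ℝ (Fin d) := ⟨toFun⟩

@[ext] theorem ext {x y : IncrementPath d} (h : ∀ s t, x s t = y s t) : x = y := by
  cases x; cases y; congr; funext s t; exact h s t

/-- The zero path. -/
instance : Zero (IncrementPath d) where
  zero :=
    { toFun := fun _ _ => 0
      continuous_toFun := continuous_const
      diag := fun _ => rfl
      cocycle := fun _ _ _ => add_zero _ }

/-- Translations: `(τ_a x) s t = x (s + a) (t + a)`. -/
def translate (a : ℝ) (x : IncrementPath d) : IncrementPath d where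
  toFun s t := x (s + a) (t + a)
  continuous_toFun := x.continuous_toFun.comp
    (f := fun p : ℝ × ℝ => (p.1 + a, p.2 + a)) (by fun_prop)
  diag t := x.diag _
  cocycle s u t := x.cocycle _ _ _

/-- The projection of `ℝ` onto `[a, b]` (for `a ≤ b`). -/
def clamp (a b t : ℝ) : ℝ := max a (min b t)

/-- `x ⊗_I y` for `I = [a, b]`: the path whose increments inside `I` are those of `x` and whose
increments over intervals contained in `Iᶜ` are those of `y`; see `concat_eq_inside`,
`concat_eq_left`, `concat_eq_right` and `eq_concat`. -/
def concat (a b : ℝ) (x y : IncrementPath d) : IncrementPath d where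
  toFun s t := x (clamp a b s) (clamp a b t) + (y s t - y (clamp a b s) (clamp a b t))
  continuous_toFun := by
    have hc : Continuous fun p : ℝ × ℝ => (clamp a b p.1, clamp a b p.2) := by
      unfold clamp; fun_prop
    exact (x.continuous_toFun.comp hc).add (y.continuous_toFun.sub (y.continuous_toFun.comp hc))
  diag t := by simp [x.diag, y.diag]
  cocycle s u t := by
    rw [← x.cocycle (clamp a b s) (clamp a b u) (clamp a b t),
      ← y.cocycle (clamp a b s) (clamp a b u) (clamp a b t), ← y.cocycle s u t]
    abel

theorem concat_eq_inside {a b s t : ℝ} (x y : IncrementPath d) (hs : s ∈ Icc a b)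
    (ht : t ∈ Icc a b) : concat a b x y s t = x s t := by
  have hs' : clamp a b s = s := by simp [clamp, hs.1, hs.2]
  have ht' : clamp a b t = t := by simp [clamp, ht.1, ht.2]
  simp [concat, hs', ht']

theorem concat_eq_left {a b s t : ℝ} (hab : a ≤ b) (x y : IncrementPath d) (hs : s ≤ a)
    (ht : t ≤ a) : concat a b x y s t = y s t := by
  have hs' : clamp a b s = a := by simp [clamp, hs, hs.trans hab]
  have ht' : clamp a b t = a := by simp [clamp, ht, ht.trans hab]
  simp [concat, hs', ht', x.diag, y.diag]

theorem concat_eq_right {a b s t : ℝ} (hab : a ≤ b) (x y : IncrementPath d) (hs : b ≤ s)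
    (ht : b ≤ t) : concat a b x y s t = y s t := by
  have hs' : clamp a b s = b := by simp [clamp, hs, hab]
  have ht' : clamp a b t = b := by simp [clamp, ht, hab]
  simp [concat, hs', ht', x.diag, y.diag]

/-- `concat a b x y` is the only path with these increments. -/
theorem eq_concat {a b : ℝ} (hab : a ≤ b) {x y z : IncrementPath d}
    (hin : ∀ s ∈ Icc a b, ∀ t ∈ Icc a b, z s t = x s t)
    (hleft : ∀ s ≤ a, ∀ t ≤ a, z s t = y s t)
    (hright : ∀ s ≥ b, ∀ t ≥ b, z s t = y s t) : z = concat a b x y := by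
  have hc : ∀ t, clamp a b t ∈ Icc a b := fun t => by simp [clamp, hab]
  have hy : ∀ t, z (clamp a b t) t = y (clamp a b t) t ∧ z t (clamp a b t) = y t (clamp a b t) := by
    intro t
    rcases le_total t a with h | h
    · have : clamp a b t = a := by simp [clamp, h, h.trans hab]
      rw [this]; exact ⟨hleft _ le_rfl _ h, hleft _ h _ le_rfl⟩
    · rcases le_total t b with h' | h'
      · have : clamp a b t = t := by simp [clamp, h, h']
        rw [this, z.diag, y.diag]; simp
      · have : clamp a b t = b := by simp [clamp, h', hab]
        rw [this]; exact ⟨hright _ le_rfl _ h', hright _ h' _ le_rfl⟩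
  ext1 s t
  rw [← z.cocycle s (clamp a b s) t, ← z.cocycle (clamp a b s) (clamp a b t) t, (hy s).2, (hy t).1,
    hin _ (hc s) _ (hc t)]
  simp only [concat]
  rw [← y.cocycle s (clamp a b s) t, ← y.cocycle (clamp a b s) (clamp a b t) t]
  abel

end IncrementPath

variable {d : ℕ}

/-- `𝓕_I = σ(X_{st} : [s, t] ⊆ I)`. -/
def sigmaIncr (I : Set ℝ) : MeasurableSpace (IncrementPath d) :=
  ⨆ (s : ℝ) (t : ℝ) (_ : uIcc s t ⊆ I),
    MeasurableSpace.comap (fun x : IncrementPath d => x s t) inferInstance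

/-- `𝒳` carries the `σ`-algebra generated by all increments. -/
instance : MeasurableSpace (IncrementPath d) := sigmaIncr univ

theorem sigmaIncr_le (I : Set ℝ) :
    sigmaIncr I ≤ (inferInstance : MeasurableSpace (IncrementPath d)) :=
  iSup_le fun s => iSup_le fun t => iSup_le fun _ =>
    le_iSup_of_le s (le_iSup_of_le t (le_iSup_of_le (subset_univ _) le_rfl))

/-- `μ` is the law of the increments of a two-sided `d`-dimensional Brownian motion:
`X_{st}` is a centred Gaussian vector with covariance `|t - s| Id`, and increments over
non-overlapping intervals are independent. -/
structure IsBrownianIncrementLaw (μ : Measure (IncrementPath d)) : Prop where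
  hasLaw : ∀ s t : ℝ, HasLaw (fun x : IncrementPath d => x s t)
    (multivariateGaussian 0 (|t - s| • (1 : Matrix (Fin d) (Fin d) ℝ))) μ
  indep : ∀ (n : ℕ) (t : Fin (n + 1) → ℝ), Monotone t →
    iIndepFun (fun (i : Fin n) (x : IncrementPath d) => x (t i.castSucc) (t i.succ)) μ

/-- `U_I(x) = ∫_{I × I} W(x_{st}, t - s) dt ds` for `I = [a, b]`. -/
noncomputable def energyU (W : EuclideanSpace ℝ (Fin d) → ℝ → ℝ) (a b : ℝ)
    (x : IncrementPath d) : ℝ :=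
  ∫ p in Icc a b ×ˢ Icc a b, W (x p.1 p.2) (p.2 - p.1)

/-- The cone `J(I) = (I⁺ × I⁻) ∪ (I⁻ × I⁺) ∪ (I × Iᶜ) ∪ (Iᶜ × I)` for `I = [a, b]`. -/
def cone (a b : ℝ) : Set (ℝ × ℝ) :=
  (Ioi b ×ˢ Iio a) ∪ (Iio a ×ˢ Ioi b) ∪ (Icc a b ×ˢ (Icc a b)ᶜ) ∪ ((Icc a b)ᶜ ×ˢ Icc a b)

/-- The integrand `W((x ⊗_I y)_{st}, t - s) - W((0 ⊗_I y)_{st}, t - s)` at `p = (s, t)`. -/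
noncomputable def interactionIntegrand (W : EuclideanSpace ℝ (Fin d) → ℝ → ℝ) (a b : ℝ)
    (x y : IncrementPath d) (p : ℝ × ℝ) : ℝ :=
  W (IncrementPath.concat a b x y p.1 p.2) (p.2 - p.1)
    - W (IncrementPath.concat a b 0 y p.1 p.2) (p.2 - p.1)

/-- `V_I(x, y)`, the integral of the interaction integrand over the cone `J(I)`. -/
noncomputable def energyV (W : EuclideanSpace ℝ (Fin d) → ℝ → ℝ) (a b : ℝ)
    (x y : IncrementPath d) : ℝ :=
  ∫ p in cone a b, interactionIntegrand W a b x y p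

/-- The Boltzmann weight `exp(-λ U_I(x) - λ V_I(x, y))`. -/
noncomputable def weight (W : EuclideanSpace ℝ (Fin d) → ℝ → ℝ) (lam a b : ℝ)
    (x y : IncrementPath d) : ℝ≥0∞ :=
  ENNReal.ofReal (Real.exp (-lam * energyU W a b x - lam * energyV W a b x y))

/-- The normalisation `Z_I(y)`. -/
noncomputable def partitionZ (μ : Measure (IncrementPath d))
    (W : EuclideanSpace ℝ (Fin d) → ℝ → ℝ) (lam a b : ℝ) (y : IncrementPath d) : ℝ≥0∞ :=
  ∫⁻ x, weight W lam a b x y ∂μ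

/-- `π_I(dx | y) = Z_I(y)⁻¹ exp(-λ U_I(x) - λ V_I(x, y)) (μ_I × δ_{Iᶜ, y})(dx)` for `I = [a, b]`.
The weight only sees the increments of `x` in `I`, so this is the image under `x ↦ x ⊗_I y` of
the normalised weighted measure. -/
noncomputable def gibbsKernel (μ : Measure (IncrementPath d))
    (W : EuclideanSpace ℝ (Fin d) → ℝ → ℝ) (lam a b : ℝ) (y : IncrementPath d) :
    Measure (IncrementPath d) :=
  (partitionZ μ W lam a b y)⁻¹ •
    (μ.withDensity fun x => weight W lam a b x y).map fun x => IncrementPath.concat a b x y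

/-- A family `π a b y = π_{[a,b]}(· | y)` is a specification: the `π_I` are proper probability
kernels from `(𝒳, 𝓕_{Iᶜ})` to `(𝒳, 𝓕)`, and `π_K π_I = π_K` for `I ⊆ K`. -/
structure IsSpecification (π : ℝ → ℝ → IncrementPath d → Measure (IncrementPath d)) : Prop where
  prob : ∀ a b, a < b → ∀ y, IsProbabilityMeasure (π a b y)
  measurable : ∀ a b, a < b → ∀ A : Set (IncrementPath d), MeasurableSet A →
    Measurable[sigmaIncr (Icc a b)ᶜ] fun y => π a b y A
  proper : ∀ a b, a < b → ∀ y, ∀ A B : Set (IncrementPath d), MeasurableSet A →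
    MeasurableSet[sigmaIncr (Icc a b)ᶜ] B → π a b y (A ∩ B) = B.indicator 1 y * π a b y A
  consistent : ∀ a b a' b', a < b → a' ≤ a → b ≤ b' → ∀ y, ∀ A : Set (IncrementPath d),
    MeasurableSet A → ∫⁻ z, π a b z A ∂(π a' b' y) = π a' b' y A

/-- `ν` is a Gibbs measure for `π`: a probability measure such that, for every bounded interval
`I`, `π_I(A | ·)` is a version of the conditional probability `ν(A | 𝓕_{Iᶜ})`. -/
structure IsGibbsMeasure (π : ℝ → ℝ → IncrementPath d → Measure (IncrementPath d))
    (ν : Measure (IncrementPath d)) : Prop where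
  prob : IsProbabilityMeasure ν
  condProb : ∀ a b, a < b → ∀ A : Set (IncrementPath d), MeasurableSet A →
    ν⟦A | sigmaIncr (Icc a b)ᶜ⟧ =ᵐ[ν] fun y => (π a b y).real A

/-- `Q(x, ξ, a)`, the integral over `t < 0 < s` of
`|W(ξ + x_{st}, a + s - t) - W(x_{st}, a + s - t)|`. -/
noncomputable def Q (W : EuclideanSpace ℝ (Fin d) → ℝ → ℝ) (x : IncrementPath d)
    (ξ : EuclideanSpace ℝ (Fin d)) (a : ℝ) : ℝ≥0∞ :=
  ∫⁻ t in Iio (0 : ℝ), ∫⁻ s in Ioi (0 : ℝ),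
    ‖W (ξ + x s t) (a + s - t) - W (x s t) (a + s - t)‖ₑ

/-- `sup_x |U_I(x)| ≤ C |I|²` and `sup_x ∫_ℝ |W(x_{0t}, |t|)| dt < ∞`. -/
def H1 (W : EuclideanSpace ℝ (Fin d) → ℝ → ℝ) : Prop :=
  (∃ C : ℝ, ∀ a b : ℝ, a < b → ∀ x : IncrementPath d, |energyU W a b x| ≤ C * (b - a) ^ 2) ∧
    (⨆ x : IncrementPath d, ∫⁻ t : ℝ, ‖W (x 0 t) |t|‖ₑ) < ∞

/-- `sup_{a ≥ 0} sup_x Q(x, ξ, a) ≤ C (1 + |ξ|)` for all `ξ`. -/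
def H2 (W : EuclideanSpace ℝ (Fin d) → ℝ → ℝ) : Prop :=
  ∃ C : ℝ, ∀ (ξ : EuclideanSpace ℝ (Fin d)) (a : ℝ), 0 ≤ a → ∀ x : IncrementPath d,
    Q W x ξ a ≤ ENNReal.ofReal (C * (1 + ‖ξ‖))

/-- The time reversal `(ξ, t) ↦ W(ξ, -t)` of a pair potential; it is `W` if `W` is even in `t`. -/
def timeReversal (W : EuclideanSpace ℝ (Fin d) → ℝ → ℝ) : EuclideanSpace ℝ (Fin d) → ℝ → ℝ :=
  fun ξ t => W ξ (-t)

end BrownianGibbs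

/-!
The argument rests on one pointwise bound. A path of `IncrementPath d` is an arbitrary continuous
path up to its starting point, so it can follow approximate maximisers of `ξ ↦ |W ξ r|` as `r`
varies; hence the one-particle integral bound in (H1), for `W` and its time reversal, says that
`supPotential W`, the supremum of the potential over space, is integrable in time
(`lintegral_supPotential_lt_top`). Interactions within finite distance of `[a, b]` are controlled
by it. The interaction between the past and the future of `[a, b]` sees the inner path only through
its increment `x_ab`, and (H2) bounds it by a multiple of `1 + ‖x_ab‖`; its tails are small
uniformly in the boundary condition, because a path that nearly maximises the total interaction
across `[a, b]` does so already in a bounded window, and any other path can be attached to it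
outside. So `V` converges absolutely, the energy given the boundary condition is at most
`k (1 + ‖x_ab‖)` in absolute value, with `k` independent of the boundary condition, and it depends
little on the boundary condition far away.

Consistency of the Gibbs kernels holds because differences of energies are additive and because
the Brownian measure is unchanged when the increments in `[a, b]` are resampled independently
(`map_concat`). Translation covariance is inherited from the Brownian measure.

For the existence of a Gibbs measure, take Gibbs kernels on growing intervals with boundary
condition `0` and average them over translations (`averagedGibbs`). The local laws of these
measures are dominated, uniformly, by finite measures with density `exp (k (1 + ‖x_ab‖))` up to a
constant with respect to the Brownian measure. Dominated measures have setwise limits along an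
ultrafilter, so all local laws converge setwise along `hyperfilter ℕ`. As they have densities, the
limits are the marginals of a Markov chain of growing windows with explicit conditional densities,
and the Ionescu-Tulcea theorem yields a global law (`exists_local_limit`); no tightness argument or
topology on the path space is needed. The kernels are quasilocal (`exists_gibbsKernel_le_add`), so
the limit is invariant under each kernel and thus a Gibbs measure, and it is translation invariant
since translating the averaged laws changes them only by `O(1 / n)`.
-/

namespace BrownianGibbs

variable {d : ℕ}

/-! ### Increment paths as a measurable space -/

namespace IncrementPath

theorem measurable_eval (s t : ℝ) : Measurable fun x : IncrementPath d => x s t :=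
  Measurable.of_comap_le <| le_iSup_of_le s <| le_iSup_of_le t <|
    le_iSup_of_le (subset_univ _) le_rfl

theorem measurable_of_eval {α : Type*} [MeasurableSpace α] {f : α → IncrementPath d}
    (hf : ∀ s t, Measurable fun ω => f ω s t) : Measurable f := by
  rw [measurable_iff_comap_le]
  change MeasurableSpace.comap f (sigmaIncr univ) ≤ _
  rw [sigmaIncr, MeasurableSpace.comap_iSup]
  refine iSup_le fun s => ?_
  rw [MeasurableSpace.comap_iSup]
  refine iSup_le fun t => ?_
  rw [MeasurableSpace.comap_iSup]
  refine iSup_le fun _ => ?_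
  rw [MeasurableSpace.comap_comp]
  exact (hf s t).comap_le

theorem measurable_eval_uncurry :
    Measurable fun q : (ℝ × ℝ) × IncrementPath d => q.2 q.1.1 q.1.2 :=
  measurable_uncurry_of_continuous_of_measurable
    (u := fun (p : ℝ × ℝ) (x : IncrementPath d) => x p.1 p.2)
    (fun x => x.continuous_toFun) fun p => measurable_eval p.1 p.2

theorem measurable_eval_comp {α : Type*} [MeasurableSpace α] {f : α → IncrementPath d}
    {s t : α → ℝ} (hf : Measurable f) (hs : Measurable s) (ht : Measurable t) :
    Measurable fun ω => f ω (s ω) (t ω) :=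
  measurable_eval_uncurry.comp ((hs.prodMk ht).prodMk hf)

theorem measurable_concat (a b : ℝ) :
    Measurable fun p : IncrementPath d × IncrementPath d => concat a b p.1 p.2 := by
  refine measurable_of_eval fun s t => ?_
  exact ((measurable_eval _ _).comp measurable_fst).add
    (((measurable_eval s t).comp measurable_snd).sub ((measurable_eval _ _).comp measurable_snd))

theorem measurable_concat_left (a b : ℝ) (y : IncrementPath d) :
    Measurable fun x => concat a b x y :=
  (measurable_concat a b).comp (measurable_id.prodMk measurable_const)

theorem measurable_concat_right (a b : ℝ) (x : IncrementPath d) :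
    Measurable fun y => concat a b x y :=
  (measurable_concat a b).comp (measurable_const.prodMk measurable_id)

theorem measurable_translate_uncurry :
    Measurable fun p : ℝ × IncrementPath d => translate p.1 p.2 :=
  measurable_of_eval fun s t => measurable_eval_comp (s := fun p : ℝ × IncrementPath d => s + p.1)
    (t := fun p => t + p.1) measurable_snd (by fun_prop) (by fun_prop)

theorem measurable_translate (a : ℝ) : Measurable (translate (d := d) a) :=
  measurable_translate_uncurry.comp (measurable_const.prodMk measurable_id)

@[simp] theorem zero_apply (s t : ℝ) : (0 : IncrementPath d) s t = 0 := rfl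

theorem neg_apply_swap (x : IncrementPath d) (s t : ℝ) : -x s t = x t s := by
  have := x.cocycle s t s
  rw [x.diag] at this
  exact neg_eq_of_add_eq_zero_right this

theorem sub_left (x : IncrementPath d) (u s t : ℝ) : x u t - x u s = x s t := by
  rw [sub_eq_add_neg, neg_apply_swap, add_comm, x.cocycle]

/-! ### Clamping and concatenation -/

theorem clamp_mem {a b : ℝ} (hab : a ≤ b) (t : ℝ) : clamp a b t ∈ Icc a b := by
  simp [clamp, hab]

theorem clamp_of_mem {a b t : ℝ} (ht : t ∈ Icc a b) : clamp a b t = t := by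
  simp [clamp, ht.1, ht.2]

theorem clamp_of_le {a b t : ℝ} (hab : a ≤ b) (ht : t ≤ a) : clamp a b t = a := by
  simp [clamp, ht, ht.trans hab]

theorem clamp_of_ge {a b t : ℝ} (hab : a ≤ b) (ht : b ≤ t) : clamp a b t = b := by
  simp [clamp, ht, hab]

theorem clamp_clamp_outer {a b a' b' : ℝ} (hab : a ≤ b) (ha : a' ≤ a) (hb : b ≤ b') (t : ℝ) :
    clamp a' b' (clamp a b t) = clamp a b t :=
  clamp_of_mem ⟨ha.trans (clamp_mem hab t).1, (clamp_mem hab t).2.trans hb⟩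

theorem clamp_clamp_inner {a b a' b' : ℝ} (hab : a ≤ b) (ha : a' ≤ a) (hb : b ≤ b') (t : ℝ) :
    clamp a b (clamp a' b' t) = clamp a b t := by
  have hab' : a' ≤ b' := ha.trans (hab.trans hb)
  rcases le_total t a' with h | h
  · rw [clamp_of_le hab' h, clamp_of_le hab ha, clamp_of_le hab (h.trans ha)]
  · rcases le_total t b' with h' | h'
    · rw [clamp_of_mem (a := a') (b := b') ⟨h, h'⟩]
    · rw [clamp_of_ge hab' h', clamp_of_ge hab hb, clamp_of_ge hab (hb.trans h')]

theorem concat_apply (a b : ℝ) (x y : IncrementPath d) (s t : ℝ) : concat a b x y s t =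
    x (clamp a b s) (clamp a b t) + (y s t - y (clamp a b s) (clamp a b t)) := rfl

theorem concat_concat_nested {a b a' b' : ℝ} (hab : a ≤ b) (ha : a' ≤ a) (hb : b ≤ b')
    (u x y : IncrementPath d) :
    concat a' b' (concat a b u x) y = concat a b u (concat a' b' x y) := by
  ext1 s t
  simp only [concat_apply, clamp_clamp_outer hab ha hb, clamp_clamp_inner hab ha hb]
  abel

theorem concat_concat_right {a b a' b' : ℝ} (hab : a ≤ b) (ha : a' ≤ a) (hb : b ≤ b')
    (x u y : IncrementPath d) :
    concat a' b' x (concat a b u y) = concat a' b' x y := by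
  ext1 s t
  simp only [concat_apply, clamp_clamp_inner hab ha hb]
  abel

theorem concat_concat_left {a b a' b' : ℝ} (hab : a ≤ b) (ha : a' ≤ a) (hb : b ≤ b')
    (x z y : IncrementPath d) :
    concat a b (concat a' b' x z) y = concat a b x y := by
  ext1 s t
  simp only [concat_apply, clamp_clamp_outer hab ha hb]
  abel

theorem translate_concat (a b c : ℝ) (x y : IncrementPath d) :
    translate c (concat a b x y) = concat (a - c) (b - c) (translate c x) (translate c y) := by
  have h : ∀ t, clamp a b (t + c) = clamp (a - c) (b - c) t + c := by
    intro t
    simp only [clamp]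
    rw [← max_add_add_right, ← min_add_add_right, sub_add_cancel, sub_add_cancel]
  ext1 s t
  simp only [concat_apply, translate, h]

theorem translate_translate (a c : ℝ) (x : IncrementPath d) :
    translate a (translate c x) = translate (a + c) x := by
  ext1 s t
  simp only [translate, add_assoc]

/-! ### Laws of increment paths -/

/-- The vector of consecutive increments of a path along the grid `t`. -/
def gridIncr {n : ℕ} (t : Fin (n + 1) → ℝ) (x : IncrementPath d) :
    Fin n → EuclideanSpace ℝ (Fin d) :=
  fun i => x (t i.castSucc) (t i.succ)

theorem measurable_gridIncr {n : ℕ} (t : Fin (n + 1) → ℝ) :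
    Measurable (gridIncr (d := d) t) :=
  measurable_pi_lambda _ fun _ => measurable_eval _ _

theorem partialSum_gridIncr {n : ℕ} (t : Fin (n + 1) → ℝ) (x : IncrementPath d)
    (j : Fin (n + 1)) : Fin.partialSum (gridIncr t x) j = x (t 0) (t j) := by
  induction j using Fin.induction with
  | zero => simp [x.diag]
  | succ i ih => rw [Fin.partialSum_succ, ih, gridIncr, x.cocycle]

theorem measurable_partialSum {n : ℕ} (j : Fin (n + 1)) :
    Measurable fun v : Fin n → EuclideanSpace ℝ (Fin d) => Fin.partialSum v j := by
  induction j using Fin.induction with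
  | zero => simp
  | succ i ih =>
    simp only [Fin.partialSum_succ]
    exact ih.add (measurable_pi_apply i)

/-- A law on increment paths is determined by the laws of the increments along all grids that
contain a given finite set of times. -/
theorem measure_ext_of_gridIncr (S₀ : Finset ℝ) {P P' : Measure (IncrementPath d)}
    [IsProbabilityMeasure P]
    (h : ∀ (n : ℕ) (t : Fin (n + 1) → ℝ), Monotone t → (∀ s ∈ S₀, s ∈ range t) →
      P.map (gridIncr t) = P'.map (gridIncr t)) : P = P' := by
  set ev : IncrementPath d → (ℝ → EuclideanSpace ℝ (Fin d)) := fun x s => x 0 s with hev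
  have hevm : Measurable ev := measurable_pi_lambda _ fun s => measurable_eval 0 s
  have hfin : ∀ J : Finset ℝ, P.map (J.restrict ∘ ev) = P'.map (J.restrict ∘ ev) := by
    intro J
    -- a sorted enumeration of `J ∪ S₀ ∪ {0}` is a grid whose increments determine `x 0 s`, `s ∈ J`
    set K : Finset ℝ := insert 0 (J ∪ S₀) with hK
    obtain ⟨n, hn⟩ : ∃ n, K.card = n + 1 :=
      ⟨K.card - 1, (Nat.succ_pred_eq_of_pos (Finset.card_pos.2 ⟨0, by simp [hK]⟩)).symm⟩
    set t := K.orderEmbOfFin hn with ht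
    have hr : ∀ s ∈ K, ∃ i, t i = s := by
      intro s hs
      have : s ∈ range t := by rw [ht, Finset.range_orderEmbOfFin]; exact hs
      exact this
    obtain ⟨i0, hi0⟩ := hr 0 (by simp [hK])
    have hJ : ∀ s : J, ∃ i, t i = s := fun s => hr s (by simp [hK, s.2])
    choose idx hidx using hJ
    set G : (Fin n → EuclideanSpace ℝ (Fin d)) → (J → EuclideanSpace ℝ (Fin d)) :=
      fun v s => Fin.partialSum v (idx s) - Fin.partialSum v i0 with hG
    have hGm : Measurable G := measurable_pi_lambda _ fun s =>
      (measurable_partialSum _).sub (measurable_partialSum _)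
    have hcomp : J.restrict ∘ ev = G ∘ gridIncr t := by
      funext x
      funext s
      simp only [Function.comp, hG, partialSum_gridIncr, Finset.restrict, hev]
      rw [sub_left, hi0, hidx]
    rw [hcomp, ← Measure.map_map hGm (measurable_gridIncr _),
      ← Measure.map_map hGm (measurable_gridIncr _),
      h n t t.monotone fun s hs => hr s (by simp [hK, hs])]
  have hmap : P.map ev = P'.map ev := by
    have := Measure.isProbabilityMeasure_map (μ := P) hevm.aemeasurable
    refine IsProjectiveLimit.unique (P := fun J => (P.map ev).map J.restrict) (fun J => rfl)
      fun J => ?_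
    change (P'.map ev).map J.restrict = (P.map ev).map J.restrict
    rw [Measure.map_map (Finset.measurable_restrict J) hevm,
      Measure.map_map (Finset.measurable_restrict J) hevm, hfin]
  -- a path is recovered measurably from its values `x 0 s`
  refine Measure.ext fun A hA => ?_
  obtain ⟨B, hB, rfl⟩ : ∃ B, MeasurableSet B ∧ ev ⁻¹' B = A := by
    have : Measurable[MeasurableSpace.comap ev inferInstance] (id : IncrementPath d → _) := by
      refine @measurable_of_eval d _ (MeasurableSpace.comap ev inferInstance) _ fun s t => ?_
      have : (fun x : IncrementPath d => id x s t) = (fun f => f t - f s) ∘ ev := by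
        funext x; simp [hev, sub_left]
      rw [this]
      exact ((measurable_pi_apply t).sub (measurable_pi_apply s)).comp (comap_measurable ev)
    exact this hA
  rw [← Measure.map_apply hevm hB, ← Measure.map_apply hevm hB, hmap]

end IncrementPath

open IncrementPath

namespace IsBrownianIncrementLaw

variable {μ : Measure (IncrementPath d)}

theorem isProbabilityMeasure (hμ : IsBrownianIncrementLaw μ) : IsProbabilityMeasure μ :=
  (hμ.hasLaw 0 0).isProbabilityMeasure

theorem map_gridIncr (hμ : IsBrownianIncrementLaw μ) {n : ℕ} {t : Fin (n + 1) → ℝ}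
    (ht : Monotone t) : μ.map (gridIncr t) = Measure.pi fun i : Fin n =>
      multivariateGaussian 0 (|t i.succ - t i.castSucc| • (1 : Matrix (Fin d) (Fin d) ℝ)) := by
  have := hμ.isProbabilityMeasure
  have h := (hμ.indep n t ht).map_fun_eq_pi_map fun i => (measurable_eval _ _).aemeasurable
  unfold gridIncr
  rw [h]
  congr 1
  funext i
  exact (hμ.hasLaw _ _).map_eq

theorem map_translate (hμ : IsBrownianIncrementLaw μ) (c : ℝ) :
    μ.map (IncrementPath.translate c) = μ := by
  have := hμ.isProbabilityMeasure
  have := Measure.isProbabilityMeasure_map (μ := μ) (measurable_translate (d := d) c).aemeasurable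
  refine measure_ext_of_gridIncr ∅ fun n t ht _ => ?_
  rw [Measure.map_map (measurable_gridIncr t) (measurable_translate c), hμ.map_gridIncr ht]
  have : gridIncr t ∘ IncrementPath.translate c = gridIncr (d := d) fun i => t i + c := rfl
  rw [this, hμ.map_gridIncr fun i j hij => by simpa using ht hij]
  simp

end IsBrownianIncrementLaw

/-- Exchanging a set of coordinates between two independent copies of a product law leaves the law
of either copy unchanged. -/
theorem map_piecewise_prod_pi {ι : Type*} [Fintype ι] {β : ι → Type*}
    [∀ i, MeasurableSpace (β i)] (m : ∀ i, Measure (β i)) [∀ i, IsProbabilityMeasure (m i)]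
    (p : ι → Prop) [DecidablePred p] :
    ((Measure.pi m).prod (Measure.pi m)).map (fun q i => if p i then q.1 i else q.2 i) =
      Measure.pi m := by
  refine (Measure.pi_eq fun s hs => ?_).symm
  rw [Measure.map_apply _ (MeasurableSet.univ_pi hs)]
  · have : (fun (q : (∀ i, β i) × ∀ i, β i) i => if p i then q.1 i else q.2 i) ⁻¹' univ.pi s =
        (univ.pi fun i => if p i then s i else univ) ×ˢ
          (univ.pi fun i => if p i then univ else s i) := by
      ext q
      simp only [mem_preimage, mem_univ_pi, mem_prod, ← forall_and]
      refine forall_congr' fun i => ?_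
      split_ifs <;> simp
    rw [this, Measure.prod_prod, Measure.pi_pi, Measure.pi_pi, ← Finset.prod_mul_distrib]
    refine Finset.prod_congr rfl fun i _ => ?_
    split_ifs <;> simp
  · refine measurable_pi_lambda _ fun i => ?_
    split_ifs
    · exact (measurable_pi_apply i).comp measurable_fst
    · exact (measurable_pi_apply i).comp measurable_snd

namespace IsBrownianIncrementLaw

variable {μ : Measure (IncrementPath d)}

/-- Brownian increments inside and outside `[a, b]` are independent: gluing two independent copies
along `[a, b]` gives the same law. -/
theorem map_concat (hμ : IsBrownianIncrementLaw μ) {a b : ℝ} (hab : a ≤ b) :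
    (μ.prod μ).map (fun p => concat a b p.1 p.2) = μ := by
  classical
  have := hμ.isProbabilityMeasure
  have := Measure.isProbabilityMeasure_map (μ := μ.prod μ)
    (measurable_concat (d := d) a b).aemeasurable
  refine measure_ext_of_gridIncr {a, b} fun n t ht hab' => ?_
  obtain ⟨i, hi⟩ := hab' a (by simp)
  obtain ⟨j, hj⟩ := hab' b (by simp)
  rw [Measure.map_map (measurable_gridIncr t) (measurable_concat a b)]
  have hsplit : gridIncr t ∘ (fun p : IncrementPath d × IncrementPath d => concat a b p.1 p.2) =
      (fun (q : (Fin n → EuclideanSpace ℝ (Fin d)) × (Fin n → EuclideanSpace ℝ (Fin d))) k =>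
        if a ≤ t k.castSucc ∧ t k.succ ≤ b then q.1 k else q.2 k) ∘
        Prod.map (gridIncr t) (gridIncr t) := by
    funext p
    funext k
    have hk : t k.castSucc ≤ t k.succ := ht k.castSucc_le_succ
    simp only [Function.comp, gridIncr, Prod.map]
    split_ifs with h
    · exact concat_eq_inside _ _ ⟨h.1, hk.trans h.2⟩ ⟨h.1.trans hk, h.2⟩
    · by_cases h1 : a ≤ t k.castSucc
      · have h2 : b < t k.succ := not_le.1 fun h2 => h ⟨h1, h2⟩
        have h3 : b ≤ t k.castSucc := by
          rw [← hj] at h2 ⊢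
          have : j < k.succ := by
            by_contra hc
            exact absurd (ht (not_lt.1 hc)) (not_le.2 h2)
          exact ht (Fin.le_castSucc_iff.2 this)
        exact concat_eq_right hab _ _ h3 (h3.trans hk)
      · have h1' := not_le.1 h1
        have h3 : t k.succ ≤ a := by
          rw [← hi] at h1' ⊢
          have : k.castSucc < i := by
            by_contra hc
            exact absurd (ht (not_lt.1 hc)) (not_le.2 h1')
          exact ht (Fin.castSucc_lt_iff_succ_le.1 this)
        exact concat_eq_left hab _ _ (hk.trans h3) h3
  rw [hsplit, ← Measure.map_map _ ((measurable_gridIncr t).prodMap (measurable_gridIncr t)),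
    ← Measure.map_prod_map _ _ (measurable_gridIncr t) (measurable_gridIncr t),
    hμ.map_gridIncr ht]
  · exact map_piecewise_prod_pi _ fun k : Fin n => a ≤ t k.castSucc ∧ t k.succ ≤ b
  · refine measurable_pi_lambda _ fun k => ?_
    split_ifs
    · exact (measurable_pi_apply k).comp measurable_fst
    · exact (measurable_pi_apply k).comp measurable_snd

theorem lintegral_concat (hμ : IsBrownianIncrementLaw μ) {a b : ℝ} (hab : a ≤ b)
    {f : IncrementPath d → ℝ≥0∞} (hf : Measurable f) :
    ∫⁻ x, ∫⁻ u, f (concat a b u x) ∂μ ∂μ = ∫⁻ x, f x ∂μ := by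
  have := hμ.isProbabilityMeasure
  conv_rhs => rw [← hμ.map_concat hab, lintegral_map hf (measurable_concat a b),
    lintegral_prod_symm' (fun p : IncrementPath d × IncrementPath d => f (concat a b p.1 p.2))
      (hf.comp (measurable_concat a b))]

end IsBrownianIncrementLaw

open Filter Topology

/-! ### The supremum of the potential over space is integrable in time -/

/-- The increments of a continuous curve. -/
def curveIncr (F : ℝ → EuclideanSpace ℝ (Fin d)) (hF : Continuous F) : IncrementPath d where
  toFun s t := F t - F s
  continuous_toFun := by fun_prop
  diag t := sub_self _
  cocycle s u t := by abel

theorem curveIncr_apply (F : ℝ → EuclideanSpace ℝ (Fin d)) (hF : Continuous F) (s t : ℝ) :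
    curveIncr F hF s t = F t - F s := rfl

/-- `sup_ξ |W(ξ, r)|`. -/
noncomputable def supPotential (W : EuclideanSpace ℝ (Fin d) → ℝ → ℝ) (r : ℝ) : ℝ≥0∞ :=
  ⨆ ξ, ‖W ξ r‖ₑ

section SupPotential

variable {W : EuclideanSpace ℝ (Fin d) → ℝ → ℝ}

theorem enorm_le_supPotential (W : EuclideanSpace ℝ (Fin d) → ℝ → ℝ)
    (ξ : EuclideanSpace ℝ (Fin d)) (r : ℝ) : ‖W ξ r‖ₑ ≤ supPotential W r :=
  le_iSup (fun ξ => ‖W ξ r‖ₑ) ξ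

theorem supPotential_eq_iSup_denseSeq
    (hW : Continuous fun p : EuclideanSpace ℝ (Fin d) × ℝ => W p.1 p.2) (r : ℝ) :
    supPotential W r = ⨆ n, ‖W (TopologicalSpace.denseSeq _ n) r‖ₑ := by
  refine le_antisymm (iSup_le fun ξ => ?_) (iSup_le fun n => enorm_le_supPotential W _ r)
  have hc : Continuous fun ξ => ‖W ξ r‖ₑ :=
    (hW.comp (by fun_prop : Continuous fun ξ => (ξ, r))).enorm
  refine (TopologicalSpace.denseRange_denseSeq (EuclideanSpace ℝ (Fin d))).induction_on
    (p := fun ξ => ‖W ξ r‖ₑ ≤ ⨆ n, ‖W (TopologicalSpace.denseSeq _ n) r‖ₑ) ξ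
    (isClosed_le hc continuous_const) fun n => ?_
  exact le_iSup (fun n => ‖W (TopologicalSpace.denseSeq _ n) r‖ₑ) n

theorem measurable_supPotential
    (hW : Continuous fun p : EuclideanSpace ℝ (Fin d) × ℝ => W p.1 p.2) :
    Measurable (supPotential W) := by
  have : supPotential W = fun r => ⨆ n, ‖W (TopologicalSpace.denseSeq _ n) r‖ₑ :=
    funext (supPotential_eq_iSup_denseSeq hW)
  rw [this]
  refine Measurable.iSup fun n => ?_
  exact ((hW.comp (by fun_prop : Continuous fun r => (TopologicalSpace.denseSeq _ n, r)))).enorm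
    |>.measurable

/-- A bound on the time integral of the potential along all continuous paths extends to bounded
measurable curves. -/
theorem lintegral_measurable_curve_le
    (hW : Continuous fun p : EuclideanSpace ℝ (Fin d) × ℝ => W p.1 p.2) {M : ℝ≥0∞}
    (hM : ∀ x : IncrementPath d, ∫⁻ t : ℝ, ‖W (x 0 t) |t|‖ₑ ≤ M)
    {ζ : ℝ → EuclideanSpace ℝ (Fin d)} (hζ : Measurable ζ) {B : ℝ} (hB : ∀ t, ‖ζ t‖ ≤ B) :
    ∫⁻ t : ℝ, ‖W (ζ t) |t|‖ₑ ≤ M := by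
  set γ := gaussianReal 0 1 with hγ
  have hmem : MemLp ζ 1 γ := MemLp.of_bound hζ.aestronglyMeasurable B (ae_of_all _ hB)
  have happrox : ∀ n : ℕ, ∃ g : BoundedContinuousFunction ℝ (EuclideanSpace ℝ (Fin d)),
      eLpNorm (ζ - (g : ℝ → _)) 1 γ ≤ ((n : ℝ≥0∞) + 1)⁻¹ := fun n => by
    obtain ⟨g, hg, -⟩ := hmem.exists_boundedContinuous_eLpNorm_sub_le ENNReal.one_ne_top
      (ε := ((n : ℝ≥0∞) + 1)⁻¹) (by simp)
    exact ⟨g, hg⟩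
  choose g hg using happrox
  have hmeas : TendstoInMeasure γ (fun n => (g n : ℝ → EuclideanSpace ℝ (Fin d))) atTop ζ := by
    refine tendstoInMeasure_of_tendsto_eLpNorm one_ne_zero
      (fun n => (g n).continuous.aestronglyMeasurable) hζ.aestronglyMeasurable ?_
    have h0 : Tendsto (fun n : ℕ => ((n : ℝ≥0∞) + 1)⁻¹) atTop (𝓝 0) := by
      have := (ENNReal.tendsto_inv_nat_nhds_zero).comp (tendsto_add_atTop_nat 1)
      simpa [Function.comp_def] using this
    refine tendsto_of_tendsto_of_tendsto_of_le_of_le tendsto_const_nhds h0 (fun _ => zero_le)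
      fun n => ?_
    rw [eLpNorm_sub_comm]
    exact hg n
  obtain ⟨ns, -, hns⟩ := hmeas.exists_seq_tendsto_ae
  have hac : (volume : Measure ℝ) ≪ γ := gaussianReal_absolutelyContinuous' 0 one_ne_zero
  have hns' := hac.ae_le hns
  -- the factor `min 1 (n |t|)` makes the curve start at the origin and is eventually `1` off `0`
  set F : ℕ → ℝ → EuclideanSpace ℝ (Fin d) := fun n t => (min 1 ((n : ℝ) * |t|)) • g (ns n) t
    with hF
  have hFc : ∀ n, Continuous (F n) := fun n => by
    have := (g (ns n)).continuous
    simp only [hF]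
    fun_prop
  have hF0 : ∀ n, F n 0 = 0 := fun n => by simp [hF]
  have hlim : ∀ᵐ t : ℝ, Tendsto (fun n => ‖W (F n t) |t|‖ₑ) atTop (𝓝 ‖W (ζ t) |t|‖ₑ) := by
    filter_upwards [hns', Measure.ae_ne volume (0 : ℝ)] with t ht ht0
    have h1 : Tendsto (fun n => F n t) atTop (𝓝 (ζ t)) := by
      refine ht.congr' ?_
      obtain ⟨N, hN⟩ := exists_nat_gt (|t|⁻¹)
      filter_upwards [eventually_ge_atTop N] with n hn
      have hpos : 0 < |t| := abs_pos.2 ht0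
      have : 1 ≤ (n : ℝ) * |t| := by
        have h2 : |t|⁻¹ ≤ n := hN.le.trans (by exact_mod_cast hn)
        calc (1 : ℝ) = |t|⁻¹ * |t| := (inv_mul_cancel₀ hpos.ne').symm
          _ ≤ n * |t| := by gcongr
      simp [hF, min_eq_left this]
    have hc : Continuous fun ξ => ‖W ξ |t|‖ₑ :=
      (hW.comp (by fun_prop : Continuous fun ξ => (ξ, |t|))).enorm
    exact (hc.tendsto _).comp h1
  calc ∫⁻ t : ℝ, ‖W (ζ t) |t|‖ₑ = ∫⁻ t : ℝ, liminf (fun n => ‖W (F n t) |t|‖ₑ) atTop :=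
        lintegral_congr_ae (hlim.mono fun t ht => ht.liminf_eq.symm)
    _ ≤ liminf (fun n => ∫⁻ t : ℝ, ‖W (F n t) |t|‖ₑ) atTop := by
        refine lintegral_liminf_le fun n => ?_
        exact (hW.comp ((hFc n).prodMk continuous_abs)).enorm.measurable
    _ ≤ M := by
        refine liminf_le_of_le (by isBoundedDefault) fun b hb => ?_
        obtain ⟨n, hn⟩ := hb.exists
        refine hn.trans ?_
        have := hM (curveIncr (F n) (hFc n))
        simpa [curveIncr_apply, hF0] using this

theorem lintegral_supPotential_abs_le
    (hW : Continuous fun p : EuclideanSpace ℝ (Fin d) × ℝ => W p.1 p.2) {M : ℝ≥0∞}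
    (hM : ∀ x : IncrementPath d, ∫⁻ t : ℝ, ‖W (x 0 t) |t|‖ₑ ≤ M) :
    ∫⁻ t : ℝ, supPotential W |t| ≤ M := by
  set ξ := TopologicalSpace.denseSeq (EuclideanSpace ℝ (Fin d)) with hξ
  have hmeas : ∀ {ζ : ℝ → EuclideanSpace ℝ (Fin d)}, Measurable ζ →
      Measurable fun t => ‖W (ζ t) |t|‖ₑ := fun hζ =>
    (hW.measurable.comp (hζ.prodMk continuous_abs.measurable)).enorm
  -- the maximum over finitely many points is attained along a measurable curve
  have hmax : ∀ n : ℕ, ∃ ζ : ℝ → EuclideanSpace ℝ (Fin d), Measurable ζ ∧ (∃ B, ∀ t, ‖ζ t‖ ≤ B) ∧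
      ∀ t, ∀ k ≤ n, ‖W (ξ k) |t|‖ₑ ≤ ‖W (ζ t) |t|‖ₑ := by
    intro n
    induction n with
    | zero =>
      exact ⟨fun _ => ξ 0, measurable_const, ⟨‖ξ 0‖, fun _ => le_rfl⟩, fun t k hk => by
        rw [Nat.le_zero.1 hk]⟩
    | succ n ih =>
      obtain ⟨ζ, hζ, ⟨B, hB⟩, hle⟩ := ih
      classical
      set S := {t | ‖W (ξ (n + 1)) |t|‖ₑ ≤ ‖W (ζ t) |t|‖ₑ} with hS
      have hSm : MeasurableSet S := measurableSet_le (hmeas measurable_const) (hmeas hζ)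
      refine ⟨S.piecewise ζ fun _ => ξ (n + 1), hζ.piecewise hSm measurable_const,
        ⟨max B ‖ξ (n + 1)‖, fun t => ?_⟩, fun t k hk => ?_⟩
      · by_cases ht : t ∈ S
        · rw [piecewise_eq_of_mem _ _ _ ht]; exact (hB t).trans (le_max_left _ _)
        · rw [piecewise_eq_of_notMem _ _ _ ht]; exact le_max_right _ _
      · rcases Nat.le_succ_iff.1 hk with hk | rfl
        · by_cases ht : t ∈ S
          · rw [piecewise_eq_of_mem _ _ _ ht]; exact hle t k hk
          · rw [piecewise_eq_of_notMem _ _ _ ht]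
            exact (hle t k hk).trans (not_le.1 ht).le
        · by_cases ht : t ∈ S
          · rw [piecewise_eq_of_mem _ _ _ ht]; exact ht
          · rw [piecewise_eq_of_notMem _ _ _ ht]
  have hsup : ∀ t : ℝ, supPotential W |t| = ⨆ n : ℕ, ⨆ (k : ℕ) (_ : k ≤ n), ‖W (ξ k) |t|‖ₑ := by
    intro t
    rw [supPotential_eq_iSup_denseSeq hW]
    refine le_antisymm (iSup_le fun n => ?_) (iSup_le fun n => iSup₂_le fun k _ => ?_)
    · exact le_iSup_of_le n (le_iSup₂_of_le n le_rfl le_rfl)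
    · exact le_iSup (fun k => ‖W (ξ k) |t|‖ₑ) k
  simp only [hsup]
  rw [lintegral_iSup]
  · refine iSup_le fun n => ?_
    obtain ⟨ζ, hζ, ⟨B, hB⟩, hle⟩ := hmax n
    exact (lintegral_mono fun t => iSup₂_le (hle t)).trans
      (lintegral_measurable_curve_le hW hM hζ hB)
  · exact fun n => Measurable.iSup fun k => Measurable.iSup fun _ => hmeas measurable_const
  · exact fun n m hnm t => iSup₂_le fun k hk =>
      le_iSup₂_of_le (f := fun k (_ : k ≤ m) => ‖W (ξ k) |t|‖ₑ) k (hk.trans hnm) le_rfl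

theorem continuous_timeReversal
    (hW : Continuous fun p : EuclideanSpace ℝ (Fin d) × ℝ => W p.1 p.2) :
    Continuous fun p : EuclideanSpace ℝ (Fin d) × ℝ => timeReversal W p.1 p.2 :=
  hW.comp (by fun_prop : Continuous fun p : EuclideanSpace ℝ (Fin d) × ℝ => (p.1, -p.2))

theorem H1.lintegral_supPotential_abs_lt_top
    (hW : Continuous fun p : EuclideanSpace ℝ (Fin d) × ℝ => W p.1 p.2) (h : H1 W) :
    ∫⁻ t : ℝ, supPotential W |t| < ∞ :=
  (lintegral_supPotential_abs_le hW fun x =>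
    le_iSup (fun x : IncrementPath d => ∫⁻ t : ℝ, ‖W (x 0 t) |t|‖ₑ) x).trans_lt h.2

/-- The second part of (H1) for `W` and for its time reversal bounds the supremum of `|W|` over
space by an integrable function of time: a path may follow the maximisers of `|W|`. -/
theorem lintegral_supPotential_lt_top
    (hW : Continuous fun p : EuclideanSpace ℝ (Fin d) × ℝ => W p.1 p.2)
    (h : H1 W) (h' : H1 (timeReversal W)) : ∫⁻ t : ℝ, supPotential W t < ∞ := by
  calc ∫⁻ t : ℝ, supPotential W t
      ≤ ∫⁻ t : ℝ, (supPotential W |t| + supPotential (timeReversal W) |t|) := by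
        refine lintegral_mono fun t => ?_
        rcases abs_choice t with ht | ht
        · rw [ht]; exact le_self_add
        · refine le_add_left (le_of_eq ?_)
          simp [supPotential, timeReversal, ht]
    _ = (∫⁻ t : ℝ, supPotential W |t|) + ∫⁻ t : ℝ, supPotential (timeReversal W) |t| :=
        lintegral_add_left ((measurable_supPotential hW).comp continuous_abs.measurable) _
    _ < ∞ := ENNReal.add_lt_top.2 ⟨h.lintegral_supPotential_abs_lt_top hW,
        h'.lintegral_supPotential_abs_lt_top (continuous_timeReversal hW)⟩

end SupPotential

/-! ### Interaction across a gap -/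

/-- The effect on the pair interaction of the times `s` and `t` of shifting the increment
`F t - F s` of a curve by `ξ`. -/
noncomputable def shiftEffect (W : EuclideanSpace ℝ (Fin d) → ℝ → ℝ)
    (ξ : EuclideanSpace ℝ (Fin d)) (F : ℝ → EuclideanSpace ℝ (Fin d)) (p : ℝ × ℝ) : ℝ≥0∞ :=
  ‖W (ξ + (F p.2 - F p.1)) (p.2 - p.1) - W (F p.2 - F p.1) (p.2 - p.1)‖ₑ

section ShiftEffect

variable {W : EuclideanSpace ℝ (Fin d) → ℝ → ℝ}

theorem measurable_shiftEffect
    (hW : Continuous fun p : EuclideanSpace ℝ (Fin d) × ℝ => W p.1 p.2)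
    (ξ : EuclideanSpace ℝ (Fin d)) {F : ℝ → EuclideanSpace ℝ (Fin d)} (hF : Continuous F) :
    Measurable (shiftEffect W ξ F) := by
  unfold shiftEffect
  refine Continuous.measurable (Continuous.enorm (Continuous.sub ?_ ?_))
  · exact hW.comp (by fun_prop :
      Continuous fun p : ℝ × ℝ => (ξ + (F p.2 - F p.1), p.2 - p.1))
  · exact hW.comp (by fun_prop : Continuous fun p : ℝ × ℝ => (F p.2 - F p.1, p.2 - p.1))

/-- (H2) for the curve obtained by collapsing a gap `[a, b]` over which `F` has no increment. -/
theorem setLIntegral_shiftEffect_le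
    (hW : Continuous fun p : EuclideanSpace ℝ (Fin d) × ℝ => W p.1 p.2) {C : ℝ}
    (hC : ∀ (ξ : EuclideanSpace ℝ (Fin d)) (a : ℝ), 0 ≤ a → ∀ x : IncrementPath d,
      Q W x ξ a ≤ ENNReal.ofReal (C * (1 + ‖ξ‖)))
    {a b : ℝ} (hab : a ≤ b) (ξ : EuclideanSpace ℝ (Fin d)) {F : ℝ → EuclideanSpace ℝ (Fin d)}
    (hF : Continuous F) (hFab : F a = F b) :
    ∫⁻ p in Iio a ×ˢ Ioi b, shiftEffect W ξ F p ≤ ENNReal.ofReal (C * (1 + ‖ξ‖)) := by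
  -- the curve `G` runs through `F` off the gap, with the sign for which `G t - G s = F s' - F t'`
  set G : ℝ → EuclideanSpace ℝ (Fin d) := fun r => -(F (a + min r 0) + F (b + max r 0)) with hG
  have hGc : Continuous G := by simp only [hG]; fun_prop
  have key := hC ξ (b - a) (sub_nonneg.2 hab) (curveIncr G hGc)
  refine le_trans (le_of_eq ?_) key
  rw [Q, Measure.volume_eq_prod, setLIntegral_prod _ (measurable_shiftEffect hW ξ hF).aemeasurable,
    ← (measurePreserving_add_left volume a).setLIntegral_comp_preimage_emb
      (measurableEmbedding_addLeft a)]
  have hpa : (fun x => a + x) ⁻¹' Iio a = Iio 0 := by ext; simp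
  have hpb : (fun x => b + x) ⁻¹' Ioi b = Ioi 0 := by ext; simp
  rw [hpa]
  refine setLIntegral_congr_fun measurableSet_Iio fun t ht => ?_
  rw [← (measurePreserving_add_left volume b).setLIntegral_comp_preimage_emb
      (measurableEmbedding_addLeft b), hpb]
  refine setLIntegral_congr_fun measurableSet_Ioi fun s hs => ?_
  have ht' : t ≤ 0 := le_of_lt ht
  have hs' : 0 ≤ s := le_of_lt hs
  have e1 : curveIncr G hGc s t = F (b + s) - F (a + t) := by
    simp only [curveIncr_apply, hG, min_eq_left ht', max_eq_right ht', min_eq_right hs',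
      max_eq_left hs', add_zero, hFab]
    abel
  have e2 : b - a + s - t = b + s - (a + t) := by ring
  simp only [shiftEffect, e1, e2]

/-- The far part of the interaction across a gap is small, uniformly in the curve: a curve that
nearly maximises the total interaction already does so on a bounded window, and any other curve may
be attached outside of this window. -/
theorem exists_setLIntegral_shiftEffect_far_le
    {M : ℝ≥0∞} (hM : M ≠ ∞) {a b : ℝ} (ξ : EuclideanSpace ℝ (Fin d))
    (hbound : ∀ F : ℝ → EuclideanSpace ℝ (Fin d), Continuous F → F a = F b →
      ∫⁻ p in Iio a ×ˢ Ioi b, shiftEffect W ξ F p ≤ M) {ε : ℝ≥0∞} (hε : ε ≠ 0) :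
    ∃ R : ℝ, ∀ F : ℝ → EuclideanSpace ℝ (Fin d), Continuous F → F a = F b →
      ∀ R' ≥ R, ∫⁻ p in Iio (-R') ×ˢ Ioi R', shiftEffect W ξ F p ≤ ε := by
  suffices H : ∃ R : ℝ, ∀ F : ℝ → EuclideanSpace ℝ (Fin d), Continuous F → F a = F b →
      ∫⁻ p in Iio (-R) ×ˢ Ioi R, shiftEffect W ξ F p ≤ ε by
    obtain ⟨R, hR⟩ := H
    refine ⟨R, fun F hF hFab R' hR' => (lintegral_mono_set ?_).trans (hR F hF hFab)⟩
    exact prod_mono (Iio_subset_Iio (by linarith)) (Ioi_subset_Ioi hR')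
  by_contra hcon
  push Not at hcon
  set ι := {F : ℝ → EuclideanSpace ℝ (Fin d) // Continuous F ∧ F a = F b}
  have : Nonempty ι := ⟨⟨fun _ => 0, continuous_const, rfl⟩⟩
  set I : ι → ℝ≥0∞ := fun F => ∫⁻ p in Iio a ×ˢ Ioi b, shiftEffect W ξ F.1 p with hI
  set box : ℕ → Set (ℝ × ℝ) := fun m => Ico (-(m : ℝ)) a ×ˢ Ioc b m with hbox
  have hboxm : ∀ m, MeasurableSet (box m) := fun m => measurableSet_Ico.prod measurableSet_Ioc
  have hmono : Monotone box := fun m n hmn => by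
    have : (m : ℝ) ≤ n := by exact_mod_cast hmn
    exact prod_mono (Ico_subset_Ico (by linarith) le_rfl) (Ioc_subset_Ioc le_rfl this)
  have hunion : ⋃ m, box m = Iio a ×ˢ Ioi b := by
    ext p
    simp only [mem_iUnion, hbox, mem_prod, mem_Ico, mem_Ioc, mem_Iio, mem_Ioi]
    constructor
    · rintro ⟨m, h1, h2⟩; exact ⟨h1.2, h2.1⟩
    · rintro ⟨h1, h2⟩
      obtain ⟨m, hm⟩ := exists_nat_ge (max (-p.1) p.2)
      exact ⟨m, ⟨by linarith [le_max_left (-p.1) p.2], h1⟩, h2, (le_max_right _ _).trans hm⟩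
  have hstep : ∀ F : ι, ∀ m : ℕ, |a| ≤ m → |b| ≤ m →
      (∫⁻ p in box m, shiftEffect W ξ F.1 p) + ε ≤ ⨆ F, I F := by
    rintro ⟨F, hF, hFab⟩ m ham hbm
    obtain ⟨F', hF', hFab', hlt⟩ := hcon (m + 1)
    -- `φ` interpolates between `F` on `[-m, m]` and `F'` off `[-(m+1), m+1]`
    set φ : ℝ → ℝ := fun t => max 0 (min 1 (m + 1 - |t|)) with hφ
    have hφ1 : ∀ t : ℝ, |t| ≤ m → φ t = 1 := fun t ht => by
      have : 1 ≤ (m : ℝ) + 1 - |t| := by linarith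
      simp [hφ, min_eq_left this]
    have hφ0 : ∀ t, (m : ℝ) + 1 ≤ |t| → φ t = 0 := fun t ht => by
      have : (m : ℝ) + 1 - |t| ≤ 0 := by linarith
      simp only [hφ]
      rw [min_eq_right (this.trans zero_le_one), max_eq_left this]
    set F₁ : ℝ → EuclideanSpace ℝ (Fin d) := fun t => φ t • F t + (1 - φ t) • F' t with hF₁
    have hF₁c : Continuous F₁ := by simp only [hF₁, hφ]; fun_prop
    have hin : ∀ t : ℝ, |t| ≤ m → F₁ t = F t := fun t ht => by simp [hF₁, hφ1 t ht]
    have hout : ∀ t, (m : ℝ) + 1 ≤ |t| → F₁ t = F' t := fun t ht => by simp [hF₁, hφ0 t ht]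
    have hF₁ab : F₁ a = F₁ b := by rw [hin a ham, hin b hbm, hFab]
    have hma := abs_le.1 ham
    have hmb := abs_le.1 hbm
    have e1 : ∫⁻ p in box m, shiftEffect W ξ F p = ∫⁻ p in box m, shiftEffect W ξ F₁ p := by
      refine setLIntegral_congr_fun (hboxm m) fun p hp => ?_
      have h1 : |p.1| ≤ m := abs_le.2 ⟨hp.1.1, hp.1.2.le.trans hma.2⟩
      have h2 : |p.2| ≤ m := abs_le.2 ⟨hmb.1.trans hp.2.1.le, hp.2.2⟩
      simp only [shiftEffect, hin _ h1, hin _ h2]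
    have hfarm : MeasurableSet (Iio (-((m : ℝ) + 1)) ×ˢ Ioi ((m : ℝ) + 1)) :=
      measurableSet_Iio.prod measurableSet_Ioi
    have e2 : ∫⁻ p in Iio (-((m : ℝ) + 1)) ×ˢ Ioi ((m : ℝ) + 1), shiftEffect W ξ F' p =
        ∫⁻ p in Iio (-((m : ℝ) + 1)) ×ˢ Ioi ((m : ℝ) + 1), shiftEffect W ξ F₁ p := by
      refine setLIntegral_congr_fun hfarm fun p hp => ?_
      have hp1 : p.1 < -((m : ℝ) + 1) := hp.1
      have hp2 : (m : ℝ) + 1 < p.2 := hp.2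
      have h1 : (m : ℝ) + 1 ≤ |p.1| := le_trans (by linarith) (neg_le_abs _)
      have h2 : (m : ℝ) + 1 ≤ |p.2| := hp2.le.trans (le_abs_self _)
      simp only [shiftEffect, hout _ h1, hout _ h2]
    have hdisj : Disjoint (box m) (Iio (-((m : ℝ) + 1)) ×ˢ Ioi ((m : ℝ) + 1)) := by
      rw [Set.disjoint_left]
      rintro p hp hp'
      have h1 : p.2 ≤ m := hp.2.2
      have h2 : (m : ℝ) + 1 < p.2 := hp'.2
      linarith
    calc (∫⁻ p in box m, shiftEffect W ξ F p) + ε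
        ≤ (∫⁻ p in box m, shiftEffect W ξ F p) +
          ∫⁻ p in Iio (-((m : ℝ) + 1)) ×ˢ Ioi ((m : ℝ) + 1), shiftEffect W ξ F' p := by gcongr
      _ = ∫⁻ p in box m ∪ Iio (-((m : ℝ) + 1)) ×ˢ Ioi ((m : ℝ) + 1), shiftEffect W ξ F₁ p := by
        rw [lintegral_union hfarm hdisj, e1, e2]
      _ ≤ ∫⁻ p in Iio a ×ˢ Ioi b, shiftEffect W ξ F₁ p := by
        refine lintegral_mono_set (union_subset ?_ (prod_mono ?_ ?_))
        · rw [← hunion]; exact subset_iUnion box m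
        · exact Iio_subset_Iio (by linarith)
        · exact Ioi_subset_Ioi (by linarith)
      _ ≤ ⨆ F, I F := le_iSup I ⟨F₁, hF₁c, hF₁ab⟩
  have hstep' : ∀ F : ι, I F + ε ≤ ⨆ F, I F := by
    intro F
    have h1 : I F = ⨆ m, ∫⁻ p in box m, shiftEffect W ξ F.1 p := by
      rw [← setLIntegral_iUnion_of_directed _ hmono.directed_le, hunion]
    rw [h1, ENNReal.iSup_add]
    refine iSup_le fun m => ?_
    obtain ⟨n, hn⟩ := exists_nat_ge (max |a| |b|)
    refine le_trans ?_ (hstep F (max m n)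
      (((le_max_left _ _).trans hn).trans (by exact_mod_cast le_max_right m n))
      (((le_max_right _ _).trans hn).trans (by exact_mod_cast le_max_right m n)))
    gcongr
    exact hmono (le_max_left m n)
  have hfin : ⨆ F, I F ≠ ∞ :=
    ne_top_of_le_ne_top hM (iSup_le fun F => hbound F.1 F.2.1 F.2.2)
  have : (⨆ F, I F) + ε ≤ ⨆ F, I F := by
    rw [ENNReal.iSup_add]; exact iSup_le hstep'
  exact absurd this (not_le.2 (ENNReal.lt_add_right hfin hε))

end ShiftEffect

/-! ### Integrability of the interaction and its tails -/

section Interaction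

variable {W : EuclideanSpace ℝ (Fin d) → ℝ → ℝ}

/-- The pairs of times of which at least one lies in `[a, b]`. -/
def strips (a b : ℝ) : Set (ℝ × ℝ) := (Icc a b ×ˢ univ) ∪ (univ ×ˢ Icc a b)

theorem setLIntegral_strips_supPotential_lt_top
    (hW : Continuous fun p : EuclideanSpace ℝ (Fin d) × ℝ => W p.1 p.2)
    (hsup : ∫⁻ t : ℝ, supPotential W t < ∞) (a b : ℝ) :
    ∫⁻ p in strips a b, supPotential W (p.2 - p.1) < ∞ := by
  have hm : Measurable fun p : ℝ × ℝ => supPotential W (p.2 - p.1) :=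
    (measurable_supPotential hW).comp (by fun_prop)
  refine (lintegral_union_le _ _ _).trans_lt (ENNReal.add_lt_top.2 ⟨?_, ?_⟩)
  · rw [Measure.volume_eq_prod, setLIntegral_prod _ hm.aemeasurable]
    simp only [Measure.restrict_univ]
    have : ∀ s : ℝ, ∫⁻ t : ℝ, supPotential W (t - s) = ∫⁻ t : ℝ, supPotential W t :=
      fun s => lintegral_sub_right_eq_self _ s
    simp only [this, lintegral_const, Measure.restrict_apply_univ]
    exact ENNReal.mul_lt_top hsup measure_Icc_lt_top
  · rw [Measure.volume_eq_prod, setLIntegral_prod_symm _ hm.aemeasurable]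
    simp only [Measure.restrict_univ]
    have : ∀ t : ℝ, ∫⁻ s : ℝ, supPotential W (t - s) = ∫⁻ t : ℝ, supPotential W t :=
      fun t => lintegral_sub_left_eq_self _ t
    simp only [this, lintegral_const, Measure.restrict_apply_univ]
    exact ENNReal.mul_lt_top hsup measure_Icc_lt_top

theorem continuous_interactionIntegrand
    (hW : Continuous fun p : EuclideanSpace ℝ (Fin d) × ℝ => W p.1 p.2) (a b : ℝ)
    (x y : IncrementPath d) : Continuous (interactionIntegrand W a b x y) := by
  unfold interactionIntegrand
  exact (hW.comp ((concat a b x y).continuous_toFun.prodMk (by fun_prop))).sub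
    (hW.comp ((concat a b 0 y).continuous_toFun.prodMk (by fun_prop)))

theorem enorm_interactionIntegrand_le (a b : ℝ) (x y : IncrementPath d) (p : ℝ × ℝ) :
    ‖interactionIntegrand W a b x y p‖ₑ ≤ 2 * supPotential W (p.2 - p.1) := by
  rw [interactionIntegrand, two_mul]
  exact enorm_sub_le.trans (add_le_add (enorm_le_supPotential W _ _) (enorm_le_supPotential W _ _))

theorem interactionIntegrand_eq_zero_left {a b : ℝ} (hab : a ≤ b) (x y : IncrementPath d)
    {p : ℝ × ℝ} (h1 : p.1 ≤ a) (h2 : p.2 ≤ a) : interactionIntegrand W a b x y p = 0 := by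
  rw [interactionIntegrand, concat_eq_left hab _ _ h1 h2, concat_eq_left hab _ _ h1 h2, sub_self]

theorem interactionIntegrand_eq_zero_right {a b : ℝ} (hab : a ≤ b) (x y : IncrementPath d)
    {p : ℝ × ℝ} (h1 : b ≤ p.1) (h2 : b ≤ p.2) : interactionIntegrand W a b x y p = 0 := by
  rw [interactionIntegrand, concat_eq_right hab _ _ h1 h2, concat_eq_right hab _ _ h1 h2, sub_self]

theorem concat_zero_endpoints {a b : ℝ} (hab : a ≤ b) (y : IncrementPath d) (s : ℝ) :
    concat a b 0 y s a = concat a b 0 y s b := by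
  rw [← (concat a b 0 y).cocycle s a b, concat_eq_inside _ _ ⟨le_rfl, hab⟩ ⟨hab, le_rfl⟩,
    IncrementPath.zero_apply, add_zero]

theorem enorm_interactionIntegrand_left_right {a b : ℝ} (hab : a ≤ b) (x y : IncrementPath d)
    {p : ℝ × ℝ} (h1 : p.1 ≤ a) (h2 : b ≤ p.2) :
    ‖interactionIntegrand W a b x y p‖ₑ = shiftEffect W (x a b) (concat a b 0 y 0) p := by
  rw [interactionIntegrand, shiftEffect, sub_left]
  simp only [concat_apply, clamp_of_le hab h1, clamp_of_ge hab h2, IncrementPath.zero_apply,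
    zero_add]

theorem enorm_interactionIntegrand_right_left {a b : ℝ} (hab : a ≤ b) (x y : IncrementPath d)
    {p : ℝ × ℝ} (h1 : b ≤ p.1) (h2 : p.2 ≤ a) :
    ‖interactionIntegrand W a b x y p‖ₑ =
      shiftEffect (timeReversal W) (x b a) (fun t => -concat a b 0 y 0 t) p.swap := by
  have e : -concat a b 0 y 0 p.1 - -concat a b 0 y 0 p.2 = concat a b 0 y p.1 p.2 := by
    rw [neg_sub_neg, sub_left]
  simp only [interactionIntegrand, shiftEffect, Prod.fst_swap, Prod.snd_swap, e, timeReversal,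
    neg_sub]
  simp only [concat_apply, clamp_of_le hab h2, clamp_of_ge hab h1, IncrementPath.zero_apply,
    zero_add]

theorem continuous_concat_zero (a b : ℝ) (y : IncrementPath d) :
    Continuous (concat a b 0 y 0) :=
  (concat a b 0 y).continuous_toFun.comp (by fun_prop : Continuous fun t : ℝ => ((0 : ℝ), t))

/-- The interaction integrand splits into a part on the strips over a larger interval and the
interactions between both sides of it. -/
theorem setLIntegral_interactionIntegrand_le {a b a' b' : ℝ} (hab : a ≤ b) (ha : a' ≤ a)
    (hb : b ≤ b') (x y : IncrementPath d) (S : Set (ℝ × ℝ)) :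
    ∫⁻ p in S, ‖interactionIntegrand W a b x y p‖ₑ ≤
      2 * (∫⁻ p in strips a' b' ∩ S, supPotential W (p.2 - p.1)) +
      ((∫⁻ p in Iio a' ×ˢ Ioi b', shiftEffect W (x a b) (concat a b 0 y 0) p) +
       ∫⁻ p in Iio a' ×ˢ Ioi b',
        shiftEffect (timeReversal W) (x b a) (fun t => -concat a b 0 y 0 t) p) := by
  have hcover : S ⊆ (strips a' b' ∩ S) ∪ ((Iio a' ×ˢ Ioi b') ∪ (Ioi b' ×ˢ Iio a')) ∪
      ((Iio a' ×ˢ Iio a') ∪ (Ioi b' ×ˢ Ioi b')) := by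
    rintro ⟨s, t⟩ hp
    simp only [strips, mem_union, mem_inter_iff, mem_prod, mem_Icc, mem_univ, mem_Iio, mem_Ioi,
      and_true, true_and, hp]
    rcases lt_or_ge s a' with h1 | h1 <;> rcases lt_or_ge t a' with h2 | h2 <;>
      rcases lt_or_ge b' s with h3 | h3 <;> rcases lt_or_ge b' t with h4 | h4 <;> simp_all
  have hzero : ∫⁻ p in (Iio a' ×ˢ Iio a') ∪ (Ioi b' ×ˢ Ioi b'),
      ‖interactionIntegrand W a b x y p‖ₑ = 0 := by
    rw [setLIntegral_congr_fun (g := fun _ => 0) ((measurableSet_Iio.prod measurableSet_Iio).union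
      (measurableSet_Ioi.prod measurableSet_Ioi))]
    · simp
    · rintro p (hp | hp)
      · have h1 : p.1 < a' := hp.1
        have h2 : p.2 < a' := hp.2
        simp [interactionIntegrand_eq_zero_left hab x y (h1.le.trans ha) (h2.le.trans ha)]
      · have h1 : b' < p.1 := hp.1
        have h2 : b' < p.2 := hp.2
        simp [interactionIntegrand_eq_zero_right hab x y (hb.trans h1.le) (hb.trans h2.le)]
  have hstrip : ∫⁻ p in strips a' b' ∩ S, ‖interactionIntegrand W a b x y p‖ₑ ≤
      2 * ∫⁻ p in strips a' b' ∩ S, supPotential W (p.2 - p.1) := by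
    rw [← lintegral_const_mul' _ _ ENNReal.ofNat_ne_top]
    exact lintegral_mono fun p => enorm_interactionIntegrand_le a b x y p
  have hlr : ∫⁻ p in Iio a' ×ˢ Ioi b', ‖interactionIntegrand W a b x y p‖ₑ =
      ∫⁻ p in Iio a' ×ˢ Ioi b', shiftEffect W (x a b) (concat a b 0 y 0) p := by
    refine setLIntegral_congr_fun (measurableSet_Iio.prod measurableSet_Ioi) fun p hp => ?_
    have h1 : p.1 < a' := hp.1
    have h2 : b' < p.2 := hp.2
    exact enorm_interactionIntegrand_left_right hab x y (h1.le.trans ha) (hb.trans h2.le)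
  have hrl : ∫⁻ p in Ioi b' ×ˢ Iio a', ‖interactionIntegrand W a b x y p‖ₑ =
      ∫⁻ p in Iio a' ×ˢ Ioi b',
        shiftEffect (timeReversal W) (x b a) (fun t => -concat a b 0 y 0 t) p := by
    have hsw := (Measure.measurePreserving_swap (μ := (volume : Measure ℝ))
      (ν := (volume : Measure ℝ))).setLIntegral_comp_preimage_emb
        MeasurableEquiv.prodComm.measurableEmbedding
      (shiftEffect (timeReversal W) (x b a) (fun t => -concat a b 0 y 0 t)) (Iio a' ×ˢ Ioi b')
    rw [preimage_swap_prod] at hsw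
    refine Eq.trans ?_ hsw
    refine setLIntegral_congr_fun (measurableSet_Ioi.prod measurableSet_Iio) fun p hp => ?_
    have h1 : b' < p.1 := hp.1
    have h2 : p.2 < a' := hp.2
    exact enorm_interactionIntegrand_right_left hab x y (hb.trans h1.le) (h2.le.trans ha)
  calc ∫⁻ p in S, ‖interactionIntegrand W a b x y p‖ₑ
      ≤ _ := lintegral_mono_set hcover
    _ ≤ _ := lintegral_union_le _ _ _
    _ = ∫⁻ p in (strips a' b' ∩ S) ∪ ((Iio a' ×ˢ Ioi b') ∪ (Ioi b' ×ˢ Iio a')),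
        ‖interactionIntegrand W a b x y p‖ₑ := by rw [hzero, add_zero]
    _ ≤ _ := lintegral_union_le _ _ _
    _ ≤ _ := add_le_add hstrip ((lintegral_union_le _ _ _).trans (by rw [hlr, hrl]))

/-- The total interaction grows at most linearly in the increment over `[a, b]`, uniformly in the
boundary condition. -/
theorem exists_lintegral_interactionIntegrand_le
    (hW : Continuous fun p : EuclideanSpace ℝ (Fin d) × ℝ => W p.1 p.2)
    (hH1 : H1 W) (hH2 : H2 W) (hH1' : H1 (timeReversal W)) (hH2' : H2 (timeReversal W))
    {a b : ℝ} (hab : a ≤ b) :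
    ∃ c : ℝ, 0 ≤ c ∧ ∀ x y : IncrementPath d,
      ∫⁻ p, ‖interactionIntegrand W a b x y p‖ₑ ≤ ENNReal.ofReal (c * (1 + ‖x a b‖)) := by
  obtain ⟨C, hC⟩ := hH2
  obtain ⟨C', hC'⟩ := hH2'
  have hfin := setLIntegral_strips_supPotential_lt_top hW
    (lintegral_supPotential_lt_top hW hH1 hH1') a b
  set K := ∫⁻ p in strips a b, supPotential W (p.2 - p.1) with hK
  refine ⟨2 * K.toReal + |C| + |C'|, by positivity, fun x y => ?_⟩
  have h := setLIntegral_interactionIntegrand_le (W := W) hab le_rfl le_rfl x y univ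
  rw [Measure.restrict_univ, inter_univ] at h
  have hF := continuous_concat_zero a b y
  have hFab := concat_zero_endpoints hab y 0
  have hx : ‖x b a‖ = ‖x a b‖ := by rw [← neg_apply_swap, norm_neg]
  refine h.trans ((add_le_add le_rfl (add_le_add
    (setLIntegral_shiftEffect_le hW hC hab (x a b) hF hFab)
    (setLIntegral_shiftEffect_le (continuous_timeReversal hW) hC' hab (x b a) hF.neg
      (congrArg Neg.neg hFab)))).trans ?_)
  have h2K : 2 * K = ENNReal.ofReal (2 * K.toReal) := by
    rw [ENNReal.ofReal_mul zero_le_two, ENNReal.ofReal_toReal hfin.ne, ENNReal.ofReal_ofNat]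
  rw [← hK, hx, h2K]
  have hn : 0 ≤ ‖x a b‖ := norm_nonneg _
  have hK0 : 0 ≤ K.toReal := ENNReal.toReal_nonneg
  calc _ ≤ ENNReal.ofReal (2 * K.toReal) + (ENNReal.ofReal (|C| * (1 + ‖x a b‖)) +
        ENNReal.ofReal (|C'| * (1 + ‖x a b‖))) := by
        gcongr <;> exact le_abs_self _
    _ = ENNReal.ofReal (2 * K.toReal + (|C| * (1 + ‖x a b‖) + |C'| * (1 + ‖x a b‖))) := by
        rw [ENNReal.ofReal_add, ENNReal.ofReal_add] <;> positivity
    _ ≤ _ := by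
        refine ENNReal.ofReal_le_ofReal ?_
        nlinarith [mul_nonneg hK0 hn]

/-- The interaction with the outside of a large square is small, uniformly in the boundary
condition. -/
theorem exists_lintegral_interactionIntegrand_compl_le
    (hW : Continuous fun p : EuclideanSpace ℝ (Fin d) × ℝ => W p.1 p.2)
    (hH1 : H1 W) (hH2 : H2 W) (hH1' : H1 (timeReversal W)) (hH2' : H2 (timeReversal W))
    {a b : ℝ} (hab : a ≤ b) (x : IncrementPath d) {ε : ℝ≥0∞} (hε : ε ≠ 0) :
    ∃ N₀ : ℕ, ∀ N : ℕ, N₀ ≤ N → ∀ y : IncrementPath d,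
      ∫⁻ p in (Icc (-(N : ℝ)) N ×ˢ Icc (-(N : ℝ)) N)ᶜ, ‖interactionIntegrand W a b x y p‖ₑ ≤ ε := by
  obtain ⟨C, hC⟩ := hH2
  obtain ⟨C', hC'⟩ := hH2'
  have hε4 : ε / 2 / 2 ≠ 0 :=
    (ENNReal.div_pos (ENNReal.div_pos hε (by norm_num)).ne' (by norm_num)).ne'
  obtain ⟨R₁, hR₁⟩ := exists_setLIntegral_shiftEffect_far_le ENNReal.ofReal_ne_top (x a b)
    (fun F hF hFab => setLIntegral_shiftEffect_le hW hC hab (x a b) hF hFab) hε4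
  obtain ⟨R₂, hR₂⟩ := exists_setLIntegral_shiftEffect_far_le
    ENNReal.ofReal_ne_top (x b a) (fun F hF hFab => setLIntegral_shiftEffect_le
      (continuous_timeReversal hW) hC' hab (x b a) hF hFab) hε4
  set R := max (max R₁ R₂) (max |a| |b|) with hR
  have hRa : -R ≤ a := (abs_le.1 ((le_max_left _ _).trans (le_max_right _ _))).1
  have hRb : b ≤ R := (abs_le.1 ((le_max_right _ _).trans (le_max_right _ _))).2
  have hfin := setLIntegral_strips_supPotential_lt_top hW
    (lintegral_supPotential_lt_top hW hH1 hH1') (-R) R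
  set ρ : Measure (ℝ × ℝ) :=
    (volume.restrict (strips (-R) R)).withDensity fun p => supPotential W (p.2 - p.1) with hρ
  have hsqm : ∀ N : ℕ, MeasurableSet (Icc (-(N : ℝ)) N ×ˢ Icc (-(N : ℝ)) N)ᶜ := fun N =>
    (measurableSet_Icc.prod measurableSet_Icc).compl
  have hρf : IsFiniteMeasure ρ := ⟨by
    rw [hρ, withDensity_apply _ MeasurableSet.univ, Measure.restrict_univ]; exact hfin⟩
  have htend : Tendsto (fun N : ℕ => ρ (Icc (-(N : ℝ)) N ×ˢ Icc (-(N : ℝ)) N)ᶜ) atTop (𝓝 0) := by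
    have hempty : ⋂ N : ℕ, (Icc (-(N : ℝ)) N ×ˢ Icc (-(N : ℝ)) N)ᶜ = (∅ : Set (ℝ × ℝ)) := by
      rw [← compl_iUnion, compl_empty_iff, eq_univ_iff_forall]
      intro p
      obtain ⟨n, hn⟩ := exists_nat_ge (max |p.1| |p.2|)
      exact mem_iUnion.2 ⟨n, abs_le.1 ((le_max_left _ _).trans hn),
        abs_le.1 ((le_max_right _ _).trans hn)⟩
    rw [← measure_empty (μ := ρ), ← hempty]
    refine tendsto_measure_iInter_atTop (fun N => (hsqm N).nullMeasurableSet) ?_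
      ⟨0, measure_ne_top _ _⟩
    intro m n hmn
    have : (m : ℝ) ≤ n := by exact_mod_cast hmn
    exact compl_subset_compl.2 (prod_mono (Icc_subset_Icc (by linarith) this)
      (Icc_subset_Icc (by linarith) this))
  have hev := (ENNReal.tendsto_atTop_zero.1 htend) (ε / 2 / 2) (pos_iff_ne_zero.2 hε4)
  obtain ⟨N₀, hN₀⟩ := hev
  refine ⟨N₀, fun N hN y => ?_⟩
  have hF := continuous_concat_zero a b y
  have hFab := concat_zero_endpoints hab y 0
  have h := setLIntegral_interactionIntegrand_le (W := W) hab hRa hRb x y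
    (Icc (-(N : ℝ)) N ×ˢ Icc (-(N : ℝ)) N)ᶜ
  have hρN := hN₀ N hN
  rw [hρ, withDensity_apply _ (hsqm N), Measure.restrict_restrict (hsqm N), inter_comm] at hρN
  refine h.trans ((add_le_add (mul_le_mul_right hρN 2) (add_le_add
    (hR₁ _ hF hFab R ((le_max_left _ _).trans (le_max_left _ _)))
    (hR₂ _ hF.neg (congrArg Neg.neg hFab) R ((le_max_right _ _).trans
      (le_max_left _ _))))).trans ?_)
  rw [two_mul, ENNReal.add_halves, ENNReal.add_halves]

theorem integrable_interactionIntegrand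
    (hW : Continuous fun p : EuclideanSpace ℝ (Fin d) × ℝ => W p.1 p.2)
    (hH1 : H1 W) (hH2 : H2 W) (hH1' : H1 (timeReversal W)) (hH2' : H2 (timeReversal W))
    {a b : ℝ} (hab : a ≤ b) (x y : IncrementPath d) :
    Integrable (interactionIntegrand W a b x y) := by
  obtain ⟨c, -, hc⟩ := exists_lintegral_interactionIntegrand_le hW hH1 hH2 hH1' hH2' hab
  exact ⟨(continuous_interactionIntegrand hW a b x y).aestronglyMeasurable,
    (hc x y).trans_lt ENNReal.ofReal_lt_top⟩

end Interaction

/-! ### The energy of a path given its boundary condition -/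

/-- The assumptions on the potential: continuity, and (H1) and (H2) for `W` and for its time
reversal. -/
structure IsAdmissible (W : EuclideanSpace ℝ (Fin d) → ℝ → ℝ) : Prop where
  continuous : Continuous fun p : EuclideanSpace ℝ (Fin d) × ℝ => W p.1 p.2
  h1 : H1 W
  h2 : H2 W
  h1_timeReversal : H1 (timeReversal W)
  h2_timeReversal : H2 (timeReversal W)

/-- The integral over the whole plane of the interaction integrand: the energy of `x ⊗_I y`
relative to that of `0 ⊗_I y`. -/
noncomputable def energyDiff (W : EuclideanSpace ℝ (Fin d) → ℝ → ℝ) (a b : ℝ)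
    (x y : IncrementPath d) : ℝ :=
  ∫ p, interactionIntegrand W a b x y p

theorem measurableSet_cone (a b : ℝ) : MeasurableSet (cone a b) :=
  (((measurableSet_Ioi.prod measurableSet_Iio).union
    (measurableSet_Iio.prod measurableSet_Ioi)).union
    (measurableSet_Icc.prod measurableSet_Icc.compl)).union
    (measurableSet_Icc.compl.prod measurableSet_Icc)

namespace IsAdmissible

variable {W : EuclideanSpace ℝ (Fin d) → ℝ → ℝ}

theorem integrable (hW : IsAdmissible W) {a b : ℝ} (hab : a ≤ b) (x y : IncrementPath d) :
    Integrable (interactionIntegrand W a b x y) :=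
  integrable_interactionIntegrand hW.continuous hW.h1 hW.h2 hW.h1_timeReversal hW.h2_timeReversal
    hab x y

/-- `U_I(x) + V_I(x, y)` differs from the energy difference by a constant. -/
theorem energyU_add_energyV (hW : IsAdmissible W) {a b : ℝ} (hab : a ≤ b)
    (x y : IncrementPath d) :
    energyU W a b x + energyV W a b x y = energyU W a b 0 + energyDiff W a b x y := by
  have hint := hW.integrable hab x y
  have hsq : MeasurableSet (Icc a b ×ˢ Icc a b) := measurableSet_Icc.prod measurableSet_Icc
  have hdisj : Disjoint (Icc a b ×ˢ Icc a b) (cone a b) := by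
    rw [Set.disjoint_left]
    rintro ⟨s, t⟩ ⟨⟨h1, h2⟩, h3, h4⟩ h
    simp only [cone, mem_union, mem_prod, mem_Ioi, mem_Iio, mem_compl_iff, mem_Icc] at h
    dsimp only at h1 h2 h3 h4
    rcases h with ((h | h) | h) | h
    · linarith [h.1]
    · linarith [h.1]
    · exact h.2 ⟨h3, h4⟩
    · exact h.1 ⟨h1, h2⟩
  have hall : energyDiff W a b x y =
      (∫ p in Icc a b ×ˢ Icc a b, interactionIntegrand W a b x y p) + energyV W a b x y := by
    rw [energyV, ← setIntegral_union hdisj (measurableSet_cone a b) hint.integrableOn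
      hint.integrableOn, energyDiff]
    refine (setIntegral_eq_integral_of_forall_compl_eq_zero ?_).symm
    rintro ⟨s, t⟩ h
    have h' : (s ≤ a ∧ t ≤ a) ∨ (b ≤ s ∧ b ≤ t) := by
      simp only [cone, mem_union, mem_prod, mem_Ioi, mem_Iio, mem_compl_iff, mem_Icc] at h
      rcases lt_or_ge s a with h1 | h1 <;> rcases lt_or_ge t a with h2 | h2 <;>
        rcases lt_or_ge b s with h3 | h3 <;> rcases lt_or_ge b t with h4 | h4 <;>
          simp_all [le_of_lt]
    rcases h' with h' | h'
    · exact interactionIntegrand_eq_zero_left hab x y h'.1 h'.2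
    · exact interactionIntegrand_eq_zero_right hab x y h'.1 h'.2
  have hcont : ∀ z : IncrementPath d, IntegrableOn (fun p : ℝ × ℝ => W (z p.1 p.2) (p.2 - p.1))
      (Icc a b ×ˢ Icc a b) := fun z =>
    (hW.continuous.comp (z.continuous_toFun.prodMk (by fun_prop :
      Continuous fun p : ℝ × ℝ => p.2 - p.1))).continuousOn.integrableOn_compact
      (isCompact_Icc.prod isCompact_Icc)
  have hin : ∫ p in Icc a b ×ˢ Icc a b, interactionIntegrand W a b x y p =
      energyU W a b x - energyU W a b 0 := by
    rw [energyU, energyU, ← integral_sub (hcont x) (hcont 0)]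
    refine setIntegral_congr_fun hsq fun p hp => ?_
    simp only [interactionIntegrand, concat_eq_inside _ _ hp.1 hp.2]
  rw [hall, hin]; ring

/-- Resampling `x` inside `[a, b] ⊆ [a', b']` changes the energy in `[a', b']` as it changes the
energy in `[a, b]` with the boundary condition `x ⊗ y`. -/
theorem energyDiff_concat (hW : IsAdmissible W) {a b a' b' : ℝ} (hab : a ≤ b) (ha : a' ≤ a)
    (hb : b ≤ b') (u x y : IncrementPath d) :
    energyDiff W a' b' (concat a b u x) y =
      energyDiff W a b u (concat a' b' x y) + energyDiff W a' b' (concat a b 0 x) y := by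
  rw [energyDiff, energyDiff, energyDiff, ← integral_add (hW.integrable hab _ _)
    (hW.integrable (ha.trans (hab.trans hb)) _ _)]
  congr 1
  funext p
  simp only [interactionIntegrand, concat_concat_nested hab ha hb]
  ring

theorem measurable_energyDiff (hW : IsAdmissible W) (a b : ℝ) :
    Measurable fun p : IncrementPath d × IncrementPath d => energyDiff W a b p.1 p.2 := by
  refine StronglyMeasurable.measurable ?_
  refine StronglyMeasurable.integral_prod_right' (f := fun q : (IncrementPath d × IncrementPath d) ×
    (ℝ × ℝ) => interactionIntegrand W a b q.1.1 q.1.2 q.2) ?_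
  refine Measurable.stronglyMeasurable ?_
  have h1 : ∀ x : (IncrementPath d × IncrementPath d) × (ℝ × ℝ) → IncrementPath d, Measurable x →
      Measurable fun q => W (x q q.2.1 q.2.2) (q.2.2 - q.2.1) := fun x hx =>
    hW.continuous.measurable.comp ((measurable_eval_comp hx (by fun_prop) (by fun_prop)).prodMk
      (by fun_prop))
  exact (h1 _ ((measurable_concat a b).comp measurable_fst)).sub
    (h1 _ ((measurable_concat_right a b 0).comp (measurable_snd.comp measurable_fst)))

theorem exists_abs_energyDiff_le (hW : IsAdmissible W) {a b : ℝ} (hab : a ≤ b) :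
    ∃ c : ℝ, 0 ≤ c ∧ ∀ x y : IncrementPath d,
      |energyDiff W a b x y| ≤ c * (1 + ‖x a b‖) := by
  obtain ⟨c, hc0, hc⟩ := exists_lintegral_interactionIntegrand_le hW.continuous hW.h1 hW.h2
    hW.h1_timeReversal hW.h2_timeReversal hab
  refine ⟨c, hc0, fun x y => ?_⟩
  have h := (enorm_integral_le_lintegral_enorm (interactionIntegrand W a b x y)).trans (hc x y)
  rwa [← ofReal_norm, ENNReal.ofReal_le_ofReal_iff (by positivity), Real.norm_eq_abs] at h

/-- Changing the boundary condition outside of a large window changes the energy little. -/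
theorem exists_abs_energyDiff_sub_le (hW : IsAdmissible W) {a b : ℝ} (hab : a ≤ b)
    (x : IncrementPath d) {ε : ℝ} (hε : 0 < ε) :
    ∃ N₀ : ℕ, ∀ N : ℕ, N₀ ≤ N → ∀ y y' : IncrementPath d,
      (∀ s ∈ Icc (-(N : ℝ)) N, ∀ t ∈ Icc (-(N : ℝ)) N, y s t = y' s t) →
      |energyDiff W a b x y - energyDiff W a b x y'| ≤ ε := by
  obtain ⟨N₀, hN₀⟩ := exists_lintegral_interactionIntegrand_compl_le hW.continuous hW.h1 hW.h2
    hW.h1_timeReversal hW.h2_timeReversal hab x (ε := ENNReal.ofReal (ε / 2)) (by simpa using hε)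
  obtain ⟨n, hn⟩ := exists_nat_ge (max |a| |b|)
  refine ⟨max N₀ n, fun N hN y y' hy => ?_⟩
  have hnN : (n : ℝ) ≤ N := by exact_mod_cast (le_max_right _ _).trans hN
  have haN := (abs_le.1 (((le_max_left _ _).trans hn).trans hnN)).1
  have hbN := (abs_le.1 (((le_max_right _ _).trans hn).trans hnN)).2
  set S : Set (ℝ × ℝ) := Icc (-(N : ℝ)) N ×ˢ Icc (-(N : ℝ)) N with hS
  have hSm : MeasurableSet S := measurableSet_Icc.prod measurableSet_Icc
  have hsplit : ∀ z, energyDiff W a b x z = (∫ p in S, interactionIntegrand W a b x z p) +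
      ∫ p in Sᶜ, interactionIntegrand W a b x z p := fun z =>
    (integral_add_compl hSm (hW.integrable hab x z)).symm
  have htail : ∀ z, |∫ p in Sᶜ, interactionIntegrand W a b x z p| ≤ ε / 2 := fun z => by
    have h := (enorm_integral_le_lintegral_enorm (μ := volume.restrict Sᶜ)
      (interactionIntegrand W a b x z)).trans (hN₀ N ((le_max_left _ _).trans hN) z)
    rwa [← ofReal_norm, ENNReal.ofReal_le_ofReal_iff (by positivity), Real.norm_eq_abs] at h
  have heq : ∫ p in S, interactionIntegrand W a b x y p =
      ∫ p in S, interactionIntegrand W a b x y' p := by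
    refine setIntegral_congr_fun hSm fun p hp => ?_
    have hcl : ∀ t, clamp a b t ∈ Icc (-(N : ℝ)) N := fun t =>
      ⟨haN.trans (clamp_mem hab t).1, (clamp_mem hab t).2.trans hbN⟩
    simp only [interactionIntegrand, concat_apply, hy _ hp.1 _ hp.2, hy _ (hcl _) _ (hcl _)]
  rw [hsplit y, hsplit y', heq, add_sub_add_left_eq_sub]
  exact (abs_sub _ _).trans (by linarith [htail y, htail y'])

end IsAdmissible

/-! ### Boltzmann weights -/

section Weight

variable {W : EuclideanSpace ℝ (Fin d) → ℝ → ℝ}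

theorem energyU_translate (a b c : ℝ) (x : IncrementPath d) :
    energyU W (a - c) (b - c) (IncrementPath.translate c x) = energyU W a b x := by
  symm
  rw [energyU, energyU, ← (measurePreserving_add_right volume (c, c)).setIntegral_preimage_emb
    (measurableEmbedding_addRight (c, c))]
  have : (fun p : ℝ × ℝ => p + (c, c)) ⁻¹' (Icc a b ×ˢ Icc a b) =
      Icc (a - c) (b - c) ×ˢ Icc (a - c) (b - c) := by
    ext p; simp
  rw [this]
  simp [IncrementPath.translate]

theorem energyV_translate (a b c : ℝ) (x y : IncrementPath d) :
    energyV W (a - c) (b - c) (IncrementPath.translate c x) (IncrementPath.translate c y) =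
      energyV W a b x y := by
  symm
  rw [energyV, energyV, ← (measurePreserving_add_right volume (c, c)).setIntegral_preimage_emb
    (measurableEmbedding_addRight (c, c))]
  have : (fun p : ℝ × ℝ => p + (c, c)) ⁻¹' cone a b = cone (a - c) (b - c) := by
    ext p; simp [cone, le_sub_iff_add_le, sub_lt_iff_lt_add, lt_sub_iff_add_lt]
  rw [this]
  have hz : concat (a - c) (b - c) 0 (IncrementPath.translate c y) =
      IncrementPath.translate c (concat a b 0 y) := by
    rw [translate_concat]; rfl
  simp only [interactionIntegrand, ← translate_concat, hz]
  simp [IncrementPath.translate]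

theorem weight_translate (lam a b c : ℝ) (x y : IncrementPath d) :
    weight W lam (a - c) (b - c) (IncrementPath.translate c x) (IncrementPath.translate c y) =
      weight W lam a b x y := by
  rw [weight, weight, energyU_translate, energyV_translate]

/-- The weight depends on `y` only through its increments outside of `[a, b]`. -/
theorem weight_concat_right {a b : ℝ} (hab : a ≤ b) (lam : ℝ) (x u y : IncrementPath d) :
    weight W lam a b x (concat a b u y) = weight W lam a b x y := by
  simp only [weight, energyV, interactionIntegrand, concat_concat_right hab le_rfl le_rfl]

theorem weight_eq {a b : ℝ} (hW : IsAdmissible W) (hab : a ≤ b) (lam : ℝ)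
    (x y : IncrementPath d) : weight W lam a b x y =
      ENNReal.ofReal (Real.exp (-lam * (energyU W a b 0 + energyDiff W a b x y))) := by
  rw [weight, ← hW.energyU_add_energyV hab]
  ring_nf

theorem measurable_weight {a b : ℝ} (hW : IsAdmissible W) (hab : a ≤ b) (lam : ℝ) :
    Measurable fun p : IncrementPath d × IncrementPath d => weight W lam a b p.1 p.2 := by
  simp only [weight_eq hW hab]
  exact (Real.measurable_exp.comp
    (((hW.measurable_energyDiff a b).const_add _).const_mul _)).ennreal_ofReal

theorem measurable_weight_left {a b : ℝ} (hW : IsAdmissible W) (hab : a ≤ b) (lam : ℝ)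
    (y : IncrementPath d) : Measurable fun x => weight W lam a b x y :=
  (measurable_weight hW hab lam).comp (measurable_id.prodMk measurable_const)

/-- The exponential `exp (k (1 + |x_{ab}|))` that controls the weights, for `k` of either sign. -/
noncomputable def envelope (k a b : ℝ) (x : IncrementPath d) : ℝ≥0∞ :=
  ENNReal.ofReal (Real.exp (k * (1 + ‖x a b‖)))

theorem measurable_envelope (k a b : ℝ) : Measurable (envelope (d := d) k a b) :=
  (Real.measurable_exp.comp (((measurable_eval a b).norm.const_add 1).const_mul k)).ennreal_ofReal

theorem envelope_concat {a b : ℝ} (hab : a ≤ b) (k : ℝ) (x y : IncrementPath d) :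
    envelope k a b (concat a b x y) = envelope k a b x := by
  rw [envelope, envelope, concat_eq_inside _ _ ⟨le_rfl, hab⟩ ⟨hab, le_rfl⟩]

/-- The weights are bounded above and below in terms of the increment over `[a, b]` alone, uniformly
in the boundary condition. -/
theorem exists_weight_bounds (hW : IsAdmissible W) (lam : ℝ) {a b : ℝ} (hab : a ≤ b) :
    ∃ k : ℝ, ∀ x y : IncrementPath d,
      envelope (-k) a b x ≤ weight W lam a b x y ∧ weight W lam a b x y ≤ envelope k a b x := by
  obtain ⟨c, hc0, hc⟩ := hW.exists_abs_energyDiff_le hab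
  refine ⟨|lam| * (|energyU W a b 0| + c), fun x y => ?_⟩
  have h1 : |-lam * (energyU W a b 0 + energyDiff W a b x y)| ≤
      |lam| * (|energyU W a b 0| + c) * (1 + ‖x a b‖) := by
    rw [abs_mul, abs_neg, mul_assoc]
    gcongr
    have hn : 0 ≤ ‖x a b‖ := norm_nonneg _
    calc |energyU W a b 0 + energyDiff W a b x y|
        ≤ |energyU W a b 0| + c * (1 + ‖x a b‖) :=
          (abs_add_le _ _).trans (add_le_add le_rfl (hc x y))
      _ ≤ _ := by nlinarith [abs_nonneg (energyU W a b (0 : IncrementPath d))]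
  rw [weight_eq hW hab, envelope, envelope]
  have h2 := abs_le.1 h1
  refine ⟨ENNReal.ofReal_le_ofReal (Real.exp_le_exp.2 ?_),
    ENNReal.ofReal_le_ofReal (Real.exp_le_exp.2 h2.2)⟩
  linarith [h2.1]

theorem IsBrownianIncrementLaw.lintegral_envelope_lt_top {μ : Measure (IncrementPath d)}
    (hμ : IsBrownianIncrementLaw μ) (k a b : ℝ) : ∫⁻ x, envelope k a b x ∂μ < ∞ := by
  set γ := multivariateGaussian (0 : EuclideanSpace ℝ (Fin d))
    (|b - a| • (1 : Matrix (Fin d) (Fin d) ℝ)) with hγ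
  obtain ⟨C, hC0, hC⟩ := IsGaussian.exists_integrable_exp_sq γ
  have hm : Measurable fun v : EuclideanSpace ℝ (Fin d) =>
      ENNReal.ofReal (Real.exp (k * (1 + ‖v‖))) := by fun_prop
  have hmap : ∫⁻ x, envelope k a b x ∂μ =
      ∫⁻ v, ENNReal.ofReal (Real.exp (k * (1 + ‖v‖))) ∂γ := by
    rw [hγ, ← (hμ.hasLaw a b).map_eq, lintegral_map hm (measurable_eval a b)]
    rfl
  rw [hmap]
  -- `k r ≤ C r ^ 2 + k ^ 2 / (4 C)`
  have hle : ∀ v : EuclideanSpace ℝ (Fin d), ENNReal.ofReal (Real.exp (k * (1 + ‖v‖))) ≤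
      ENNReal.ofReal (Real.exp (k + k ^ 2 / (4 * C))) * ‖Real.exp (C * ‖v‖ ^ 2)‖ₑ := by
    intro v
    rw [← ofReal_norm, Real.norm_eq_abs, abs_of_pos (Real.exp_pos _),
      ← ENNReal.ofReal_mul (Real.exp_pos _).le, ← Real.exp_add]
    refine ENNReal.ofReal_le_ofReal (Real.exp_le_exp.2 ?_)
    have : 0 ≤ C * (‖v‖ - k / (2 * C)) ^ 2 := by positivity
    have e : C * (‖v‖ - k / (2 * C)) ^ 2 = C * ‖v‖ ^ 2 - k * ‖v‖ + k ^ 2 / (4 * C) := by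
      field_simp; ring
    rw [e] at this
    linarith
  refine (lintegral_mono hle).trans_lt ?_
  rw [lintegral_const_mul' _ _ ENNReal.ofReal_ne_top]
  exact ENNReal.mul_lt_top ENNReal.ofReal_lt_top hC.2

end Weight

/-! ### The outside σ-algebra -/

section Outside

variable {a b : ℝ}

/-- Sets in `𝓕_{Iᶜ}` do not see the increments inside `I`. -/
theorem mem_concat_iff_of_measurableSet (hab : a ≤ b) {B : Set (IncrementPath d)}
    (hB : MeasurableSet[sigmaIncr (Icc a b)ᶜ] B) (x y : IncrementPath d) :
    concat a b x y ∈ B ↔ y ∈ B := by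
  let m : MeasurableSpace (IncrementPath d) :=
    { MeasurableSet' := fun B => ∀ x y, concat a b x y ∈ B ↔ y ∈ B
      measurableSet_empty := fun _ _ => Iff.rfl
      measurableSet_compl := fun B hB x y => not_congr (hB x y)
      measurableSet_iUnion := fun f hf x y => by simp [hf _ x y] }
  have hle : sigmaIncr (Icc a b)ᶜ ≤ m := by
    refine iSup_le fun s => iSup_le fun t => iSup_le fun hst => ?_
    rintro _ ⟨A, -, rfl⟩ x y
    have hs : s ∈ (Icc a b)ᶜ := hst left_mem_uIcc
    have ht : t ∈ (Icc a b)ᶜ := hst right_mem_uIcc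
    have key : concat a b x y s t = y s t := by
      rcases lt_or_ge s a with h1 | h1
      · rcases lt_or_ge t a with h2 | h2
        · exact concat_eq_left hab _ _ h1.le h2.le
        · exact absurd ⟨le_rfl, hab⟩ (hst (Icc_subset_uIcc ⟨h1.le, h2⟩))
      · have h1' : b < s := by by_contra h; exact hs ⟨h1, not_lt.1 h⟩
        rcases lt_or_ge b t with h2 | h2
        · exact concat_eq_right hab _ _ h1'.le h2.le
        · exact absurd ⟨hab, le_rfl⟩ (hst (Icc_subset_uIcc' ⟨h2, h1'.le⟩))
    change concat a b x y s t ∈ A ↔ y s t ∈ A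
    rw [key]
  exact hle B hB x y

/-- The increments over intervals that reach up to the boundary of `I` are `𝓕_{Iᶜ}`-measurable, as
limits of increments over intervals in `Iᶜ`. -/
theorem measurable_eval_clamp (hab : a ≤ b) (s : ℝ) :
    Measurable[sigmaIncr (Icc a b)ᶜ] fun y : IncrementPath d => y s (clamp a b s) := by
  have hev : ∀ u v : ℝ, uIcc u v ⊆ (Icc a b)ᶜ →
      Measurable[sigmaIncr (Icc a b)ᶜ] fun y : IncrementPath d => y u v := fun u v h =>
    Measurable.of_comap_le (le_iSup_of_le u (le_iSup_of_le v (le_iSup_of_le h le_rfl)))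
  have hlim : ∀ (y : IncrementPath d) (c : ℝ), Tendsto
      (fun n : ℕ => y s (c + (s - c) * (1 / ((n : ℝ) + 1)))) atTop (𝓝 (y s c)) := by
    intro y c
    have h1 : Tendsto (fun n : ℕ => c + (s - c) * (1 / ((n : ℝ) + 1))) atTop (𝓝 c) := by
      simpa using (tendsto_one_div_add_atTop_nhds_zero_nat.const_mul (s - c)).const_add c
    have hc : Continuous fun t => y s t :=
      y.continuous_toFun.comp (by fun_prop : Continuous fun t : ℝ => (s, t))
    exact (hc.tendsto c).comp h1
  have hfrac : ∀ n : ℕ, 0 < 1 / ((n : ℝ) + 1) ∧ 1 / ((n : ℝ) + 1) ≤ 1 := fun n =>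
    ⟨by positivity, by rw [div_le_one (by positivity)]; linarith [n.cast_nonneg (α := ℝ)]⟩
  rcases lt_or_ge s a with h1 | h1
  · rw [clamp_of_le hab h1.le]
    refine @measurable_of_tendsto_metrizable _ _ (sigmaIncr (Icc a b)ᶜ) _ _ _ _ _ _
      (fun n => hev s _ ?_) (tendsto_pi_nhds.2 fun y => hlim y a)
    obtain ⟨h3, h4⟩ := hfrac n
    have h5 : a + (s - a) * (1 / ((n : ℝ) + 1)) < a := by nlinarith
    intro r hr hr'
    rw [mem_uIcc] at hr
    rcases hr with hr | hr <;> linarith [hr.1, hr.2, hr'.1]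
  · rcases lt_or_ge b s with h2 | h2
    · rw [clamp_of_ge hab h2.le]
      refine @measurable_of_tendsto_metrizable _ _ (sigmaIncr (Icc a b)ᶜ) _ _ _ _ _ _
        (fun n => hev s _ ?_) (tendsto_pi_nhds.2 fun y => hlim y b)
      obtain ⟨h3, h4⟩ := hfrac n
      have h5 : b < b + (s - b) * (1 / ((n : ℝ) + 1)) := by nlinarith
      intro r hr hr'
      rw [mem_uIcc] at hr
      rcases hr with hr | hr <;> linarith [hr.1, hr.2, hr'.2]
    · rw [clamp_of_mem ⟨h1, h2⟩]
      simp only [IncrementPath.diag]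
      exact @measurable_const _ _ _ (sigmaIncr (Icc a b)ᶜ) _

theorem measurable_concat_zero_sigmaIncr (hab : a ≤ b) :
    Measurable[sigmaIncr (Icc a b)ᶜ] fun y : IncrementPath d => concat a b 0 y := by
  refine @measurable_of_eval d _ (sigmaIncr (Icc a b)ᶜ) _ fun s t => ?_
  have : (fun y : IncrementPath d => concat a b 0 y s t) =
      fun y => y s (clamp a b s) - y t (clamp a b t) := by
    funext y
    rw [concat_apply, IncrementPath.zero_apply, zero_add, ← y.cocycle s (clamp a b s) t,
      ← y.cocycle (clamp a b s) (clamp a b t) t, ← neg_apply_swap y t]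
    abel
  rw [this]
  exact (measurable_eval_clamp hab s).sub (measurable_eval_clamp hab t)

end Outside

/-! ### The Gibbs kernels form a specification -/

section Specification

variable {W : EuclideanSpace ℝ (Fin d) → ℝ → ℝ} {μ : Measure (IncrementPath d)} {a b : ℝ}

theorem envelope_pos (k a b : ℝ) (x : IncrementPath d) : 0 < envelope k a b x :=
  ENNReal.ofReal_pos.2 (Real.exp_pos _)

theorem exists_le_partitionZ (hμ : IsBrownianIncrementLaw μ) (hW : IsAdmissible W) (lam : ℝ)
    (hab : a ≤ b) : ∃ z : ℝ≥0∞, z ≠ 0 ∧ ∀ y, z ≤ partitionZ μ W lam a b y := by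
  have := hμ.isProbabilityMeasure
  obtain ⟨k, hk⟩ := exists_weight_bounds hW lam hab
  refine ⟨∫⁻ x, envelope (-k) a b x ∂μ, ?_, fun y => lintegral_mono fun x => (hk x y).1⟩
  rw [Ne, lintegral_eq_zero_iff (measurable_envelope _ _ _)]
  intro h
  obtain ⟨x, hx⟩ := h.exists
  exact (envelope_pos _ _ _ x).ne' hx

theorem partitionZ_ne_zero (hμ : IsBrownianIncrementLaw μ) (hW : IsAdmissible W) (lam : ℝ)
    (hab : a ≤ b) (y : IncrementPath d) : partitionZ μ W lam a b y ≠ 0 := by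
  obtain ⟨z, hz, hle⟩ := exists_le_partitionZ hμ hW lam hab
  exact fun h => hz (le_zero_iff.1 (h ▸ hle y))

theorem partitionZ_ne_top (hμ : IsBrownianIncrementLaw μ) (hW : IsAdmissible W) (lam : ℝ)
    (hab : a ≤ b) (y : IncrementPath d) : partitionZ μ W lam a b y ≠ ∞ := by
  obtain ⟨k, hk⟩ := exists_weight_bounds hW lam hab
  exact ((lintegral_mono fun x => (hk x y).2).trans_lt (hμ.lintegral_envelope_lt_top k a b)).ne

theorem lintegral_gibbsKernel (hW : IsAdmissible W) (lam : ℝ) (hab : a ≤ b) (y : IncrementPath d)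
    {f : IncrementPath d → ℝ≥0∞} (hf : Measurable f) :
    ∫⁻ z, f z ∂(gibbsKernel μ W lam a b y) = (partitionZ μ W lam a b y)⁻¹ *
      ∫⁻ x, weight W lam a b x y * f (concat a b x y) ∂μ := by
  have hfc : Measurable fun x => f (concat a b x y) := hf.comp (measurable_concat_left a b y)
  rw [gibbsKernel, lintegral_smul_measure, lintegral_map hf (measurable_concat_left a b y),
    lintegral_withDensity_eq_lintegral_mul _ (measurable_weight_left hW hab lam y) hfc]
  rfl

theorem gibbsKernel_apply (hW : IsAdmissible W) (lam : ℝ) (hab : a ≤ b) (y : IncrementPath d)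
    {A : Set (IncrementPath d)} (hA : MeasurableSet A) :
    gibbsKernel μ W lam a b y A = (partitionZ μ W lam a b y)⁻¹ *
      ∫⁻ x, weight W lam a b x y * A.indicator 1 (concat a b x y) ∂μ := by
  rw [← lintegral_gibbsKernel hW lam hab y (measurable_one.indicator hA),
    lintegral_indicator_one hA]

theorem gibbsKernel_isProbabilityMeasure (hμ : IsBrownianIncrementLaw μ) (hW : IsAdmissible W)
    (lam : ℝ) (hab : a ≤ b) (y : IncrementPath d) :
    IsProbabilityMeasure (gibbsKernel μ W lam a b y) := by
  refine ⟨?_⟩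
  rw [gibbsKernel_apply hW lam hab y MeasurableSet.univ]
  simp only [indicator_univ, Pi.one_apply, mul_one]
  exact ENNReal.inv_mul_cancel (partitionZ_ne_zero hμ hW lam hab y)
    (partitionZ_ne_top hμ hW lam hab y)

theorem partitionZ_concat_right (hab : a ≤ b) (lam : ℝ) (u y : IncrementPath d) :
    partitionZ μ W lam a b (concat a b u y) = partitionZ μ W lam a b y := by
  simp only [partitionZ, weight_concat_right hab]

/-- The kernel depends on `y` only through its increments outside of `[a, b]`. -/
theorem gibbsKernel_concat_right (hab : a ≤ b) (lam : ℝ) (u y : IncrementPath d) :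
    gibbsKernel μ W lam a b (concat a b u y) = gibbsKernel μ W lam a b y := by
  simp only [gibbsKernel, partitionZ_concat_right hab, weight_concat_right hab,
    concat_concat_right hab le_rfl le_rfl]

theorem measurable_partitionZ [SFinite μ] (hW : IsAdmissible W) (lam : ℝ) (hab : a ≤ b) :
    Measurable (partitionZ μ W lam a b) :=
  Measurable.lintegral_prod_right' (f := fun p : IncrementPath d × IncrementPath d =>
    weight W lam a b p.2 p.1) ((measurable_weight hW hab lam).comp measurable_swap)

theorem measurable_gibbsKernel [SFinite μ] (hW : IsAdmissible W) (lam : ℝ) (hab : a ≤ b) :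
    Measurable (gibbsKernel μ W lam a b) := by
  refine Measure.measurable_of_measurable_coe _ fun A hA => ?_
  simp only [gibbsKernel_apply hW lam hab _ hA]
  refine (measurable_partitionZ hW lam hab).inv.mul ?_
  exact Measurable.lintegral_prod_right' (f := fun p : IncrementPath d × IncrementPath d =>
    weight W lam a b p.2 p.1 * A.indicator 1 (concat a b p.2 p.1))
    (((measurable_weight hW hab lam).comp measurable_swap).mul
      ((measurable_one.indicator hA).comp ((measurable_concat a b).comp measurable_swap)))

/-- Consistency rests on the independence under `μ` of the increments inside and outside of
`[a, b]`: resampling the inside produces the smaller partition function as a common factor. -/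
theorem lintegral_gibbsKernel_gibbsKernel (hμ : IsBrownianIncrementLaw μ) (hW : IsAdmissible W)
    (lam : ℝ) (hab : a ≤ b) {a' b' : ℝ} (ha : a' ≤ a) (hb : b ≤ b') (y : IncrementPath d)
    {A : Set (IncrementPath d)} (hA : MeasurableSet A) :
    ∫⁻ z, gibbsKernel μ W lam a b z A ∂(gibbsKernel μ W lam a' b' y) =
      gibbsKernel μ W lam a' b' y A := by
  have := hμ.isProbabilityMeasure
  have hab' : a' ≤ b' := ha.trans (hab.trans hb)
  have hmA : Measurable fun z => gibbsKernel μ W lam a b z A :=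
    Measure.measurable_coe hA |>.comp (measurable_gibbsKernel hW lam hab)
  have hmI : Measurable (A.indicator (1 : IncrementPath d → ℝ≥0∞)) := measurable_one.indicator hA
  rw [lintegral_gibbsKernel hW lam hab' y hmA, gibbsKernel_apply hW lam hab' y hA]
  congr 1
  have hw' := measurable_weight_left hW hab' lam y
  have hc' := measurable_concat_left a' b' y
  have hf₁ : Measurable fun x => weight W lam a' b' x y *
      gibbsKernel μ W lam a b (concat a' b' x y) A := hw'.mul (hmA.comp hc')
  have hf₂ : Measurable fun x => weight W lam a' b' x y *
      A.indicator 1 (concat a' b' x y) := hw'.mul (hmI.comp hc')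
  rw [← hμ.lintegral_concat hab hf₁, ← hμ.lintegral_concat hab hf₂]
  refine lintegral_congr fun x => ?_
  set z := concat a' b' x y with hz
  -- the weight in `[a', b']` factorises
  set g : ℝ≥0∞ := ENNReal.ofReal (Real.exp (-lam * (energyU W a' b' 0 +
    energyDiff W a' b' (concat a b 0 x) y - energyU W a b 0))) with hg
  have hfac : ∀ u, weight W lam a' b' (concat a b u x) y = g * weight W lam a b u z := by
    intro u
    rw [weight_eq hW hab', weight_eq hW hab, hg, ← ENNReal.ofReal_mul (Real.exp_pos _).le,
      ← Real.exp_add, hW.energyDiff_concat hab ha hb, ← hz]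
    ring_nf
  have hwz := measurable_weight_left hW hab lam z
  simp only [hfac, concat_concat_nested hab ha hb, ← hz, gibbsKernel_concat_right hab, mul_assoc]
  have hf₃ : Measurable fun u => weight W lam a b u z * A.indicator 1 (concat a b u z) :=
    hwz.mul (hmI.comp (measurable_concat_left a b z))
  rw [lintegral_const_mul _ (hwz.mul_const _), lintegral_const_mul _ hf₃,
    lintegral_mul_const _ hwz, gibbsKernel_apply hW lam hab z hA, ← mul_assoc (∫⁻ _, _ ∂μ)]
  have hZ : ∫⁻ u, weight W lam a b u z ∂μ = partitionZ μ W lam a b z := rfl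
  rw [hZ, ENNReal.mul_inv_cancel (partitionZ_ne_zero hμ hW lam hab z)
    (partitionZ_ne_top hμ hW lam hab z), one_mul]

theorem isSpecification_gibbsKernel (hμ : IsBrownianIncrementLaw μ) (hW : IsAdmissible W)
    (lam : ℝ) : IsSpecification (gibbsKernel μ W lam) where
  prob a b hab y := gibbsKernel_isProbabilityMeasure hμ hW lam hab.le y
  measurable a b hab A hA := by
    have := hμ.isProbabilityMeasure
    have h : (fun y => gibbsKernel μ W lam a b y A) =
        (fun y => gibbsKernel μ W lam a b y A) ∘ fun y => concat a b 0 y := by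
      funext y
      simp [Function.comp, gibbsKernel_concat_right hab.le]
    rw [h]
    exact ((Measure.measurable_coe hA).comp (measurable_gibbsKernel hW lam hab.le)).comp
      (measurable_concat_zero_sigmaIncr hab.le)
  proper a b hab y A B hA hB := by
    rw [gibbsKernel_apply hW lam hab.le y (hA.inter (sigmaIncr_le _ _ hB)),
      gibbsKernel_apply hW lam hab.le y hA]
    have h : ∀ x, (A ∩ B).indicator (1 : IncrementPath d → ℝ≥0∞) (concat a b x y) =
        B.indicator 1 y * A.indicator 1 (concat a b x y) := by
      intro x
      have := mem_concat_iff_of_measurableSet hab.le hB x y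
      by_cases hy : y ∈ B
      · by_cases hA' : concat a b x y ∈ A
        · rw [indicator_of_mem (show _ ∈ A ∩ B from ⟨hA', this.2 hy⟩), indicator_of_mem hy,
            indicator_of_mem hA']
          simp
        · rw [indicator_of_notMem (fun h => hA' h.1), indicator_of_notMem hA', mul_zero]
      · simp [indicator, hy, this]
    simp only [h]
    by_cases hy : y ∈ B <;> simp [hy]
  consistent a b a' b' hab ha hb y A hA :=
    lintegral_gibbsKernel_gibbsKernel hμ hW lam hab.le ha hb y hA

theorem gibbsKernel_map_translate (hμ : IsBrownianIncrementLaw μ) (hW : IsAdmissible W)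
    (lam : ℝ) (hab : a ≤ b) (c : ℝ) (y : IncrementPath d) :
    (gibbsKernel μ W lam a b y).map (IncrementPath.translate c) =
      gibbsKernel μ W lam (a - c) (b - c) (IncrementPath.translate c y) := by
  have hab' : a - c ≤ b - c := by linarith
  have hmt := measurable_translate (d := d) c
  have hZ : partitionZ μ W lam (a - c) (b - c) (IncrementPath.translate c y) =
      partitionZ μ W lam a b y := by
    rw [partitionZ, partitionZ]
    conv_lhs => rw [← hμ.map_translate c]
    rw [lintegral_map (measurable_weight_left hW hab' lam _) hmt]
    simp only [weight_translate]
  ext A hA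
  rw [Measure.map_apply hmt hA, gibbsKernel_apply hW lam hab y (hmt hA),
    gibbsKernel_apply hW lam hab' _ hA, hZ]
  congr 1
  conv_rhs => rw [← hμ.map_translate c]
  have hf : Measurable fun x => weight W lam (a - c) (b - c) x (IncrementPath.translate c y) *
      A.indicator 1 (concat (a - c) (b - c) x (IncrementPath.translate c y)) :=
    (measurable_weight_left hW hab' lam _).mul
      ((measurable_one.indicator hA).comp (measurable_concat_left _ _ _))
  rw [lintegral_map hf hmt]
  simp only [weight_translate, ← translate_concat]
  rfl

/-- Under the Gibbs kernels with all boundary conditions, the increments in `[a, b]` have densities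
with one integrable majorant. This is stated for paths whose outside is sampled from `μ`. -/
theorem exists_gibbsKernel_domination (hμ : IsBrownianIncrementLaw μ) (hW : IsAdmissible W)
    (lam : ℝ) (hab : a ≤ b) :
    ∃ m : Measure (IncrementPath d), IsFiniteMeasure m ∧ m ≪ μ ∧ ∀ y A, MeasurableSet A →
      ∫⁻ z, ∫⁻ x, A.indicator 1 (concat a b z x) ∂μ ∂(gibbsKernel μ W lam a b y) ≤ m A := by
  have := hμ.isProbabilityMeasure
  obtain ⟨k, hk⟩ := exists_weight_bounds hW lam hab
  obtain ⟨z₀, hz₀, hle⟩ := exists_le_partitionZ hμ hW lam hab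
  have hme := measurable_envelope (d := d) k a b
  refine ⟨z₀⁻¹ • μ.withDensity (envelope k a b), ?_, ?_, fun y A hA => ?_⟩
  · have : IsFiniteMeasure (μ.withDensity (envelope k a b)) :=
      isFiniteMeasure_withDensity (hμ.lintegral_envelope_lt_top k a b).ne
    exact Measure.smul_finite _ (ENNReal.inv_ne_top.2 hz₀)
  · exact (withDensity_absolutelyContinuous _ _).smul_left _
  · have hmI : Measurable (A.indicator (1 : IncrementPath d → ℝ≥0∞)) := measurable_one.indicator hA
    have hmc : Measurable fun p : IncrementPath d × IncrementPath d =>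
        A.indicator (1 : IncrementPath d → ℝ≥0∞) (concat a b p.1 p.2) :=
      hmI.comp (measurable_concat a b)
    rw [lintegral_gibbsKernel hW lam hab y hmc.lintegral_prod_right', Measure.smul_apply,
      smul_eq_mul, withDensity_apply _ hA]
    simp only [concat_concat_left hab le_rfl le_rfl]
    refine mul_le_mul' (ENNReal.inv_le_inv.2 (hle y)) ?_
    calc ∫⁻ x, weight W lam a b x y * ∫⁻ x', A.indicator 1 (concat a b x x') ∂μ ∂μ
        ≤ ∫⁻ x, ∫⁻ x', envelope k a b (concat a b x x') *
            A.indicator 1 (concat a b x x') ∂μ ∂μ := by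
          refine lintegral_mono fun x => ?_
          simp only [envelope_concat hab]
          have hf : Measurable fun x' => A.indicator (1 : IncrementPath d → ℝ≥0∞)
              (concat a b x x') := hmI.comp (measurable_concat_right a b x)
          rw [lintegral_const_mul _ hf]
          gcongr
          exact (hk x y).2
      _ = ∫⁻ x', ∫⁻ x, envelope k a b (concat a b x x') *
            A.indicator 1 (concat a b x x') ∂μ ∂μ :=
          lintegral_lintegral_swap ((hme.comp (measurable_concat a b)).mul hmc).aemeasurable
      _ = ∫⁻ x, envelope k a b x * A.indicator 1 x ∂μ := hμ.lintegral_concat hab (hme.mul hmI)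
      _ = ∫⁻ x in A, envelope k a b x ∂μ := by
          rw [← lintegral_indicator hA]
          refine lintegral_congr fun x => ?_
          by_cases hx : x ∈ A <;> simp [hx]

end Specification

/-! ### Setwise limits of dominated measures -/

section SetwiseLimit

variable {α ι : Type*} [MeasurableSpace α]

theorem exists_tendsto_ultrafilter {β : Type*} [TopologicalSpace β] [CompactSpace β]
    (l : Ultrafilter ι) (f : ι → β) : ∃ c, Tendsto f l (𝓝 c) :=
  ⟨(l.map f).lim, (l.map f).le_nhds_lim⟩

/-- Along an ultrafilter, measures dominated by one finite measure converge setwise to a measure. -/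
theorem exists_measure_tendsto_of_le (l : Ultrafilter ι) (ρ : ι → Measure α) (m : Measure α)
    [IsFiniteMeasure m] (h : ∀ᶠ i in l, ∀ A, MeasurableSet A → ρ i A ≤ m A) :
    ∃ ρ' : Measure α, (∀ A, MeasurableSet A → ρ' A ≤ m A) ∧
      ∀ A, MeasurableSet A → Tendsto (fun i => ρ i A) l (𝓝 (ρ' A)) := by
  choose L hL using fun A : Set α => exists_tendsto_ultrafilter l fun i => ρ i A
  have hLm : ∀ A, MeasurableSet A → L A ≤ m A := fun A hA =>
    le_of_tendsto (hL A) (h.mono fun i hi => hi A hA)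
  have hfin : ∀ A, MeasurableSet A → L A ≠ ∞ := fun A hA =>
    ne_top_of_le_ne_top (measure_ne_top m A) (hLm A hA)
  have hempty : L ∅ = 0 := tendsto_nhds_unique (hL ∅) (by simp)
  have hUnion : ∀ ⦃f : ℕ → Set α⦄, (∀ j, MeasurableSet (f j)) →
      Pairwise (Function.onFun Disjoint f) → L (⋃ j, f j) = ∑' j, L (f j) := by
    intro f hf hd
    have hsum : ∑' j, m (f j) ≠ ∞ := by
      rw [← measure_iUnion hd hf]; exact measure_ne_top _ _
    have hsumL : ∑' j, L (f j) ≠ ∞ :=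
      ne_top_of_le_ne_top hsum (ENNReal.tsum_le_tsum fun j => hLm _ (hf j))
    have hdom : Tendsto (fun i => ∑' j, (ρ i (f j)).toReal) l (𝓝 (∑' j, (L (f j)).toReal)) := by
      refine tendsto_tsum_of_dominated_convergence (bound := fun j => (m (f j)).toReal)
        (ENNReal.summable_toReal hsum) (fun j => (ENNReal.tendsto_toReal (hfin _ (hf j))).comp
          (hL (f j))) ?_
      filter_upwards [h] with i hi j
      rw [Real.norm_eq_abs, abs_of_nonneg ENNReal.toReal_nonneg]
      exact ENNReal.toReal_mono (measure_ne_top _ _) (hi _ (hf j))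
    have hU : Tendsto (fun i => (ρ i (⋃ j, f j)).toReal) l (𝓝 (L (⋃ j, f j)).toReal) :=
      (ENNReal.tendsto_toReal (hfin _ (MeasurableSet.iUnion hf))).comp (hL _)
    have heq : (fun i => (ρ i (⋃ j, f j)).toReal) =ᶠ[l] fun i => ∑' j, (ρ i (f j)).toReal := by
      filter_upwards [h] with i hi
      rw [measure_iUnion hd hf, ENNReal.tsum_toReal_eq]
      exact fun j => ne_top_of_le_ne_top (measure_ne_top m _) (hi _ (hf j))
    have := tendsto_nhds_unique (hU.congr' heq) hdom
    rw [← ENNReal.tsum_toReal_eq fun j => hfin _ (hf j)] at this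
    exact (ENNReal.toReal_eq_toReal_iff' (hfin _ (MeasurableSet.iUnion hf)) hsumL).1 this
  refine ⟨Measure.ofMeasurable (fun A _ => L A) hempty fun f hf hd => hUnion hf hd,
    fun A hA => ?_, fun A hA => ?_⟩ <;> rw [Measure.ofMeasurable_apply A hA]
  · exact hLm A hA
  · exact hL A

theorem lintegral_le_of_tendsto_setwise {l : Filter ι} [l.NeBot] {ρ : ι → Measure α}
    {ρ' : Measure α} (h : ∀ A, MeasurableSet A → Tendsto (fun i => ρ i A) l (𝓝 (ρ' A)))
    {f : α → ℝ≥0∞} {c : ℝ≥0∞} (hc : Tendsto (fun i => ∫⁻ x, f x ∂ρ i) l (𝓝 c)) :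
    ∫⁻ x, f x ∂ρ' ≤ c := by
  rw [lintegral_eq_nnreal]
  refine iSup₂_le fun φ hφ => ?_
  have h1 : Tendsto (fun i => (φ.map ((↑) : ℝ≥0 → ℝ≥0∞)).lintegral (ρ i)) l
      (𝓝 ((φ.map ((↑) : ℝ≥0 → ℝ≥0∞)).lintegral ρ')) := by
    simp only [SimpleFunc.map_lintegral]
    refine tendsto_finsetSum _ fun r _ => ?_
    exact ENNReal.Tendsto.const_mul (h _ (φ.measurableSet_fiber r)) (Or.inr ENNReal.coe_ne_top)
  refine le_of_tendsto_of_tendsto' h1 hc fun i => ?_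
  rw [← SimpleFunc.lintegral_eq_lintegral]
  exact lintegral_mono hφ

/-- Setwise convergence of probability measures implies convergence of the integrals of bounded
measurable functions. -/
theorem tendsto_lintegral_of_tendsto_setwise {l : Ultrafilter ι} {ρ : ι → Measure α}
    {ρ' : Measure α} [∀ i, IsProbabilityMeasure (ρ i)] [IsProbabilityMeasure ρ']
    (h : ∀ A, MeasurableSet A → Tendsto (fun i => ρ i A) l (𝓝 (ρ' A)))
    {f : α → ℝ≥0∞} (hf : Measurable f) (hf1 : ∀ x, f x ≤ 1) :
    Tendsto (fun i => ∫⁻ x, f x ∂ρ i) l (𝓝 (∫⁻ x, f x ∂ρ')) := by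
  obtain ⟨c, hc⟩ := exists_tendsto_ultrafilter l fun i => ∫⁻ x, f x ∂ρ i
  have hle1 : ∀ (P : Measure α) [IsProbabilityMeasure P], ∫⁻ x, f x ∂P ≤ 1 := fun P _ =>
    (lintegral_mono hf1).trans (by simp)
  have hsub : ∀ (P : Measure α) [IsProbabilityMeasure P],
      ∫⁻ x, (1 - f x) ∂P = 1 - ∫⁻ x, f x ∂P := fun P _ => by
    rw [lintegral_sub hf ((hle1 P).trans_lt ENNReal.one_lt_top).ne (ae_of_all _ hf1)]
    simp
  have hc1 : c ≤ 1 := le_of_tendsto' hc fun i => hle1 (ρ i)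
  have hc' : Tendsto (fun i => ∫⁻ x, (1 - f x) ∂ρ i) l (𝓝 (1 - c)) := by
    simp only [hsub]
    exact ENNReal.Tendsto.sub tendsto_const_nhds hc (Or.inl ENNReal.one_ne_top)
  have h1 := lintegral_le_of_tendsto_setwise h hc
  have h2 := lintegral_le_of_tendsto_setwise h hc'
  rw [hsub] at h2
  have h3 : c ≤ ∫⁻ x, f x ∂ρ' := by
    have h4 : 1 ≤ (1 - c) + ∫⁻ x, f x ∂ρ' := tsub_le_iff_right.1 h2
    have h5 : c + (1 - c) ≤ (∫⁻ x, f x ∂ρ') + (1 - c) := by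
      rw [add_tsub_cancel_of_le hc1, add_comm]; exact h4
    exact (ENNReal.add_le_add_iff_right (ne_top_of_le_ne_top ENNReal.one_ne_top tsub_le_self)).1 h5
  rwa [le_antisymm h3 h1] at hc

end SetwiseLimit

/-! ### Windows -/

/-- `x ⊗_I y` for the window `I = [-(n + 1), n + 1]`. -/
def window (n : ℕ) (x y : IncrementPath d) : IncrementPath d :=
  concat (-((n : ℝ) + 1)) ((n : ℝ) + 1) x y

theorem neg_window_le (n : ℕ) : -((n : ℝ) + 1) ≤ (n : ℝ) + 1 := by
  linarith [n.cast_nonneg (α := ℝ)]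

theorem measurable_window (n : ℕ) :
    Measurable fun p : IncrementPath d × IncrementPath d => window n p.1 p.2 :=
  measurable_concat _ _

theorem measurable_window_left (n : ℕ) (y : IncrementPath d) : Measurable fun x => window n x y :=
  measurable_concat_left _ _ y

theorem measurable_window_right (n : ℕ) (x : IncrementPath d) : Measurable fun y => window n x y :=
  measurable_concat_right _ _ x

theorem window_window_of_le {n m : ℕ} (h : n ≤ m) (x z y : IncrementPath d) :
    window n (window m x z) y = window n x y := by
  have : (n : ℝ) ≤ m := by exact_mod_cast h
  exact concat_concat_left (neg_window_le n) (by linarith) (by linarith) x z y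

theorem window_apply_of_mem {n : ℕ} (x y : IncrementPath d) {s t : ℝ}
    (hs : s ∈ Icc (-((n : ℝ) + 1)) (n + 1)) (ht : t ∈ Icc (-((n : ℝ) + 1)) (n + 1)) :
    window n x y s t = x s t :=
  concat_eq_inside x y hs ht

theorem window_zero_eq_iff {n : ℕ} {x y : IncrementPath d} : window n x 0 = window n y 0 ↔
    ∀ s ∈ Icc (-((n : ℝ) + 1)) (n + 1), ∀ t ∈ Icc (-((n : ℝ) + 1)) (n + 1), x s t = y s t := by
  constructor
  · intro h s hs t ht
    rw [← window_apply_of_mem x 0 hs ht, h, window_apply_of_mem y 0 hs ht]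
  · intro h
    ext1 s t
    simp only [window, concat_apply,
      h _ (clamp_mem (neg_window_le n) s) _ (clamp_mem (neg_window_le n) t)]

theorem exists_mem_window (s : ℝ) : ∃ N : ℕ, ∀ n, N ≤ n → s ∈ Ioo (-((n : ℝ) + 1)) (n + 1) := by
  obtain ⟨N, hN⟩ := exists_nat_ge |s|
  refine ⟨N, fun n hn => abs_lt.1 ?_⟩
  have : (N : ℝ) ≤ n := by exact_mod_cast hn
  linarith

/-- A law on increment paths is determined by its restrictions to all windows. -/
theorem measure_ext_of_window {P P' : Measure (IncrementPath d)} [IsProbabilityMeasure P]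
    (h : ∀ n, P.map (fun x => window n x 0) = P'.map fun x => window n x 0) : P = P' := by
  refine measure_ext_of_gridIncr ∅ fun N t _ _ => ?_
  obtain ⟨n, hn⟩ : ∃ n : ℕ, ∀ i, t i ∈ Icc (-((n : ℝ) + 1)) (n + 1) := by
    choose N hN using fun i => exists_mem_window (t i)
    refine ⟨Finset.univ.sup N, fun i => ?_⟩
    exact Ioo_subset_Icc_self (hN i _ (Finset.le_sup (Finset.mem_univ i)))
  have hg : gridIncr t = gridIncr (d := d) t ∘ fun x => window n x 0 := by
    funext x
    funext i
    exact (window_apply_of_mem x 0 (hn _) (hn _)).symm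
  rw [hg, ← Measure.map_map (measurable_gridIncr t) (measurable_window_left n 0),
    ← Measure.map_map (measurable_gridIncr t) (measurable_window_left n 0), h n]

theorem path_eq_of_rat {x y : IncrementPath d} (h : ∀ q r : ℚ, x q r = y q r) : x = y := by
  have hd : DenseRange fun p : ℚ × ℚ => ((p.1 : ℝ), (p.2 : ℝ)) :=
    Rat.denseRange_cast.prodMap Rat.denseRange_cast
  have := hd.equalizer x.continuous_toFun y.continuous_toFun (funext fun p => h p.1 p.2)
  ext1 s t
  exact congrFun this (s, t)

theorem measurableSet_eq_path {α : Type*} [MeasurableSpace α] {f g : α → IncrementPath d}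
    (hf : Measurable f) (hg : Measurable g) : MeasurableSet {ω | f ω = g ω} := by
  have : {ω | f ω = g ω} = ⋂ (q : ℚ) (r : ℚ), {ω | f ω q r = g ω q r} := by
    ext ω
    simp only [mem_ofPred_eq, mem_iInter]
    exact ⟨fun h q r => by rw [h], path_eq_of_rat⟩
  rw [this]
  exact MeasurableSet.iInter fun q => MeasurableSet.iInter fun r =>
    measurableSet_eq_fun ((measurable_eval _ _).comp hf) ((measurable_eval _ _).comp hg)

/-- Paths that are consistent along the windows can be glued. -/
theorem exists_path_of_windows {ω : ℕ → IncrementPath d}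
    (h : ∀ n, window n (ω (n + 1)) 0 = window n (ω n) 0) :
    ∃ z : IncrementPath d, ∀ n, window n z 0 = window n (ω n) 0 := by
  have hchain : ∀ n m, n ≤ m → window n (ω m) 0 = window n (ω n) 0 := by
    intro n m hnm
    induction m, hnm using Nat.le_induction with
    | base => rfl
    | succ m hnm ih =>
      rw [← ih, ← window_window_of_le hnm (ω (m + 1)) 0 0, h m, window_window_of_le hnm]
  have hagree : ∀ n m : ℕ, n ≤ m → ∀ s ∈ Icc (-((n : ℝ) + 1)) (n + 1),
      ∀ t ∈ Icc (-((n : ℝ) + 1)) (n + 1), ω m s t = ω n s t := fun n m hnm =>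
    window_zero_eq_iff.1 (hchain n m hnm)
  choose N hN using exists_mem_window
  have hN' : ∀ (s : ℝ) (n : ℕ), N s ≤ n → s ∈ Icc (-((n : ℝ) + 1)) (n + 1) := fun s n hn =>
    Ioo_subset_Icc_self (hN s n hn)
  have hval : ∀ (s t : ℝ) (n : ℕ), s ∈ Icc (-((n : ℝ) + 1)) (n + 1) →
      t ∈ Icc (-((n : ℝ) + 1)) (n + 1) →
      ω (max (N s) (N t)) s t = ω n s t := by
    intro s t n hs ht
    rcases le_total n (max (N s) (N t)) with hn | hn
    · exact hagree _ _ hn s hs t ht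
    · exact (hagree _ _ hn s (hN' s _ (le_max_left _ _)) t (hN' t _ (le_max_right _ _))).symm
  refine ⟨⟨fun s t => ω (max (N s) (N t)) s t, ?_, fun t => (ω _).diag t, fun s u t => ?_⟩,
    fun n => window_zero_eq_iff.2 fun s hs t ht => hval s t n hs ht⟩
  · refine continuous_iff_continuousAt.2 fun p => ?_
    set n := max (N p.1) (N p.2) with hn
    have hmem : ∀ᶠ q : ℝ × ℝ in 𝓝 p, q ∈ Ioo (-((n : ℝ) + 1)) (n + 1) ×ˢ
        Ioo (-((n : ℝ) + 1)) (n + 1) :=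
      (isOpen_Ioo.prod isOpen_Ioo).mem_nhds
        ⟨hN p.1 n (le_max_left _ _), hN p.2 n (le_max_right _ _)⟩
    refine ((ω n).continuous_toFun.continuousAt (x := p)).congr ?_
    filter_upwards [hmem] with q hq
    exact (hval _ _ n (Ioo_subset_Icc_self hq.1) (Ioo_subset_Icc_self hq.2)).symm
  · set n := max (N s) (max (N u) (N t))
    have hs := hN' s n (le_max_left _ _)
    have hu := hN' u n ((le_max_left _ _).trans (le_max_right _ _))
    have ht := hN' t n ((le_max_right _ _).trans (le_max_right _ _))
    rw [hval s u n hs hu, hval u t n hu ht, hval s t n hs ht, (ω n).cocycle]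

/-- Random paths that are consistent along the windows can be glued to a random path. -/
theorem exists_measurable_glue : ∃ G : (ℕ → IncrementPath d) → IncrementPath d, Measurable G ∧
    ∀ ω, (∀ n, window n (ω (n + 1)) 0 = window n (ω n) 0) →
      ∀ n, window n (G ω) 0 = window n (ω n) 0 := by
  classical
  set S : Set (ℕ → IncrementPath d) := {ω | ∀ n, window n (ω (n + 1)) 0 = window n (ω n) 0} with hS
  have hSm : MeasurableSet S := by
    rw [hS, ofPred_forall]
    exact MeasurableSet.iInter fun n => measurableSet_eq_path
      ((measurable_window_left n 0).comp (measurable_pi_apply _))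
      ((measurable_window_left n 0).comp (measurable_pi_apply _))
  choose z hz using fun (ω : ℕ → IncrementPath d) (h : ω ∈ S) => exists_path_of_windows h
  refine ⟨fun ω => if h : ω ∈ S then z ω h else 0, measurable_of_eval fun s t => ?_,
    fun ω h n => ?_⟩
  · obtain ⟨N₁, h₁⟩ := exists_mem_window s
    obtain ⟨N₂, h₂⟩ := exists_mem_window t
    set n := max N₁ N₂
    have : (fun ω => (if h : ω ∈ S then z ω h else 0 : IncrementPath d) s t) =
        S.indicator fun ω => ω n s t := by
      funext ω
      by_cases h : ω ∈ S
      · rw [dif_pos h, indicator_of_mem h]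
        exact window_zero_eq_iff.1 (hz ω h n) s (Ioo_subset_Icc_self (h₁ n (le_max_left _ _))) t
          (Ioo_subset_Icc_self (h₂ n (le_max_right _ _)))
      · rw [dif_neg h, indicator_of_notMem h, IncrementPath.zero_apply]
    rw [this]
    have hm : Measurable fun ω : ℕ → IncrementPath d => ω n s t :=
      (measurable_eval s t).comp (measurable_pi_apply n)
    exact hm.indicator hSm
  · have hω : ω ∈ S := h
    simp only [dif_pos hω]
    exact hz ω hω n

/-! ### Extending consistent local laws -/

section Extension

variable {μ : Measure (IncrementPath d)}

namespace IsBrownianIncrementLaw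

theorem lintegral_window (hμ : IsBrownianIncrementLaw μ) (k : ℕ) {f : IncrementPath d → ℝ≥0∞}
    (hf : Measurable f) : ∫⁻ z, ∫⁻ x, f (window k z x) ∂μ ∂μ = ∫⁻ x, f x ∂μ := by
  have := hμ.isProbabilityMeasure
  rw [← hμ.lintegral_concat (neg_window_le k) hf,
    lintegral_lintegral_swap (f := fun z x => f (window k z x))
      (hf.comp (measurable_window k)).aemeasurable]
  rfl

/-- If `x` and `z` are independent with law `μ`, then `(z, z ⊗ x)` and `(z ⊗ x, z)` have the same
law: both are pairs of Brownian paths that share the increments in the window and are otherwise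
independent. -/
theorem lintegral_window_swap (hμ : IsBrownianIncrementLaw μ) (k : ℕ)
    {f : IncrementPath d × IncrementPath d → ℝ≥0∞} (hf : Measurable f) :
    ∫⁻ z, ∫⁻ x, f (z, window k z x) ∂μ ∂μ = ∫⁻ z, ∫⁻ x, f (window k z x, z) ∂μ ∂μ := by
  have := hμ.isProbabilityMeasure
  have hw := measurable_window (d := d) k
  have h1 : Measurable fun z => ∫⁻ x, f (z, window k z x) ∂μ :=
    Measurable.lintegral_prod_right' (f := fun p : IncrementPath d × IncrementPath d =>
      f (p.1, window k p.1 p.2)) (hf.comp (measurable_fst.prodMk hw))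
  have h2 : Measurable fun z => ∫⁻ x, f (window k z x, z) ∂μ :=
    Measurable.lintegral_prod_right' (f := fun p : IncrementPath d × IncrementPath d =>
      f (window k p.1 p.2, p.1)) (hf.comp (hw.prodMk measurable_fst))
  rw [← hμ.lintegral_window k h1, ← hμ.lintegral_window k h2]
  refine lintegral_congr fun u => ?_
  simp only [window_window_of_le le_rfl]
  rw [lintegral_lintegral_swap]
  have hwu := measurable_window_right k u
  exact (hf.comp ((hwu.comp measurable_fst).prodMk (hwu.comp measurable_snd))).aemeasurable

end IsBrownianIncrementLaw

/-- The law of a path whose increments inside the window are sampled from `P` and whose increments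
outside of it are sampled from `μ`. -/
noncomputable def refresh (μ : Measure (IncrementPath d)) (k : ℕ) (P : Measure (IncrementPath d)) :
    Measure (IncrementPath d) :=
  (P.prod μ).map fun p => window k p.1 p.2

theorem lintegral_refresh [SFinite μ] (k : ℕ) (P : Measure (IncrementPath d))
    {f : IncrementPath d → ℝ≥0∞} (hf : Measurable f) :
    ∫⁻ z, f z ∂(refresh μ k P) = ∫⁻ z, ∫⁻ x, f (window k z x) ∂μ ∂P := by
  rw [refresh, lintegral_map hf (measurable_window k)]
  exact lintegral_prod _ (hf.comp (measurable_window k)).aemeasurable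

theorem refresh_apply [SFinite μ] (k : ℕ) (P : Measure (IncrementPath d))
    {A : Set (IncrementPath d)} (hA : MeasurableSet A) :
    refresh μ k P A = ∫⁻ z, ∫⁻ x, A.indicator 1 (window k z x) ∂μ ∂P := by
  rw [← lintegral_refresh k P (measurable_one.indicator hA), lintegral_indicator_one hA]

theorem isProbabilityMeasure_refresh [IsProbabilityMeasure μ] (k : ℕ)
    (P : Measure (IncrementPath d)) [IsProbabilityMeasure P] :
    IsProbabilityMeasure (refresh μ k P) :=
  Measure.isProbabilityMeasure_map (measurable_window k).aemeasurable

theorem map_window_refresh [IsProbabilityMeasure μ] (k : ℕ) (P : Measure (IncrementPath d)) :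
    (refresh μ k P).map (fun z => window k z 0) = P.map fun z => window k z 0 := by
  rw [refresh, Measure.map_map (measurable_window_left k 0) (measurable_window k)]
  have : (fun z => window k z 0) ∘ (fun p : IncrementPath d × IncrementPath d =>
      window k p.1 p.2) = (fun z => window k z 0) ∘ Prod.fst := by
    funext p
    exact window_window_of_le le_rfl _ _ _
  rw [this, ← Measure.map_map (measurable_window_left k 0) measurable_fst]
  congr 1
  exact Measure.fst_prod

/-- Probability laws, dominated locally and uniformly by finite measures, have local limits along
an ultrafilter. -/
theorem exists_consistent_limits [IsProbabilityMeasure μ] (l : Ultrafilter ℕ)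
    (ν : ℕ → Measure (IncrementPath d)) [∀ n, IsProbabilityMeasure (ν n)]
    (m : ℕ → Measure (IncrementPath d)) [∀ k, IsFiniteMeasure (m k)] (hm : ∀ k, m k ≪ μ)
    (h : ∀ k, ∀ᶠ n in l, ∀ A, MeasurableSet A → refresh μ k (ν n) A ≤ m k A) :
    ∃ M : ℕ → Measure (IncrementPath d), (∀ k, IsProbabilityMeasure (M k)) ∧ (∀ k, M k ≪ μ) ∧
      (∀ k, refresh μ k (M (k + 1)) = M k) ∧
      ∀ k A, MeasurableSet A → Tendsto (fun n => refresh μ k (ν n) A) l (𝓝 (M k A)) := by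
  choose M hMm hM using fun k =>
    exists_measure_tendsto_of_le l (fun n => refresh μ k (ν n)) (m k) (h k)
  have hprob := fun n k => isProbabilityMeasure_refresh (μ := μ) k (ν n)
  have hMprob : ∀ k, IsProbabilityMeasure (M k) := fun k =>
    ⟨tendsto_nhds_unique (hM k univ MeasurableSet.univ) (by simp)⟩
  refine ⟨M, hMprob, fun k => ?_, fun k => ?_, hM⟩
  · refine Measure.AbsolutelyContinuous.trans (Measure.AbsolutelyContinuous.mk fun A hA h0 => ?_)
      (hm k)
    exact le_zero_iff.1 (h0 ▸ hMm k A hA)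
  · ext A hA
    have hφm : Measurable fun z =>
        ∫⁻ x, A.indicator (1 : IncrementPath d → ℝ≥0∞) (window k z x) ∂μ :=
      Measurable.lintegral_prod_right' (f := fun p : IncrementPath d × IncrementPath d =>
        A.indicator 1 (window k p.1 p.2))
        ((measurable_one.indicator hA).comp (measurable_window k))
    have hφ1 : ∀ z, ∫⁻ x, A.indicator (1 : IncrementPath d → ℝ≥0∞) (window k z x) ∂μ ≤ 1 := by
      intro z
      refine (lintegral_mono fun x => ?_).trans (by simp : ∫⁻ _, (1 : ℝ≥0∞) ∂μ ≤ 1)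
      exact indicator_le_self' (fun _ _ => zero_le) _
    have h1 := tendsto_lintegral_of_tendsto_setwise (hM (k + 1)) hφm hφ1
    rw [refresh_apply k _ hA]
    refine tendsto_nhds_unique h1 ((hM k A hA).congr fun n => ?_)
    rw [lintegral_refresh (k + 1) (ν n) hφm, refresh_apply k _ hA]
    simp [window_window_of_le (Nat.le_succ k)]

/-- The conditional density, under a law with density `f`, of a path given its increments in the
window, relative to `μ`. It is set to `1` where the normalising integral is `0` or `∞`, so that it
always defines a probability law. -/
noncomputable def condDensity (μ : Measure (IncrementPath d)) (k : ℕ)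
    (f : IncrementPath d → ℝ≥0∞) (z x : IncrementPath d) : ℝ≥0∞ :=
  if ∫⁻ x, f (window k z x) ∂μ = 0 ∨ ∫⁻ x, f (window k z x) ∂μ = ∞ then 1
  else (∫⁻ x, f (window k z x) ∂μ)⁻¹ * f (window k z x)

theorem measurable_lintegral_window [SFinite μ] (k : ℕ) {f : IncrementPath d → ℝ≥0∞}
    (hf : Measurable f) : Measurable fun z => ∫⁻ x, f (window k z x) ∂μ :=
  Measurable.lintegral_prod_right' (f := fun p : IncrementPath d × IncrementPath d =>
    f (window k p.1 p.2)) (hf.comp (measurable_window k))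

theorem measurable_condDensity [SFinite μ] (k : ℕ) {f : IncrementPath d → ℝ≥0∞}
    (hf : Measurable f) : Measurable fun p : IncrementPath d × IncrementPath d =>
      condDensity μ k f p.1 p.2 := by
  have hg := (measurable_lintegral_window (μ := μ) k hf).comp
    (measurable_fst : Measurable (Prod.fst : IncrementPath d × IncrementPath d → _))
  refine Measurable.ite ?_ measurable_const (hg.inv.mul (hf.comp (measurable_window k)))
  exact (hg (measurableSet_singleton 0)).union (hg (measurableSet_singleton ∞))

theorem lintegral_condDensity [IsProbabilityMeasure μ] (k : ℕ) {f : IncrementPath d → ℝ≥0∞}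
    (hf : Measurable f) (z : IncrementPath d) : ∫⁻ x, condDensity μ k f z x ∂μ = 1 := by
  by_cases h : ∫⁻ x, f (window k z x) ∂μ = 0 ∨ ∫⁻ x, f (window k z x) ∂μ = ∞
  · simp [condDensity, h]
  · simp only [condDensity, h, if_false]
    have hfz : Measurable fun x => f (window k z x) := hf.comp (measurable_window_right k z)
    rw [lintegral_const_mul _ hfz]
    push Not at h
    exact ENNReal.inv_mul_cancel h.1 h.2

/-- The conditional law, under a law with density `f`, of a path given its increments in the
window. -/
noncomputable def condKernel (μ : Measure (IncrementPath d)) (k : ℕ)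
    (f : IncrementPath d → ℝ≥0∞) (z : IncrementPath d) : Measure (IncrementPath d) :=
  (μ.withDensity (condDensity μ k f z)).map fun x => window k z x

theorem lintegral_condKernel [SFinite μ] (k : ℕ) {f : IncrementPath d → ℝ≥0∞}
    (hf : Measurable f) (z : IncrementPath d) {φ : IncrementPath d → ℝ≥0∞} (hφ : Measurable φ) :
    ∫⁻ x, φ x ∂(condKernel μ k f z) = ∫⁻ x, condDensity μ k f z x * φ (window k z x) ∂μ := by
  have h1 : Measurable fun x => φ (window k z x) := hφ.comp (measurable_window_right k z)
  have h2 : Measurable (condDensity μ k f z) :=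
    (measurable_condDensity k hf).comp (measurable_const.prodMk measurable_id)
  rw [condKernel, lintegral_map hφ (measurable_window_right k z),
    lintegral_withDensity_eq_lintegral_mul _ h2 h1]
  rfl

theorem isProbabilityMeasure_condKernel [IsProbabilityMeasure μ] (k : ℕ)
    {f : IncrementPath d → ℝ≥0∞} (hf : Measurable f) (z : IncrementPath d) :
    IsProbabilityMeasure (condKernel μ k f z) := by
  refine ⟨?_⟩
  rw [← lintegral_one, lintegral_condKernel k hf z measurable_const]
  simp [lintegral_condDensity k hf z]

theorem measurable_condKernel [SFinite μ] (k : ℕ) {f : IncrementPath d → ℝ≥0∞}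
    (hf : Measurable f) : Measurable (condKernel μ k f) := by
  refine Measure.measurable_of_measurable_coe _ fun A hA => ?_
  have : ∀ z, condKernel μ k f z A =
      ∫⁻ x, condDensity μ k f z x * A.indicator 1 (window k z x) ∂μ := fun z => by
    rw [← lintegral_condKernel k hf z (measurable_one.indicator hA), lintegral_indicator_one hA]
  simp only [this]
  exact Measurable.lintegral_prod_right' (f := fun p : IncrementPath d × IncrementPath d =>
    condDensity μ k f p.1 p.2 * A.indicator 1 (window k p.1 p.2))
    ((measurable_condDensity k hf).mul ((measurable_one.indicator hA).comp (measurable_window k)))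

theorem condKernel_window_ne (k : ℕ) (f : IncrementPath d → ℝ≥0∞)
    (z : IncrementPath d) : condKernel μ k f z {x | window k x 0 = window k z 0}ᶜ = 0 := by
  have hm : MeasurableSet {x : IncrementPath d | window k x 0 = window k z 0} :=
    measurableSet_eq_path (measurable_window_left k 0) measurable_const
  rw [condKernel, Measure.map_apply (measurable_window_right k z) hm.compl]
  have : (fun x => window k z x) ⁻¹' {x | window k x 0 = window k z 0}ᶜ = ∅ := by
    rw [preimage_compl, compl_empty_iff, eq_univ_iff_forall]
    exact fun x => window_window_of_le le_rfl z x 0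
  rw [this, measure_empty]

/-- Disintegration: refreshing the law with density `f` outside of the window and then sampling
from its conditional law given the window restores it. -/
theorem lintegral_condKernel_refresh (hμ : IsBrownianIncrementLaw μ) (k : ℕ)
    {f : IncrementPath d → ℝ≥0∞} (hf : Measurable f) [IsProbabilityMeasure (μ.withDensity f)]
    {A : Set (IncrementPath d)} (hA : MeasurableSet A) :
    ∫⁻ z, condKernel μ k f z A ∂(refresh μ k (μ.withDensity f)) = μ.withDensity f A := by
  have := hμ.isProbabilityMeasure
  set g : IncrementPath d → ℝ≥0∞ := fun z => ∫⁻ x, f (window k z x) ∂μ with hg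
  have hgm : Measurable g := measurable_lintegral_window k hf
  have hI : Measurable (A.indicator (1 : IncrementPath d → ℝ≥0∞)) := measurable_one.indicator hA
  have hKm : Measurable fun z => condKernel μ k f z A :=
    (Measure.measurable_coe hA).comp (measurable_condKernel k hf)
  have hf1 : ∫⁻ x, f x ∂μ = 1 := by
    rw [← setLIntegral_univ, ← withDensity_apply _ MeasurableSet.univ, measure_univ]
  have hgfin : ∀ᵐ z ∂μ, g z < ∞ := by
    refine ae_lt_top hgm ?_
    rw [hμ.lintegral_window k hf, hf1]
    exact ENNReal.one_ne_top
  have hwm : Measurable fun z => ∫⁻ x, condKernel μ k f (window k z x) A ∂μ :=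
    measurable_lintegral_window k hKm
  rw [lintegral_refresh k _ hKm, lintegral_withDensity_eq_lintegral_mul _ hf hwm,
    withDensity_apply _ hA, ← lintegral_indicator hA,
    ← hμ.lintegral_window k (hf.indicator hA)]
  calc ∫⁻ z, (f * fun z => ∫⁻ x, condKernel μ k f (window k z x) A ∂μ) z ∂μ
      = ∫⁻ z, ∫⁻ x, f z * condKernel μ k f (window k z x) A ∂μ ∂μ := by
        refine lintegral_congr fun z => ?_
        have hKz : Measurable fun x => condKernel μ k f (window k z x) A :=
          hKm.comp (measurable_window_right k z)
        rw [lintegral_const_mul _ hKz]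
        rfl
    _ = ∫⁻ z, ∫⁻ x, f (window k z x) * condKernel μ k f z A ∂μ ∂μ :=
        hμ.lintegral_window_swap k (f := fun p => f p.1 * condKernel μ k f p.2 A)
          ((hf.comp measurable_fst).mul (hKm.comp measurable_snd))
    _ = ∫⁻ z, ∫⁻ x, A.indicator f (window k z x) ∂μ ∂μ := by
        refine lintegral_congr_ae ?_
        filter_upwards [hgfin] with z hz
        have hfz : Measurable fun x => f (window k z x) := hf.comp (measurable_window_right k z)
        have hfI : Measurable fun x => A.indicator f (window k z x) :=
          (hf.indicator hA).comp (measurable_window_right k z)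
        rw [lintegral_mul_const _ hfz]
        change g z * _ = _
        by_cases h0 : g z = 0
        · rw [h0, zero_mul]
          refine (le_zero_iff.1 (le_trans (lintegral_mono fun x => ?_) h0.le)).symm
          exact indicator_le_self' (fun _ _ => zero_le) _
        · have hK : condKernel μ k f z A = (g z)⁻¹ * ∫⁻ x, A.indicator f (window k z x) ∂μ := by
            rw [← lintegral_indicator_one hA, lintegral_condKernel k hf z hI,
              ← lintegral_const_mul _ hfI]
            refine lintegral_congr fun x => ?_
            have : ¬ (∫⁻ x, f (window k z x) ∂μ = 0 ∨ ∫⁻ x, f (window k z x) ∂μ = ∞) :=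
              not_or.2 ⟨h0, hz.ne⟩
            rw [condDensity, if_neg this, mul_assoc]
            congr 1
            by_cases hx : window k z x ∈ A <;> simp [hx]
          rw [hK, ← mul_assoc, ENNReal.mul_inv_cancel h0 hz.ne, one_mul]

/-- Consistent laws on the windows, each absolutely continuous with respect to `μ`, are the local
restrictions of a law on increment paths: a Markov chain of paths, of which each step keeps the
window and resamples its outside, is glued to one path. -/
theorem exists_extension (hμ : IsBrownianIncrementLaw μ) (M : ℕ → Measure (IncrementPath d))
    [∀ k, IsProbabilityMeasure (M k)] (hac : ∀ k, M k ≪ μ)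
    (hcons : ∀ k, refresh μ k (M (k + 1)) = M k) :
    ∃ ν : Measure (IncrementPath d), IsProbabilityMeasure ν ∧
      ∀ k, ν.map (fun z => window k z 0) = (M k).map fun z => window k z 0 := by
  have := hμ.isProbabilityMeasure
  set f : ℕ → IncrementPath d → ℝ≥0∞ := fun k => (M k).rnDeriv μ with hf
  have hfm : ∀ k, Measurable (f k) := fun k => Measure.measurable_rnDeriv _ _
  have hMf : ∀ k, μ.withDensity (f k) = M k := fun k => Measure.withDensity_rnDeriv_eq _ _ (hac k)
  have hκm : ∀ k, Measurable (condKernel μ k (f (k + 1))) := fun k =>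
    measurable_condKernel k (hfm (k + 1))
  let κ : (n : ℕ) → Kernel (Π _ : Finset.Iic n, IncrementPath d) (IncrementPath d) := fun n =>
    { toFun := fun h => condKernel μ n (f (n + 1)) (h ⟨n, Finset.mem_Iic.2 le_rfl⟩)
      measurable' := (hκm n).comp (measurable_pi_apply _) }
  have hκ : ∀ n, IsMarkovKernel (κ n) := fun n =>
    ⟨fun h => isProbabilityMeasure_condKernel n (hfm (n + 1)) _⟩
  set P := Kernel.trajMeasure (X := fun _ => IncrementPath d) (M 0) κ with hP
  have hev : ∀ n, Measurable fun ω : ℕ → IncrementPath d => ω n := fun n => measurable_pi_apply n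
  -- the law of two consecutive steps of the chain
  have hstep : ∀ n (S : Set (IncrementPath d × IncrementPath d)), MeasurableSet S →
      P {ω | (ω n, ω (n + 1)) ∈ S} =
        ∫⁻ z, condKernel μ n (f (n + 1)) z {x | (z, x) ∈ S} ∂(P.map fun ω => ω n) := by
    intro n S hS
    have hcp := Kernel.map_frestrictLe_trajMeasure_compProd_eq_map_trajMeasure
      (X := fun _ => IncrementPath d) (μ₀ := M 0) (κ := κ) (a := n)
    rw [← hP] at hcp
    set e : (Π _ : Finset.Iic n, IncrementPath d) → IncrementPath d :=
      fun h => h ⟨n, Finset.mem_Iic.2 le_rfl⟩ with he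
    have hem : Measurable e := measurable_pi_apply _
    set S' : Set ((Π _ : Finset.Iic n, IncrementPath d) × IncrementPath d) :=
      (fun q => (e q.1, q.2)) ⁻¹' S with hS'
    have hS'm : MeasurableSet S' :=
      ((hem.comp measurable_fst).prodMk measurable_snd) hS
    have hfr : Measurable (Preorder.frestrictLe (π := fun _ : ℕ => IncrementPath d) n) :=
      Preorder.measurable_frestrictLe n
    have h1 : P {ω | (ω n, ω (n + 1)) ∈ S} =
        (P.map fun ω => (Preorder.frestrictLe n ω, ω (n + 1))) S' := by
      rw [Measure.map_apply (hfr.prodMk (measurable_pi_apply _)) hS'm]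
      rfl
    have hsec : Measurable fun z => condKernel μ n (f (n + 1)) z {x | (z, x) ∈ S} := by
      have := isProbabilityMeasure_condKernel (μ := μ) n (hfm (n + 1))
      let η : Kernel (IncrementPath d) (IncrementPath d) := ⟨_, hκm n⟩
      have : IsMarkovKernel η := ⟨this⟩
      exact Kernel.measurable_kernel_prodMk_left (κ := η) hS
    rw [h1, ← hcp, Measure.compProd_apply hS'm,
      lintegral_map hsec (measurable_pi_apply n),
      lintegral_map (Kernel.measurable_kernel_prodMk_left hS'm) hfr]
    rfl
  have hlaw : ∀ n, P.map (fun ω => ω n) = M n := by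
    intro n
    induction n with
    | zero =>
      have hfr : P.map (Preorder.frestrictLe 0) =
          (M 0).map (MeasurableEquiv.piUnique fun _ : Finset.Iic 0 => IncrementPath d).symm := by
        rw [hP, Kernel.trajMeasure, Measure.map_comp _ _ (Preorder.measurable_frestrictLe 0),
          Kernel.traj_map_frestrictLe, Kernel.partialTraj_self, Measure.id_comp]
      have he0 : Measurable fun h : (Π _ : Finset.Iic 0, IncrementPath d) =>
          h ⟨0, Finset.mem_Iic.2 le_rfl⟩ := measurable_pi_apply _
      have h2 : (fun ω : ℕ → IncrementPath d => ω 0) =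
          (fun h : Π _ : Finset.Iic 0, IncrementPath d => h ⟨0, Finset.mem_Iic.2 le_rfl⟩) ∘
            Preorder.frestrictLe 0 := rfl
      rw [h2, ← Measure.map_map he0 (Preorder.measurable_frestrictLe 0), hfr,
        Measure.map_map he0 (MeasurableEquiv.measurable _)]
      exact Measure.map_id
    | succ n ih =>
      ext A hA
      have h3 := hstep n (univ ×ˢ A) (MeasurableSet.univ.prod hA)
      rw [Measure.map_apply (hev (n + 1)) hA]
      have : IsProbabilityMeasure (μ.withDensity (f (n + 1))) := by rw [hMf]; infer_instance
      have h4 := lintegral_condKernel_refresh hμ n (hfm (n + 1)) hA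
      rw [hMf, hcons] at h4
      rw [ih] at h3
      simp only [mem_prod, mem_univ, true_and] at h3
      exact h3.trans h4
  have hkeep : ∀ᵐ ω ∂P, ∀ n, window n (ω (n + 1)) 0 = window n (ω n) 0 := by
    refine ae_all_iff.2 fun n => ?_
    have hS : MeasurableSet {p : IncrementPath d × IncrementPath d |
        window n p.2 0 = window n p.1 0}ᶜ := (measurableSet_eq_path
      ((measurable_window_left n 0).comp measurable_snd)
      ((measurable_window_left n 0).comp measurable_fst)).compl
    have h3 := hstep n _ hS
    have h0 : ∀ z, condKernel μ n (f (n + 1)) z {x | (z, x) ∈ {p : IncrementPath d ×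
        IncrementPath d | window n p.2 0 = window n p.1 0}ᶜ} = 0 :=
      fun z => condKernel_window_ne n (f (n + 1)) z
    simp only [h0, lintegral_zero] at h3
    exact h3
  obtain ⟨G, hGm, hG⟩ := exists_measurable_glue (d := d)
  have : IsProbabilityMeasure P := by rw [hP]; infer_instance
  refine ⟨P.map G, Measure.isProbabilityMeasure_map hGm.aemeasurable, fun k => ?_⟩
  rw [← hlaw k, Measure.map_map (measurable_window_left k 0) hGm,
    Measure.map_map (measurable_window_left k 0) (hev k)]
  refine Measure.map_congr ?_
  filter_upwards [hkeep] with ω hω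
  exact hG ω hω k

/-- Local limits of uniformly locally dominated laws exist. -/
theorem exists_local_limit (hμ : IsBrownianIncrementLaw μ) (l : Ultrafilter ℕ)
    (ν : ℕ → Measure (IncrementPath d)) [∀ n, IsProbabilityMeasure (ν n)]
    (m : ℕ → Measure (IncrementPath d)) [∀ k, IsFiniteMeasure (m k)] (hm : ∀ k, m k ≪ μ)
    (h : ∀ k, ∀ᶠ n in l, ∀ A, MeasurableSet A → refresh μ k (ν n) A ≤ m k A) :
    ∃ ν' : Measure (IncrementPath d), IsProbabilityMeasure ν' ∧ ∀ k A, MeasurableSet A →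
      Tendsto (fun n => (ν n).map (fun z => window k z 0) A) l
        (𝓝 (ν'.map (fun z => window k z 0) A)) := by
  have := hμ.isProbabilityMeasure
  obtain ⟨M, hMp, hMac, hMc, hMt⟩ := exists_consistent_limits l ν m hm h
  obtain ⟨ν', hν', hν'M⟩ := exists_extension hμ M hMac hMc
  refine ⟨ν', hν', fun k A hA => ?_⟩
  have hw := measurable_window_left (d := d) k 0
  rw [hν'M k, Measure.map_apply hw hA]
  refine (hMt k _ (hw hA)).congr fun n => ?_
  rw [← map_window_refresh (μ := μ) k (ν n), Measure.map_apply hw hA]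

end Extension

/-! ### Quasilocality of the Gibbs kernels -/

section Quasilocal

variable {W : EuclideanSpace ℝ (Fin d) → ℝ → ℝ} {μ : Measure (IncrementPath d)} {a b : ℝ}

/-- Changing the boundary condition outside of a large window changes the weights little in mean.
The pointwise statement passes to the mean by dominated convergence along arbitrary sequences of
boundary conditions. -/
theorem exists_lintegral_weight_sub_le (hμ : IsBrownianIncrementLaw μ) (hW : IsAdmissible W)
    (lam : ℝ) (hab : a ≤ b) {ε : ℝ≥0∞} (hε : ε ≠ 0) :
    ∃ N₀ : ℕ, ∀ N, N₀ ≤ N → ∀ y y' : IncrementPath d, window N y 0 = window N y' 0 →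
      ∫⁻ x, weight W lam a b x y - weight W lam a b x y' ∂μ ≤ ε := by
  by_contra hcon
  push Not at hcon
  choose N hN y y' hyy hlt using hcon
  obtain ⟨k, hk⟩ := exists_weight_bounds hW lam hab
  have hlim : Tendsto (fun j => ∫⁻ x, weight W lam a b x (y j) - weight W lam a b x (y' j) ∂μ)
      atTop (𝓝 (∫⁻ _, 0 ∂μ)) := by
    refine tendsto_lintegral_of_dominated_convergence (envelope k a b)
      (fun j => (measurable_weight_left hW hab lam _).sub (measurable_weight_left hW hab lam _))
      (fun j => ae_of_all _ fun x => tsub_le_self.trans (hk x _).2)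
      (hμ.lintegral_envelope_lt_top k a b).ne (ae_of_all _ fun x => ?_)
    set u : ℕ → ℝ := fun j => energyDiff W a b x (y j) - energyDiff W a b x (y' j) with hu
    have hu0 : Tendsto u atTop (𝓝 0) := by
      refine Metric.tendsto_atTop.2 fun η hη => ?_
      obtain ⟨N₁, hN₁⟩ := hW.exists_abs_energyDiff_sub_le hab x (half_pos hη)
      refine ⟨N₁, fun j hj => ?_⟩
      have h1 := hN₁ (N j) (hj.trans (hN j)) (y j) (y' j) fun s hs t ht =>
        window_zero_eq_iff.1 (hyy j) s ⟨by linarith [hs.1], by linarith [hs.2]⟩ t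
          ⟨by linarith [ht.1], by linarith [ht.2]⟩
      rw [Real.dist_eq, sub_zero]
      linarith
    -- the ratio of the weights is `exp (-lam u)`
    have hexp : Tendsto (fun j => ENNReal.ofReal (Real.exp (-lam * u j) - 1)) atTop (𝓝 0) := by
      have h1 : Tendsto (fun j => Real.exp (-lam * u j) - 1) atTop
          (𝓝 (Real.exp (-lam * 0) - 1)) :=
        ((Real.continuous_exp.tendsto _).comp (hu0.const_mul (-lam))).sub_const 1
      have h2 := (ENNReal.continuous_ofReal.tendsto _).comp h1
      simpa [Function.comp_def] using h2
    have hmul : Tendsto (fun j => envelope k a b x * ENNReal.ofReal (Real.exp (-lam * u j) - 1))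
        atTop (𝓝 0) := by
      have := ENNReal.Tendsto.const_mul (a := envelope k a b x) hexp
        (Or.inr ENNReal.ofReal_ne_top)
      simpa using this
    refine tendsto_of_tendsto_of_tendsto_of_le_of_le tendsto_const_nhds hmul (fun _ => zero_le)
      fun j => ?_
    have heq : weight W lam a b x (y j) - weight W lam a b x (y' j) =
        weight W lam a b x (y' j) * ENNReal.ofReal (Real.exp (-lam * u j) - 1) := by
      rw [weight_eq hW hab, weight_eq hW hab, ← ENNReal.ofReal_sub _ (Real.exp_pos _).le,
        ← ENNReal.ofReal_mul (Real.exp_pos _).le, mul_sub, mul_one, ← Real.exp_add]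
      congr 3
      simp only [hu]; ring
    rw [heq]
    gcongr
    exact (hk x _).2
  rw [lintegral_zero] at hlim
  obtain ⟨j, hj⟩ := ((tendsto_order.1 hlim).2 ε (pos_iff_ne_zero.2 hε)).exists
  exact absurd hj (not_lt.2 (hlt j).le)

/-- The Gibbs kernels are quasilocal: uniformly in the boundary condition, the probability of a
local event changes little if the boundary condition is changed outside of a large window. -/
theorem exists_gibbsKernel_le_add (hμ : IsBrownianIncrementLaw μ) (hW : IsAdmissible W)
    (lam : ℝ) (hab : a ≤ b) (k : ℕ) {A : Set (IncrementPath d)} (hA : MeasurableSet A)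
    {ε : ℝ≥0∞} (hε : ε ≠ 0) :
    ∃ N : ℕ, ∀ y y' : IncrementPath d, window N y 0 = window N y' 0 →
      gibbsKernel μ W lam a b y {z | window k z 0 ∈ A} ≤
        gibbsKernel μ W lam a b y' {z | window k z 0 ∈ A} + ε := by
  obtain ⟨z₀, hz₀, hle⟩ := exists_le_partitionZ hμ hW lam hab
  have hδ : z₀ * (ε / 2) ≠ 0 := mul_ne_zero hz₀ (ENNReal.div_pos hε (by norm_num)).ne'
  obtain ⟨N₀, hN₀⟩ := exists_lintegral_weight_sub_le hμ hW lam hab hδ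
  obtain ⟨na, hna⟩ := exists_mem_window a
  obtain ⟨nb, hnb⟩ := exists_mem_window b
  set N := max (max N₀ k) (max na nb) with hN
  have haN := hna N ((le_max_left _ _).trans (le_max_right _ _))
  have hbN := hnb N ((le_max_right _ _).trans (le_max_right _ _))
  have hkN : (k : ℝ) ≤ N := by exact_mod_cast (le_max_right _ _).trans (le_max_left _ _)
  refine ⟨N, fun y y' hyy => ?_⟩
  set B := {z : IncrementPath d | window k z 0 ∈ A} with hB
  have hBm : MeasurableSet B := measurable_window_left k 0 hA
  set δ := z₀ * (ε / 2) with hδdef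
  have hd₁ : ∫⁻ x, weight W lam a b x y - weight W lam a b x y' ∂μ ≤ δ :=
    hN₀ N ((le_max_left _ _).trans (le_max_left _ _)) y y' hyy
  have hd₂ : ∫⁻ x, weight W lam a b x y' - weight W lam a b x y ∂μ ≤ δ :=
    hN₀ N ((le_max_left _ _).trans (le_max_left _ _)) y' y hyy.symm
  have hind : ∀ x, B.indicator (1 : IncrementPath d → ℝ≥0∞) (concat a b x y) =
      B.indicator 1 (concat a b x y') := by
    intro x
    have hagree := window_zero_eq_iff.1 hyy
    have : window k (concat a b x y) 0 = window k (concat a b x y') 0 := by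
      refine window_zero_eq_iff.2 fun s hs t ht => ?_
      have hcl : ∀ t, clamp a b t ∈ Icc (-((N : ℝ) + 1)) (N + 1) := fun t =>
        ⟨haN.1.le.trans (clamp_mem hab t).1, (clamp_mem hab t).2.trans hbN.2.le⟩
      simp only [concat_apply, hagree _ (hcl s) _ (hcl t),
        hagree s ⟨by linarith [hs.1], by linarith [hs.2]⟩ t
          ⟨by linarith [ht.1], by linarith [ht.2]⟩]
    have hiff : concat a b x y ∈ B ↔ concat a b x y' ∈ B := by
      change window k _ 0 ∈ A ↔ window k _ 0 ∈ A
      rw [this]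
    by_cases h : concat a b x y' ∈ B
    · rw [indicator_of_mem h, indicator_of_mem (hiff.2 h)]; rfl
    · rw [indicator_of_notMem h, indicator_of_notMem (mt hiff.1 h)]
  have hsplit : ∀ (y y' : IncrementPath d) (φ : IncrementPath d → ℝ≥0∞), Measurable φ →
      (∀ x, φ x ≤ 1) → ∫⁻ x, weight W lam a b x y * φ x ∂μ ≤
        (∫⁻ x, weight W lam a b x y' * φ x ∂μ) +
          ∫⁻ x, weight W lam a b x y - weight W lam a b x y' ∂μ := by
    intro y y' φ hφ hφ1
    have hm : Measurable fun x => weight W lam a b x y' * φ x :=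
      (measurable_weight_left hW hab lam y').mul hφ
    rw [← lintegral_add_left hm]
    refine lintegral_mono fun x => ?_
    calc weight W lam a b x y * φ x
        ≤ (weight W lam a b x y' + (weight W lam a b x y - weight W lam a b x y')) * φ x := by
          gcongr; exact le_add_tsub
      _ ≤ weight W lam a b x y' * φ x + (weight W lam a b x y - weight W lam a b x y') := by
          rw [add_mul]; gcongr; exact mul_le_of_le_one_right zero_le (hφ1 x)
  set Z := partitionZ μ W lam a b y
  set Z' := partitionZ μ W lam a b y'
  have hZ0 : Z ≠ 0 := partitionZ_ne_zero hμ hW lam hab y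
  have hZt : Z ≠ ∞ := partitionZ_ne_top hμ hW lam hab y
  set p := gibbsKernel μ W lam a b y B with hp
  set p' := gibbsKernel μ W lam a b y' B with hp'
  have hp'1 : p' ≤ 1 := by
    have := gibbsKernel_isProbabilityMeasure hμ hW lam hab y'
    exact prob_le_one
  have hI1 : ∀ z, B.indicator (1 : IncrementPath d → ℝ≥0∞) z ≤ 1 := fun z =>
    indicator_le_self' (fun _ _ => zero_le) _
  have hYm : Measurable fun x => B.indicator (1 : IncrementPath d → ℝ≥0∞) (concat a b x y') :=
    (measurable_one.indicator hBm).comp (measurable_concat_left a b y')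
  have hZp : Z * p = ∫⁻ x, weight W lam a b x y * B.indicator 1 (concat a b x y') ∂μ := by
    rw [hp, gibbsKernel_apply hW lam hab y hBm, ← mul_assoc, ENNReal.mul_inv_cancel hZ0 hZt,
      one_mul]
    simp only [hind]
  have hZp' : Z' * p' = ∫⁻ x, weight W lam a b x y' * B.indicator 1 (concat a b x y') ∂μ := by
    rw [hp', gibbsKernel_apply hW lam hab y' hBm, ← mul_assoc, ENNReal.mul_inv_cancel
      (partitionZ_ne_zero hμ hW lam hab y') (partitionZ_ne_top hμ hW lam hab y'), one_mul]
  have hZZ : Z' ≤ Z + δ := by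
    have := hsplit y' y 1 measurable_one fun _ => le_rfl
    simp only [Pi.one_apply, mul_one] at this
    exact this.trans (add_le_add le_rfl hd₂)
  have hmain : Z * p ≤ Z * (p' + ε) := by
    calc Z * p ≤ Z' * p' + δ := by
          rw [hZp, hZp']
          exact (hsplit y y' _ hYm fun x => hI1 _).trans (add_le_add le_rfl hd₁)
      _ ≤ (Z + δ) * p' + δ := by gcongr
      _ ≤ Z * p' + δ + δ := by
          rw [add_mul]
          gcongr
          exact mul_le_of_le_one_right zero_le hp'1
      _ = Z * p' + z₀ * ε := by
          rw [add_assoc, hδdef, ← mul_add, ENNReal.add_halves]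
      _ ≤ Z * (p' + ε) := by
          rw [mul_add]
          gcongr
          exact hle y
  exact (ENNReal.mul_le_mul_iff_right hZ0 hZt).1 hmain

/-- Invariance under the Gibbs kernels passes to local limits. -/
theorem bind_gibbsKernel_of_tendsto (hμ : IsBrownianIncrementLaw μ) (hW : IsAdmissible W)
    (lam : ℝ) (hab : a ≤ b) {l : Ultrafilter ℕ} {ν : ℕ → Measure (IncrementPath d)}
    [∀ n, IsProbabilityMeasure (ν n)] {ν' : Measure (IncrementPath d)} [IsProbabilityMeasure ν']
    (hlim : ∀ k A, MeasurableSet A → Tendsto (fun n => (ν n).map (fun z => window k z 0) A) l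
      (𝓝 (ν'.map (fun z => window k z 0) A)))
    (hinv : ∀ᶠ n in l, (ν n).bind (gibbsKernel μ W lam a b) = ν n) :
    ν'.bind (gibbsKernel μ W lam a b) = ν' := by
  have := hμ.isProbabilityMeasure
  have hπm := measurable_gibbsKernel (μ := μ) hW lam hab
  have hπp := fun y => gibbsKernel_isProbabilityMeasure hμ hW lam hab y
  have hbp : IsProbabilityMeasure (ν'.bind (gibbsKernel μ W lam a b)) := by
    refine ⟨?_⟩
    rw [Measure.bind_apply MeasurableSet.univ hπm.aemeasurable]
    simp
  refine measure_ext_of_window fun k => ?_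
  ext A hA
  have hwk := measurable_window_left (d := d) k 0
  rw [Measure.map_apply hwk hA, Measure.map_apply hwk hA]
  set B : Set (IncrementPath d) := {z | window k z 0 ∈ A} with hB
  have hBm : MeasurableSet B := hwk hA
  change ν'.bind (gibbsKernel μ W lam a b) B = ν' B
  rw [Measure.bind_apply hBm hπm.aemeasurable]
  set φ : IncrementPath d → ℝ≥0∞ := fun y => gibbsKernel μ W lam a b y B with hφ
  have hφm : Measurable φ := (Measure.measurable_coe hBm).comp hπm
  have hBlim : Tendsto (fun n => ν n B) l (𝓝 (ν' B)) := by
    have := hlim k A hA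
    simp only [Measure.map_apply hwk hA] at this
    exact this
  have hinvB : ∀ᶠ n in l, ∫⁻ y, φ y ∂(ν n) = ν n B := hinv.mono fun n hn => by
    conv_rhs => rw [← hn, Measure.bind_apply hBm hπm.aemeasurable]
  -- `φ` is compared with the local function `y ↦ φ (window N y 0)`
  have key : ∀ ε : ℝ≥0∞, ε ≠ 0 →
      ∫⁻ y, φ y ∂ν' ≤ ν' B + ε + ε ∧ ν' B ≤ ∫⁻ y, φ y ∂ν' + ε + ε := by
    intro ε hε
    obtain ⟨N, hN⟩ := exists_gibbsKernel_le_add hμ hW lam hab k hA hε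
    have hwN := measurable_window_left (d := d) N 0
    have h1 : ∀ y, φ y ≤ φ (window N y 0) + ε := fun y =>
      hN _ _ (window_window_of_le le_rfl y 0 0).symm
    have h2 : ∀ y, φ (window N y 0) ≤ φ y + ε := fun y =>
      hN _ _ (window_window_of_le le_rfl y 0 0)
    have hc : Tendsto (fun n => ∫⁻ y, φ (window N y 0) ∂(ν n)) l
        (𝓝 (∫⁻ y, φ (window N y 0) ∂ν')) := by
      have hp := fun n => Measure.isProbabilityMeasure_map (μ := ν n) hwN.aemeasurable
      have hp' := Measure.isProbabilityMeasure_map (μ := ν') hwN.aemeasurable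
      have := tendsto_lintegral_of_tendsto_setwise (hlim N) hφm fun y => prob_le_one
      simpa only [lintegral_map hφm hwN] using this
    have hadd : ∀ (P : Measure (IncrementPath d)) [IsProbabilityMeasure P]
        (ψ χ : IncrementPath d → ℝ≥0∞), (∀ y, ψ y ≤ χ y + ε) →
        ∫⁻ y, ψ y ∂P ≤ ∫⁻ y, χ y ∂P + ε := fun P _ ψ χ h => by
      refine (lintegral_mono h).trans ?_
      rw [lintegral_add_right _ measurable_const]
      simp
    have h3 : ∫⁻ y, φ (window N y 0) ∂ν' ≤ ν' B + ε := by
      refine le_of_tendsto_of_tendsto hc (hBlim.add_const ε) ?_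
      filter_upwards [hinvB] with n hn
      rw [← hn]
      exact hadd _ _ _ h2
    have h4 : ν' B ≤ ∫⁻ y, φ (window N y 0) ∂ν' + ε := by
      refine le_of_tendsto_of_tendsto hBlim (hc.add_const ε) ?_
      filter_upwards [hinvB] with n hn
      rw [← hn]
      exact hadd _ _ _ h1
    exact ⟨(hadd _ _ _ h1).trans (add_le_add h3 le_rfl),
      h4.trans (add_le_add (hadd _ _ _ h2) le_rfl)⟩
  have hhalf : ∀ ε : ℝ≥0, 0 < ε → (ε : ℝ≥0∞) / 2 ≠ 0 := fun ε hε =>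
    (ENNReal.div_pos (by exact_mod_cast hε.ne') (by norm_num)).ne'
  refine le_antisymm (ENNReal.le_of_forall_pos_le_add fun ε hε _ => ?_)
    (ENNReal.le_of_forall_pos_le_add fun ε hε _ => ?_)
  · have := (key _ (hhalf ε hε)).1
    rwa [add_assoc, ENNReal.add_halves] at this
  · have := (key _ (hhalf ε hε)).2
    rwa [add_assoc, ENNReal.add_halves] at this

end Quasilocal

/-! ### Gibbs measures -/

section Gibbs

/-- A probability measure that is invariant under the kernels of a specification is a Gibbs
measure, as the kernels are proper. -/
theorem IsSpecification.isGibbsMeasure {π : ℝ → ℝ → IncrementPath d → Measure (IncrementPath d)}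
    (hπ : IsSpecification π) {ν : Measure (IncrementPath d)} [IsProbabilityMeasure ν]
    (h : ∀ a b, a < b → ν.bind (π a b) = ν) : IsGibbsMeasure π ν where
  prob := inferInstance
  condProb a b hab A hA := by
    have hm := sigmaIncr_le (d := d) (Icc a b)ᶜ
    have hπp := hπ.prob a b hab
    have hmeas := hπ.measurable a b hab A hA
    have hmeas' : Measurable fun y => π a b y A := hmeas.mono hm le_rfl
    have hπm : Measurable (π a b) := Measure.measurable_of_measurable_coe _ fun B hB =>
      (hπ.measurable a b hab B hB).mono hm le_rfl
    have hint : Integrable (fun y => (π a b y).real A) ν := by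
      refine Integrable.of_bound hmeas'.ennreal_toReal.aestronglyMeasurable 1
        (ae_of_all _ fun y => ?_)
      rw [Real.norm_eq_abs, abs_of_nonneg measureReal_nonneg]
      exact measureReal_le_one
    refine (ae_eq_condExp_of_forall_setIntegral_eq hm
      ((integrable_const (1 : ℝ)).indicator hA) (fun B _ _ => hint.integrableOn) ?_ ?_).symm
    · intro B hB _
      have hB' := hm B hB
      have h1 : ∫⁻ y in B, π a b y A ∂ν = ν (A ∩ B) := by
        rw [← lintegral_indicator hB']
        conv_rhs => rw [← h a b hab, Measure.bind_apply (hA.inter hB') hπm.aemeasurable]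
        refine lintegral_congr fun y => ?_
        rw [hπ.proper a b hab y A B hA hB]
        by_cases hy : y ∈ B <;> simp [hy]
      have h2 : ∫ y in B, (π a b y).real A ∂ν = (∫⁻ y in B, π a b y A ∂ν).toReal :=
        integral_toReal hmeas'.aemeasurable (ae_of_all _ fun y => measure_lt_top _ _)
      rw [h2, h1, setIntegral_indicator hA, inter_comm]
      simp [Measure.real]
    · exact (Measurable.stronglyMeasurable hmeas.ennreal_toReal).aestronglyMeasurable

end Gibbs

/-! ### Averaging over translations -/

section Average

variable {W : EuclideanSpace ℝ (Fin d) → ℝ → ℝ} {μ : Measure (IncrementPath d)} {a b : ℝ}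

/-- The uniform distribution on `(0, n + 1]`. -/
noncomputable def uniformTime (n : ℕ) : Measure ℝ :=
  ENNReal.ofReal ((n : ℝ) + 1)⁻¹ • volume.restrict (Ioc 0 ((n : ℝ) + 1))

instance (n : ℕ) : IsProbabilityMeasure (uniformTime n) := by
  refine ⟨?_⟩
  have hn : (0 : ℝ) < (n : ℝ) + 1 := by positivity
  rw [uniformTime, Measure.smul_apply, Measure.restrict_apply_univ, Real.volume_Ioc, smul_eq_mul,
    sub_zero, ← ENNReal.ofReal_mul (by positivity), inv_mul_cancel₀ hn.ne', ENNReal.ofReal_one]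

/-- The law of a path with the Gibbs distribution in `[-2(n + 1), 2(n + 1)]` and boundary condition
`0`, translated by a uniformly distributed time in `(0, n + 1]`. -/
noncomputable def averagedGibbs (μ : Measure (IncrementPath d))
    (W : EuclideanSpace ℝ (Fin d) → ℝ → ℝ) (lam : ℝ) (n : ℕ) : Measure (IncrementPath d) :=
  ((uniformTime n).prod (gibbsKernel μ W lam (-(2 * ((n : ℝ) + 1))) (2 * ((n : ℝ) + 1)) 0)).map
    fun p => IncrementPath.translate p.1 p.2

theorem neg_two_mul_le (n : ℕ) : -(2 * ((n : ℝ) + 1)) ≤ 2 * ((n : ℝ) + 1) := by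
  linarith [n.cast_nonneg (α := ℝ)]

theorem isProbabilityMeasure_averagedGibbs (hμ : IsBrownianIncrementLaw μ) (hW : IsAdmissible W)
    (lam : ℝ) (n : ℕ) : IsProbabilityMeasure (averagedGibbs μ W lam n) := by
  have := gibbsKernel_isProbabilityMeasure hμ hW lam (neg_two_mul_le n) 0
  exact Measure.isProbabilityMeasure_map measurable_translate_uncurry.aemeasurable

theorem lintegral_averagedGibbs (hμ : IsBrownianIncrementLaw μ) (hW : IsAdmissible W) (lam : ℝ)
    (n : ℕ) {f : IncrementPath d → ℝ≥0∞} (hf : Measurable f) :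
    ∫⁻ z, f z ∂(averagedGibbs μ W lam n) = ∫⁻ c, ∫⁻ z, f (IncrementPath.translate c z)
      ∂(gibbsKernel μ W lam (-(2 * ((n : ℝ) + 1))) (2 * ((n : ℝ) + 1)) 0) ∂(uniformTime n) := by
  have := gibbsKernel_isProbabilityMeasure hμ hW lam (neg_two_mul_le n) 0
  rw [averagedGibbs, lintegral_map hf measurable_translate_uncurry]
  exact lintegral_prod _ (hf.comp measurable_translate_uncurry).aemeasurable

/-- By consistency, the averaged law is invariant under the kernels of all intervals that stay
inside the interval of the Gibbs distribution under every translation of the average. -/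
theorem bind_averagedGibbs (hμ : IsBrownianIncrementLaw μ) (hW : IsAdmissible W) (lam : ℝ)
    (hab : a ≤ b) {n : ℕ} (ha : -((n : ℝ) + 1) ≤ a) (hb : b ≤ (n : ℝ) + 1) :
    (averagedGibbs μ W lam n).bind (gibbsKernel μ W lam a b) = averagedGibbs μ W lam n := by
  have := hμ.isProbabilityMeasure
  have hπm := measurable_gibbsKernel (μ := μ) hW lam hab
  ext A hA
  have hmA : Measurable fun z => gibbsKernel μ W lam a b z A :=
    (Measure.measurable_coe hA).comp hπm
  have hmI : Measurable (A.indicator (1 : IncrementPath d → ℝ≥0∞)) := measurable_one.indicator hA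
  rw [Measure.bind_apply hA hπm.aemeasurable, lintegral_averagedGibbs hμ hW lam n hmA,
    ← lintegral_indicator_one hA, lintegral_averagedGibbs hμ hW lam n hmI, uniformTime,
    lintegral_smul_measure, lintegral_smul_measure]
  congr 1
  refine setLIntegral_congr_fun measurableSet_Ioc fun c hc => ?_
  have hmt := measurable_translate (d := d) c
  -- the translated law is a Gibbs kernel on an interval that still contains `[a, b]`
  rw [← lintegral_map hmA hmt, ← lintegral_map hmI hmt,
    gibbsKernel_map_translate hμ hW lam (neg_two_mul_le n), lintegral_indicator_one hA]
  exact lintegral_gibbsKernel_gibbsKernel hμ hW lam hab (by linarith [hc.1]) (by linarith [hc.2])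
    _ hA

/-- A translation by `c` changes the averaged law by at most `2|c| / (n + 1)`. -/
theorem averagedGibbs_translate_le (hμ : IsBrownianIncrementLaw μ) (hW : IsAdmissible W) (lam : ℝ)
    (n : ℕ) (c : ℝ) {A : Set (IncrementPath d)} (hA : MeasurableSet A) :
    averagedGibbs μ W lam n (IncrementPath.translate c ⁻¹' A) ≤
      averagedGibbs μ W lam n A + ENNReal.ofReal ((n : ℝ) + 1)⁻¹ * ENNReal.ofReal (2 * |c|) := by
  set p := gibbsKernel μ W lam (-(2 * ((n : ℝ) + 1))) (2 * ((n : ℝ) + 1)) 0 with hp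
  have hpp : IsProbabilityMeasure p :=
    gibbsKernel_isProbabilityMeasure hμ hW lam (neg_two_mul_le n) 0
  set g : ℝ → ℝ≥0∞ := fun t => p (IncrementPath.translate t ⁻¹' A) with hg
  have hgm : Measurable g :=
    measurable_measure_prodMk_left (measurable_translate_uncurry (d := d) hA)
  have hval : ∀ B, MeasurableSet B → averagedGibbs μ W lam n B = ENNReal.ofReal ((n : ℝ) + 1)⁻¹ *
      ∫⁻ t in Ioc 0 ((n : ℝ) + 1), p (IncrementPath.translate t ⁻¹' B) := by
    intro B hB
    rw [← lintegral_indicator_one hB,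
      lintegral_averagedGibbs hμ hW lam n (measurable_one.indicator hB), uniformTime,
      lintegral_smul_measure, smul_eq_mul, ← hp]
    congr 1
    refine lintegral_congr fun t => ?_
    rw [← lintegral_indicator_one (measurable_translate t hB)]
    rfl
  rw [hval _ (measurable_translate c hA), hval _ hA, ← mul_add]
  gcongr
  have hshift : ∀ t, p (IncrementPath.translate t ⁻¹' (IncrementPath.translate c ⁻¹' A)) =
      g (c + t) := fun t => by
    rw [← preimage_comp]
    simp only [hg]
    congr 2
    funext z
    exact translate_translate c t z
  have hsub : Ioc c (c + ((n : ℝ) + 1)) ⊆ Ioc 0 ((n : ℝ) + 1) ∪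
      (Ioc (-|c|) 0 ∪ Ioc ((n : ℝ) + 1) ((n : ℝ) + 1 + |c|)) := by
    intro t ht
    have h1 := neg_abs_le c
    have h2 := le_abs_self c
    rcases le_or_gt t 0 with h3 | h3
    · exact Or.inr (Or.inl ⟨h1.trans_lt ht.1, h3⟩)
    · rcases le_or_gt t ((n : ℝ) + 1) with h4 | h4
      · exact Or.inl ⟨h3, h4⟩
      · exact Or.inr (Or.inr ⟨h4, by linarith [ht.2]⟩)
  calc ∫⁻ t in Ioc 0 ((n : ℝ) + 1),
        p (IncrementPath.translate t ⁻¹' (IncrementPath.translate c ⁻¹' A))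
      = ∫⁻ t in Ioc c (c + ((n : ℝ) + 1)), g t := by
        simp only [hshift]
        rw [← (measurePreserving_add_left volume c).setLIntegral_comp_preimage_emb
          (measurableEmbedding_addLeft c) g (Ioc c (c + ((n : ℝ) + 1)))]
        congr 2
        ext t; simp
    _ ≤ (∫⁻ t in Ioc 0 ((n : ℝ) + 1), g t) +
        ∫⁻ t in Ioc (-|c|) 0 ∪ Ioc ((n : ℝ) + 1) ((n : ℝ) + 1 + |c|), g t :=
        (lintegral_mono_set hsub).trans (lintegral_union_le _ _ _)
    _ ≤ _ := by
        gcongr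
        refine (lintegral_mono fun t => (prob_le_one : g t ≤ 1)).trans ?_
        rw [setLIntegral_one]
        refine (measure_union_le _ _).trans (le_of_eq ?_)
        rw [Real.volume_Ioc, Real.volume_Ioc, ← ENNReal.ofReal_add (by simp) (by simp)]
        congr 1; ring

end Average

/-! ### Existence of a translation invariant Gibbs measure -/

section Existence

variable {W : EuclideanSpace ℝ (Fin d) → ℝ → ℝ} {μ : Measure (IncrementPath d)}

/-- Translation invariance passes to local limits of asymptotically invariant laws. -/
theorem map_translate_of_tendsto {l : Ultrafilter ℕ} {ν : ℕ → Measure (IncrementPath d)}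
    {ν' : Measure (IncrementPath d)} [IsProbabilityMeasure ν']
    (hlim : ∀ k A, MeasurableSet A → Tendsto (fun n => (ν n).map (fun z => window k z 0) A) l
      (𝓝 (ν'.map (fun z => window k z 0) A))) (c : ℝ) {δ : ℕ → ℝ≥0∞} (hδ : Tendsto δ l (𝓝 0))
    (hinv : ∀ n A, MeasurableSet A → ν n (IncrementPath.translate c ⁻¹' A) ≤ ν n A + δ n) :
    ν'.map (IncrementPath.translate c) = ν' := by
  have hmt := measurable_translate (d := d) c
  have hp := Measure.isProbabilityMeasure_map (μ := ν') hmt.aemeasurable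
  refine measure_ext_of_window fun k => ?_
  have hwk := measurable_window_left (d := d) k 0
  have hp₁ := Measure.isProbabilityMeasure_map (μ := ν'.map (IncrementPath.translate c))
    hwk.aemeasurable
  have hp₂ := Measure.isProbabilityMeasure_map (μ := ν') hwk.aemeasurable
  -- translates of events in one window are events in a larger one
  obtain ⟨m, hm⟩ := exists_nat_ge |c|
  have hloc : ∀ z : IncrementPath d, window k (IncrementPath.translate c (window (k + m) z 0)) 0 =
      window k (IncrementPath.translate c z) 0 := by
    intro z
    have hc := abs_le.1 hm
    refine window_zero_eq_iff.2 fun s hs t ht => window_apply_of_mem z 0 ?_ ?_ <;>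
      push_cast <;> constructor <;> linarith [hs.1, hs.2, ht.1, ht.2, hc.1, hc.2]
  have hle : ∀ A, MeasurableSet A → (ν'.map (IncrementPath.translate c)).map
      (fun z => window k z 0) A ≤ ν'.map (fun z => window k z 0) A := by
    intro A hA
    set B : Set (IncrementPath d) := (fun z => window k z 0) ⁻¹' A with hB
    have hBm : MeasurableSet B := hwk hA
    have hwkm := measurable_window_left (d := d) (k + m) 0
    have hpre : (fun z => window (k + m) z 0) ⁻¹' (IncrementPath.translate c ⁻¹' B) =
        IncrementPath.translate c ⁻¹' B := by
      ext z
      simp only [hB, mem_preimage, hloc]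
    have h1 : Tendsto (fun n => ν n (IncrementPath.translate c ⁻¹' B)) l
        (𝓝 (ν' (IncrementPath.translate c ⁻¹' B))) := by
      have := hlim (k + m) _ (hmt hBm)
      simpa only [Measure.map_apply hwkm (hmt hBm), hpre] using this
    have h2 : Tendsto (fun n => ν n B) l (𝓝 (ν' B)) := by
      have := hlim k A hA
      simpa only [Measure.map_apply hwk hA] using this
    rw [Measure.map_apply hwk hA, Measure.map_apply hwk hA, Measure.map_apply hmt hBm]
    have h3 := le_of_tendsto_of_tendsto' h1 (h2.add hδ) fun n => hinv n B hBm
    rwa [add_zero] at h3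
  ext A hA
  refine le_antisymm (hle A hA) ?_
  have h4 := hle Aᶜ hA.compl
  rw [prob_compl_eq_one_sub hA, prob_compl_eq_one_sub hA] at h4
  exact (ENNReal.sub_le_sub_iff_left prob_le_one ENNReal.one_ne_top).1 h4

theorem exists_gibbsMeasure_map_translate (hμ : IsBrownianIncrementLaw μ) (hW : IsAdmissible W)
    (lam : ℝ) : ∃ ν : Measure (IncrementPath d), IsGibbsMeasure (gibbsKernel μ W lam) ν ∧
      ∀ c : ℝ, ν.map (IncrementPath.translate c) = ν := by
  have := hμ.isProbabilityMeasure
  set l : Ultrafilter ℕ := hyperfilter ℕ with hl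
  have hlat : (l : Filter ℕ) ≤ atTop := Nat.hyperfilter_le_atTop
  have hνp := isProbabilityMeasure_averagedGibbs hμ hW lam
  choose m hmf hmac hm using fun k : ℕ =>
    exists_gibbsKernel_domination hμ hW lam (neg_window_le k)
  have hdom : ∀ k, ∀ᶠ n in (l : Filter ℕ), ∀ A, MeasurableSet A →
      refresh μ k (averagedGibbs μ W lam n) A ≤ m k A := by
    intro k
    refine hlat ?_
    filter_upwards [eventually_ge_atTop k] with n hn A hA
    have hkn : (k : ℝ) ≤ n := by exact_mod_cast hn
    have hinv := bind_averagedGibbs hμ hW lam (neg_window_le k) (n := n) (by linarith)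
      (by linarith)
    have hf := measurable_lintegral_window (μ := μ) k
      (measurable_one.indicator hA : Measurable (A.indicator (1 : IncrementPath d → ℝ≥0∞)))
    rw [refresh_apply k _ hA, ← hinv, Measure.lintegral_bind
      (measurable_gibbsKernel hW lam (neg_window_le k)).aemeasurable hf.aemeasurable]
    refine (lintegral_mono fun y => hm k y A hA).trans ?_
    simp
  obtain ⟨ν, hν, hlim⟩ := exists_local_limit hμ l (averagedGibbs μ W lam) m hmac hdom
  refine ⟨ν, (isSpecification_gibbsKernel hμ hW lam).isGibbsMeasure fun a b hab => ?_, fun c => ?_⟩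
  · refine bind_gibbsKernel_of_tendsto hμ hW lam hab.le hlim (hlat ?_)
    obtain ⟨na, hna⟩ := exists_mem_window a
    obtain ⟨nb, hnb⟩ := exists_mem_window b
    filter_upwards [eventually_ge_atTop na, eventually_ge_atTop nb] with n h1 h2
    exact bind_averagedGibbs hμ hW lam hab.le (hna n h1).1.le (hnb n h2).2.le
  · refine map_translate_of_tendsto hlim c (Tendsto.mono_left ?_ hlat) fun n A hA =>
      averagedGibbs_translate_le hμ hW lam n c hA
    have h1 : Tendsto (fun n : ℕ => ((n : ℝ) + 1)⁻¹) atTop (𝓝 0) := by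
      simpa using tendsto_one_div_add_atTop_nhds_zero_nat (𝕜 := ℝ)
    have h2 := (ENNReal.continuous_ofReal.tendsto _).comp h1
    rw [ENNReal.ofReal_zero] at h2
    simpa using ENNReal.Tendsto.mul_const (b := ENNReal.ofReal (2 * |c|)) h2
      (Or.inr ENNReal.ofReal_ne_top)

end Existence

end BrownianGibbs

theorem mainTheorem1 (d : ℕ) (μ : Measure (BrownianGibbs.IncrementPath d))
    (hμ : BrownianGibbs.IsBrownianIncrementLaw μ)
    (W : EuclideanSpace ℝ (Fin d) → ℝ → ℝ)
    (hW : Continuous fun p : EuclideanSpace ℝ (Fin d) × ℝ => W p.1 p.2)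
    (lam : ℝ)
    (hH1 : BrownianGibbs.H1 W) (hH2 : BrownianGibbs.H2 W)
    (hH1' : BrownianGibbs.H1 (BrownianGibbs.timeReversal W))
    (hH2' : BrownianGibbs.H2 (BrownianGibbs.timeReversal W)) :
    (∀ a b : ℝ, a < b → ∀ x y : BrownianGibbs.IncrementPath d,
      IntegrableOn (BrownianGibbs.interactionIntegrand W a b x y) (BrownianGibbs.cone a b)) ∧
    BrownianGibbs.IsSpecification (BrownianGibbs.gibbsKernel μ W lam) ∧
    ∃ ν : Measure (BrownianGibbs.IncrementPath d),
      BrownianGibbs.IsGibbsMeasure (BrownianGibbs.gibbsKernel μ W lam) ν ∧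
      ∀ a : ℝ, ν.map (BrownianGibbs.IncrementPath.translate a) = ν := by
  have hA : BrownianGibbs.IsAdmissible W := ⟨hW, hH1, hH2, hH1', hH2'⟩
  exact ⟨fun a b hab x y => (hA.integrable hab.le x y).integrableOn,
    BrownianGibbs.isSpecification_gibbsKernel hμ hA lam,
    BrownianGibbs.exists_gibbsMeasure_map_translate hμ hA lam⟩
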